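/- **Conventions.** A rooted planar map carries a root, which is an additional half-edge placed in a corner and not part of an edge; it is drawn as a head pointing to the root-vertex. A *tree* (planted plane tree) is a rooted planar map with a single face. The tour of a tree follows its border counterclockwise, starting and ending at the root. Rooted maps are considered up to orientation-preserving isomorphism. A *prefix-shuffle* is a word $w$ on $\{a,\bar a,b,\bar b\}$ such that every prefix $w'$ satisfies $|w'|_a\ge|w'|_{\bar a}$ and $|w'|_b\ge|w'|_{\bar b}$. Letters $a,\bar a$ (resp. $b,\bar b$) are paired as matching parentheses. Let $w^+$ be $w$ followed by $|w|_a-|w|_{\bar a}$ letters $\bar a$. **The prefix-map $M_w$.** Let $T_w$ be the tree whose tour is coded by the letters $a,\bar a$ of $w^+$ ($a$ when an edge is first followed, $\bar a$ the second time), with edges oriented away from the root. Reading $w$ during the tour of $T_w$, insert a head for each $b$ and a tail for each $\bar b$, and connect the heads and tails of paired letters. This gives $M_w$; the heads $h_1,\dots,h_k$ of the non-paired letters $b$ are *dangling*. The root counts as a head. The *rooting vertices* are the root-vertex and the ends of the edges of $T_w$ whose letter $a$ is not paired in $w$, ordered by first appearance in the tour of $T_w$. **The map $M_w^\bigstar$.**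 Replace each vertex $v$ of $M_w$ by a cell (a *black* face) with one vertex $x_h$ on its border for each head $h$ at $v$, in the cyclic order of these heads. The border of the cell consists of *permeable* edges, one from each $x_h$ to the $x_{h'}$ of the next head $h'$ counterclockwise around $v$. Each head $h$ is attached to $x_h$, and each tail at $v$ is attached to $x_h$ for the first head $h$ that follows it counterclockwise around $v$. The other faces are *white*; they correspond to the faces of $M_w$. The root and the root-face are inherited from $M_w$. The dangling heads are numbered $h_1,\dots,h_k$ in the order in which they are met around the root-face from the root. **The partition-tree $P_w$.** Its vertices are one vertex in each face of $M_w^\bigstar$ (the one in the root-face is $v_0$) and additional vertices $v_1,\dots,v_k$ in the root-face, with $v_i$ associated with $h_i$. Its edges are the duals of the permeable edges; at the root-face, the dual of a permeable edge $e$ ends at $v_i$ if $h_i$ is the last dangling head met before $e$ around the root-face, and at $v_0$ if no dangling head precedes $e$. The edges at a vertex drawn in a face are in the cyclic order induced by the border of the face. The root of $P_w$ is at $v_0$ and follows, in counterclockwise order, the dual of the first edge around the root-face. Vertices in black faces are *black*, the others (including $v_0,\dots,v_k$) are *white*. The *active* vertices are $v_0,\dots,v_k$, in this order, and the black vertices corresponding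 to rooting vertices, in the order of the rooting vertices. **The binary tree $\lambda_1(w)$.** Let $B_1$ be the binary tree with one node and two active leaves. Put $\lambda_1(\epsilon)=B_1$. The tree $\lambda_1(wa)$ (resp. $\lambda_1(wb)$) is obtained from $\lambda_1(w)$ by replacing the last active left leaf (resp. the first active right leaf) by $B_1$; the tree $\lambda_1(w\bar a)$ (resp. $\lambda_1(w\bar b)$) is obtained by inactivating the first active right leaf (resp. the last active left leaf). Counterclockwise around a node one finds the father (or the root), the left son and the right son. **The map $\theta$.** An edge of a binary tree $B$ is *branching* if one of its ends is a right son and the other is a left son or the root-vertex. The tree $\theta(B)$ is obtained from $B$ by contracting every non-branching edge. A leaf of $B$ is associated with the vertex of $\theta(B)$ into which it is contracted. **Proposition.** For every prefix-shuffle $w$: 1. the partition-tree $P_w$ is a tree; 2. each vertex of $\theta(\lambda_1(w))$ is associated with exactly one leaf of $\lambda_1(w)$; 3. $P_w=\theta(\lambda_1(w))$ as rooted plane trees. Moreover, if a vertex $x$ of $P_w$ is identified with the vertex of $\theta(\lambda_1(w))$ that is associated with the leaf $l$, then $x$ is active if and only if $l$ is active, $x$ is white if and only if $l$ is a left leaf,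 and $x$ is black if and only if $l$ is a right leaf. The order of the active white vertices is the order of appearance of the corresponding leaves around $\lambda_1(w)$, and the order of the active black vertices is the inverse of the order of appearance of the corresponding leaves. -/

import Mathlib

open Equiv

/-! ### Words -/

/-- The alphabet `{a, ā, b, b̄}`. -/
inductive Letter
  | a | abar | b | bbar
  deriving DecidableEq

/-- `u` is a parenthesis system on `{c, c'}` (`c` opens, `c'` closes). -/
def IsParenSystem (c c' : Letter) (u : List Letter) : Prop :=
  (∀ x ∈ u, x = c ∨ x = c') ∧ u.count c = u.count c' ∧ ∀ v, v <+: u → v.count c' ≤ v.count c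

/-- Every prefix has at least as many `a` as `ā` and at least as many `b` as `b̄`. -/
def IsPrefixShuffle (w : List Letter) : Prop :=
  ∀ v, v <+: w → v.count .abar ≤ v.count .a ∧ v.count .bbar ≤ v.count .b

/-- The subword on `{c, c'}` of the part of `u` strictly between the positions `i` and `j`. -/
def subwordBetween (c c' : Letter) (u : List Letter) (i j : ℕ) : List Letter :=
  ((u.drop (i + 1)).take (j - (i + 1))).filter (fun x => x = c ∨ x = c')

/-- The letter `c` at position `i` of `u` is paired with the letter `c'` at position `j`. -/
def IsPaired (c c' : Letter) (u : List Letter) (i j : ℕ) : Prop :=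
  i < j ∧ u[i]? = some c ∧ u[j]? = some c' ∧ IsParenSystem c c' (subwordBetween c c' u i j)

theorem drop_take_split (u : List Letter) {i j k : ℕ} (hij : i < j) (hjk : j < k)
    {x : Letter} (hx : u[j]? = some x) :
    (u.drop (i + 1)).take (k - (i + 1)) =
      (u.drop (i + 1)).take (j - (i + 1)) ++ x :: (u.drop (j + 1)).take (k - (j + 1)) := by
  have hj : j < u.length := by
    by_contra h
    rw [List.getElem?_eq_none (by omega)] at hx
    cases hx
  have e1 : k - (i + 1) = (j - (i + 1)) + ((k - (j + 1)) + 1) := by omega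
  rw [e1, List.take_add, List.drop_drop]
  have e2 : i + 1 + (j - (i + 1)) = j := by omega
  rw [e2, List.drop_eq_getElem_cons hj, List.take_succ_cons]
  rw [List.getElem?_eq_getElem hj] at hx
  cases hx
  rfl

theorem IsPaired.right_unique {c c' : Letter} (hc : c ≠ c') {u : List Letter} {i j k : ℕ}
    (h : IsPaired c c' u i j) (h' : IsPaired c c' u i k) : j = k := by
  have key : ∀ {j k : ℕ}, IsPaired c c' u i j → IsPaired c c' u i k → ¬ j < k := by
    intro j k h h' hjk
    obtain ⟨hij, -, hj, -, hbal, -⟩ := h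
    obtain ⟨-, -, -, -, -, hpre⟩ := h'
    have hs := drop_take_split u hij hjk hj
    have := hpre (subwordBetween c c' u i j ++ [c']) (by
      unfold subwordBetween
      rw [hs, List.filter_append, List.filter_cons]
      simp)
    simp [List.count_append, hbal, hc.symm] at this
  rcases lt_trichotomy j k with h1 | h1 | h1
  · exact absurd h1 (key h h')
  · exact h1
  · exact absurd h1 (key h' h)

theorem IsPaired.left_unique {c c' : Letter} (hc : c ≠ c') {u : List Letter} {i j k : ℕ}
    (h : IsPaired c c' u i k) (h' : IsPaired c c' u j k) : i = j := by
  have key : ∀ {i j : ℕ}, IsPaired c c' u i k → IsPaired c c' u j k → ¬ i < j := by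
    intro i j h h' hij
    obtain ⟨-, -, -, -, hbal, hpre⟩ := h
    obtain ⟨hjk, hj, -, -, hbal', -⟩ := h'
    have hs := drop_take_split u hij hjk hj
    have e : subwordBetween c c' u i k =
        subwordBetween c c' u i j ++ c :: subwordBetween c c' u j k := by
      unfold subwordBetween
      rw [hs, List.filter_append, List.filter_cons]
      simp
    have := hpre (subwordBetween c c' u i j) (by rw [e]; exact List.prefix_append _ _)
    rw [e] at hbal
    simp [List.count_append, hc] at hbal
    omega
  rcases lt_trichotomy i j with h1 | h1 | h1
  · exact absurd h1 (key h h')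
  · exact h1
  · exact absurd h1 (key h' h)

/-! ### Permutations -/

open Classical in
/-- The partner of `x` in a partial matching `R`, or `x` itself if it is unmatched. -/
noncomputable def partner {X : Type} (R : X → X → Prop) (x : X) : X :=
  if h : ∃ y, R x y then h.choose else x

theorem partner_eq {X : Type} {R : X → X → Prop} (hu : ∀ x y z, R x y → R x z → y = z) {x y : X}
    (h : R x y) : partner R x = y := by
  have h' : ∃ y, R x y := ⟨y, h⟩
  unfold partner
  rw [dif_pos h']
  exact hu _ _ _ h'.choose_spec h

theorem partner_of_not {X : Type} {R : X → X → Prop} {x : X} (h : ¬ ∃ y, R x y) :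
    partner R x = x := by
  unfold partner
  rw [dif_neg h]

theorem partner_involutive {X : Type} {R : X → X → Prop} (hs : ∀ x y, R x y → R y x)
    (hu : ∀ x y z, R x y → R x z → y = z) : Function.Involutive (partner R) := by
  intro x
  by_cases h : ∃ y, R x y
  · obtain ⟨y, hy⟩ := h
    rw [partner_eq hu hy, partner_eq hu (hs _ _ hy)]
  · rw [partner_of_not h, partner_of_not h]

/-- The involution exchanging the pairs of a partial matching `R` and fixing the unmatched
elements. -/
noncomputable def matchPerm {X : Type} (R : X → X → Prop) (hs : ∀ x y, R x y → R y x)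
    (hu : ∀ x y z, R x y → R x z → y = z) : Perm X :=
  (partner_involutive hs hu).toPerm

/-- The least `n ≥ 1` such that `(σ ^ n) x` carries the same label as `x`. -/
noncomputable def returnTime {X Y : Type} (σ : Perm X) (f : X → Y) (x : X) : ℕ :=
  sInf {n | 1 ≤ n ∧ f ((σ ^ n) x) = f x}

theorem returnTime_spec {X Y : Type} [Finite X] (σ : Perm X) (f : X → Y) (x : X) :
    1 ≤ returnTime σ f x ∧ f ((σ ^ returnTime σ f x) x) = f x :=
  Nat.sInf_mem (s := {n | 1 ≤ n ∧ f ((σ ^ n) x) = f x})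
    ⟨orderOf σ, orderOf_pos σ, by simp [pow_orderOf_eq_one]⟩

theorem returnTime_inv {X Y : Type} [Finite X] (σ : Perm X) (f : X → Y) (x : X) :
    returnTime σ⁻¹ f ((σ ^ returnTime σ f x) x) = returnTime σ f x := by
  obtain ⟨h1, h2⟩ := returnTime_spec σ f x
  have back : ∀ m ≤ returnTime σ f x,
      (σ⁻¹ ^ m) ((σ ^ returnTime σ f x) x) = (σ ^ (returnTime σ f x - m)) x := by
    intro m hm
    conv_lhs => rw [← Nat.add_sub_cancel' hm, pow_add]
    simp [Perm.mul_apply]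
  apply le_antisymm
  · refine Nat.sInf_le ⟨h1, ?_⟩
    rw [back _ le_rfl, h2]
    simp
  · obtain ⟨h3, h4⟩ := returnTime_spec σ⁻¹ f ((σ ^ returnTime σ f x) x)
    by_contra hlt
    push Not at hlt
    rw [back _ hlt.le, h2] at h4
    have := Nat.sInf_le (s := {n | 1 ≤ n ∧ f ((σ ^ n) x) = f x}) ⟨by omega, h4⟩
    change returnTime σ f x ≤ _ at this
    omega

/-- The first-return permutation: `x` goes to the first of `σ x`, `σ (σ x)`, … that carries the
same label as `x`. -/
noncomputable def returnPerm {X Y : Type} [Finite X] (σ : Perm X) (f : X → Y) : Perm X where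
  toFun x := (σ ^ returnTime σ f x) x
  invFun x := (σ⁻¹ ^ returnTime σ⁻¹ f x) x
  left_inv x := by
    beta_reduce
    rw [returnTime_inv]
    simp
  right_inv x := by
    have := returnTime_inv σ⁻¹ f x
    rw [inv_inv] at this
    beta_reduce
    rw [this]
    simp

theorem returnPerm_label {X Y : Type} [Finite X] (σ : Perm X) (f : X → Y) (x : X) :
    f (returnPerm σ f x) = f x :=
  (returnTime_spec σ f x).2

/-- The orbits (cycles, including fixed points) of a permutation. -/
abbrev Orbit {X : Type} (σ : Perm X) : Type := Quotient (Perm.SameCycle.setoid σ)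

/-- The orbit of `x`. -/
def orbitOf {X : Type} (σ : Perm X) (x : X) : Orbit σ := Quotient.mk _ x

/-! ### Rooted maps -/

/-- The data of a rooted map on a surface, as a rotation system: vertices `V`, half-edges `D`, the
vertex to which a half-edge is incident, the half-edge `cw d` following `d` in clockwise order
around its vertex, the other half `opp d` of the edge of `d`, and the root, which is a half-edge
that is not part of an edge. -/
structure RootedMap where
  V : Type
  D : Type
  finV : Finite V
  finD : Finite D
  vert : D → V
  cw : Perm D
  opp : Perm D
  root : D

attribute [instance] RootedMap.finV RootedMap.finD

namespace RootedMap

/-- Following a border: cross to the other half of the edge, then turn to the next half-edge around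
the vertex reached. The faces are the orbits. -/
def face (M : RootedMap) : Perm M.D := M.cw * M.opp

/-- The edges: the pairs `{d, opp d}`, with the root left out. -/
abbrev Edge (M : RootedMap) : Type := {e : Orbit M.opp // e ≠ orbitOf M.opp M.root}

/-- `M` is a rooted planar map: `opp` is an involution whose only fixed point is the root, `cw`
turns through all the half-edges of each vertex, `M` is connected, and Euler's formula holds. -/
structure IsPlanarMap (M : RootedMap) : Prop where
  opp_opp : ∀ d, M.opp (M.opp d) = d
  opp_eq_self : ∀ d, M.opp d = d ↔ d = M.root
  rotation : ∀ d e, M.vert d = M.vert e ↔ M.cw.SameCycle d e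
  connected : ∀ x y, Relation.ReflTransGen
    (fun x y => ∃ d, M.vert d = x ∧ M.vert (M.opp d) = y) x y
  euler : Nat.card M.V + Nat.card (Orbit M.face) = Nat.card M.Edge + 2

/-- A (planted plane) tree is a rooted planar map with a single face. -/
structure IsTree (M : RootedMap) : Prop extends M.IsPlanarMap where
  one_face : Nat.card (Orbit M.face) = 1

/-- Isomorphisms of rooted maps (they preserve the orientation). -/
structure Iso (M N : RootedMap) where
  onV : M.V ≃ N.V
  onD : M.D ≃ N.D
  vert_eq : ∀ d, N.vert (onD d) = onV (M.vert d)
  cw_eq : ∀ d, N.cw (onD d) = onD (M.cw d)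
  opp_eq : ∀ d, N.opp (onD d) = onD (M.opp d)
  root_eq : onD M.root = N.root

/-- The map obtained by contracting the edges whose half-edges are in `S`: the ends of these edges
are identified, and turning around a vertex one crosses the contracted edges. -/
noncomputable def contract (M : RootedMap) (S : M.D → Prop) (hS : ∀ d, S (M.opp d) ↔ S d)
    (hroot : ¬ S M.root) : RootedMap where
  V := Quot (fun x y => ∃ d, S d ∧ M.vert d = x ∧ M.vert (M.opp d) = y)
  D := {d // ¬ S d}
  finV := Quot.finite _
  finD := inferInstance
  vert d := Quot.mk _ (M.vert d.1)
  cw := (returnPerm M.face S).subtypePerm (p := fun d => ¬ S d)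
      (fun d => not_congr (iff_of_eq (returnPerm_label M.face S d)))
    * (M.opp.subtypePerm (p := fun d => ¬ S d) (fun d => not_congr (hS d)))⁻¹
  opp := M.opp.subtypePerm (p := fun d => ¬ S d) (fun d => not_congr (hS d))
  root := ⟨M.root, hroot⟩

end RootedMap

/-! ### Binary trees -/

inductive Side
  | left | right
  deriving DecidableEq

/-- A binary tree whose leaves are active (`true`) or inactive (`false`). -/
inductive BinTree
  | leaf (active : Bool)
  | node (l r : BinTree)

namespace BinTree

/-- A vertex is addressed by the sides taken on the way from it up to the root-vertex: `s :: p` is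
the son on side `s` of `p`, and `[]` is the root-vertex. -/
abbrev Address := List Side

/-- The subtree hanging from the root-vertex on a side, if this is a node. -/
def son : BinTree → Side → Option BinTree
  | leaf _, _ => none
  | node l _, .left => some l
  | node _ r, .right => some r

/-- The subtree hanging at an address. -/
def sub (B : BinTree) : Address → Option BinTree
  | [] => some B
  | s :: p => (sub B p).bind (fun C => C.son s)

def IsVertex (B : BinTree) (p : Address) : Prop := (B.sub p).isSome

def IsNode (B : BinTree) (p : Address) : Prop := ∃ l r, B.sub p = some (node l r)

def IsLeaf (B : BinTree) (p : Address) : Prop := ∃ act, B.sub p = some (leaf act)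

theorem isVertex_cons (B : BinTree) (s : Side) (p : Address) :
    B.IsVertex (s :: p) ↔ B.IsNode p := by
  unfold IsVertex IsNode
  rw [sub]
  rcases B.sub p with _ | ⟨_ | ⟨l, r⟩⟩ <;> cases s <;> simp [son]

theorem IsNode.isVertex {B : BinTree} {p : Address} (h : B.IsNode p) : B.IsVertex p := by
  obtain ⟨l, r, h⟩ := h
  simp [IsVertex, h]

theorem IsLeaf.isVertex {B : BinTree} {p : Address} (h : B.IsLeaf p) : B.IsVertex p := by
  obtain ⟨_, h⟩ := h
  simp [IsVertex, h]

theorem isVertex_tail {B : BinTree} {p : Address} (h : B.IsVertex p) : B.IsVertex p.tail := by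
  cases p with
  | nil => exact h
  | cons s p => exact ((isVertex_cons B s p).1 h).isVertex

def depth : BinTree → ℕ
  | leaf _ => 0
  | node l r => max l.depth r.depth + 1

theorem length_add_depth_le (B : BinTree) :
    ∀ (p : Address) (C : BinTree), B.sub p = some C → p.length + C.depth ≤ B.depth := by
  intro p
  induction p with
  | nil => intro C h; simp only [sub, Option.some.injEq] at h; subst h; simp
  | cons s p ih =>
    intro C h
    rw [sub] at h
    rcases hp : B.sub p with _ | ⟨_ | ⟨l, r⟩⟩ <;> simp only [hp, Option.bind] at h <;>
      cases s <;> simp [son] at h <;>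
      subst h <;> have := ih _ hp <;> simp only [depth, List.length_cons] at this ⊢ <;> omega

instance : Finite Side :=
  Finite.of_injective (fun s : Side => decide (s = .left)) (by
    intro s t; cases s <;> cases t <;> simp)

instance (B : BinTree) : Finite {p // B.IsVertex p} :=
  Set.Finite.subset (List.finite_length_le Side B.depth) (by
    intro p hp
    obtain ⟨C, hC⟩ := Option.isSome_iff_exists.1 hp
    have := B.length_add_depth_le p C hC
    simp only [Set.mem_ofPred_eq]
    omega)

/-- The half-edges of `B`: the half-edge `(p, false)` of the vertex `p` in the direction of its
father (this is the root for `p = []`), and the half-edge `(p, true)` of the father of `p ≠ []` in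
the direction of `p`. -/
abbrev HalfEdge (B : BinTree) : Type :=
  {d : Address × Bool // B.IsVertex d.1 ∧ (d.2 = true → d.1 ≠ [])}

open Classical in
/-- Clockwise around a node: father (or root), right son, left son. -/
noncomputable def cwFun (B : BinTree) : Address × Bool → Address × Bool
  | (p, false) => if B.IsNode p then (.right :: p, true) else (p, false)
  | (.right :: p, true) => (.left :: p, true)
  | (.left :: p, true) => (p, false)
  | ([], true) => ([], true)

open Classical in
/-- Counterclockwise around a node: father (or root), left son, right son. -/
noncomputable def ccwFun (B : BinTree) : Address × Bool → Address × Bool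
  | (p, false) => if B.IsNode p then (.left :: p, true) else (p, false)
  | (.left :: p, true) => (.right :: p, true)
  | (.right :: p, true) => (p, false)
  | ([], true) => ([], true)

noncomputable def cw (B : BinTree) : Perm B.HalfEdge where
  toFun d := ⟨B.cwFun d.1, by
    obtain ⟨⟨p, _ | _⟩, h1, h2⟩ := d
    · by_cases h : B.IsNode p
      · simp [cwFun, h, isVertex_cons]
      · simpa [cwFun, h] using h1
    · rcases p with _ | ⟨_ | _, p⟩
      · simp at h2
      · simpa [cwFun] using isVertex_tail h1
      · simpa [cwFun, isVertex_cons] using h1⟩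
  invFun d := ⟨B.ccwFun d.1, by
    obtain ⟨⟨p, _ | _⟩, h1, h2⟩ := d
    · by_cases h : B.IsNode p
      · simp [ccwFun, h, isVertex_cons]
      · simpa [ccwFun, h] using h1
    · rcases p with _ | ⟨_ | _, p⟩
      · simp at h2
      · simpa [ccwFun, isVertex_cons] using h1
      · simpa [ccwFun] using isVertex_tail h1⟩
  left_inv d := by
    obtain ⟨⟨p, _ | _⟩, h1, h2⟩ := d
    · by_cases h : B.IsNode p
      · simp [cwFun, ccwFun, h]
      · simp [cwFun, ccwFun, h]
    · rcases p with _ | ⟨_ | _, p⟩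
      · simp at h2
      · have h : B.IsNode p := (isVertex_cons B _ p).1 h1
        simp [cwFun, ccwFun, h]
      · simp [cwFun, ccwFun]
  right_inv d := by
    obtain ⟨⟨p, _ | _⟩, h1, h2⟩ := d
    · by_cases h : B.IsNode p
      · simp [cwFun, ccwFun, h]
      · simp [cwFun, ccwFun, h]
    · rcases p with _ | ⟨_ | _, p⟩
      · simp at h2
      · simp [cwFun, ccwFun]
      · have h : B.IsNode p := (isVertex_cons B _ p).1 h1
        simp [cwFun, ccwFun, h]

open Classical in
/-- The other half of the edge of a half-edge; the root is fixed. -/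
noncomputable def oppFun (B : BinTree) (d : B.HalfEdge) : B.HalfEdge :=
  if h : d.1.1 = [] then d else ⟨(d.1.1, !d.1.2), d.2.1, fun _ => h⟩

theorem oppFun_fst (B : BinTree) (d : B.HalfEdge) : (B.oppFun d).1.1 = d.1.1 := by
  unfold oppFun
  split_ifs <;> rfl

theorem oppFun_involutive (B : BinTree) : Function.Involutive B.oppFun := by
  intro d
  by_cases h : d.1.1 = []
  · simp [oppFun, h]
  · simp [oppFun, h]

noncomputable def opp (B : BinTree) : Perm B.HalfEdge := B.oppFun_involutive.toPerm

theorem opp_fst (B : BinTree) (d : B.HalfEdge) : (B.opp d).1.1 = d.1.1 := B.oppFun_fst d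

/-- The binary tree as a rooted map. -/
noncomputable def toMap (B : BinTree) : RootedMap where
  V := {p // B.IsVertex p}
  D := B.HalfEdge
  finV := inferInstance
  finD := Finite.of_injective
    (fun d : B.HalfEdge => ((⟨d.1.1, d.2.1⟩ : {p // B.IsVertex p}), d.1.2)) (by
      intro d e h
      simp only [Prod.mk.injEq, Subtype.mk.injEq] at h
      exact Subtype.ext (Prod.ext h.1 h.2))
  vert d := if d.1.2 then ⟨d.1.1.tail, isVertex_tail d.2.1⟩ else ⟨d.1.1, d.2.1⟩
  cw := B.cw
  opp := B.opp
  root := ⟨([], false), by simp [IsVertex, sub]⟩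

def IsLeftSon (p : Address) : Prop := p.head? = some .left

def IsRightSon (p : Address) : Prop := p.head? = some .right

/-- The edge from `p ≠ []` to its father is branching: one of its ends is a right son and the other
is a left son or the root-vertex. -/
def IsBranching (p : Address) : Prop :=
  p ≠ [] ∧ ((IsRightSon p ∧ (IsLeftSon p.tail ∨ p.tail = [])) ∨
    (IsRightSon p.tail ∧ IsLeftSon p))

/-- The half-edges of the non-branching edges. -/
def IsNonBranching {B : BinTree} (d : B.HalfEdge) : Prop := d.1.1 ≠ [] ∧ ¬ IsBranching d.1.1

theorem isNonBranching_opp {B : BinTree} (d : B.HalfEdge) :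
    IsNonBranching (B.opp d) ↔ IsNonBranching d := by
  unfold IsNonBranching
  rw [opp_fst]

/-- The tree `θ(B)`: every non-branching edge of `B` is contracted. -/
noncomputable def theta (B : BinTree) : RootedMap :=
  B.toMap.contract IsNonBranching isNonBranching_opp (fun h => h.1 rfl)

/-- The leaves of `B`. -/
abbrev Leaf (B : BinTree) : Type := {p // B.IsLeaf p}

def Leaf.IsActive {B : BinTree} (l : B.Leaf) : Prop := B.sub l.1 = some (leaf true)

/-- The vertex of `θ(B)` associated with a leaf `l`: the vertex into which `l` is contracted. (The
edges on the way up from `l` are contracted until the branching edge `e(l)` is met, if any, so this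
is the son of `e(l)`, or the root-vertex if there is no such edge.) -/
noncomputable def Leaf.vertex {B : BinTree} (l : B.Leaf) : B.theta.V :=
  Quot.mk _ (⟨l.1, l.2.isVertex⟩ : {p // B.IsVertex p})

/-- The leaves with their activities, in the order of appearance around the tree; `p` is the address
of the root-vertex of `B` in an ambient tree. -/
def leavesFrom (p : Address) : BinTree → List (Address × Bool)
  | leaf act => [(p, act)]
  | node l r => leavesFrom (.left :: p) l ++ leavesFrom (.right :: p) r

/-- All the leaves in the order of appearance around the tree. -/
def leafList (B : BinTree) : List Address := (leavesFrom [] B).map Prod.fst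

/-- The active leaves on side `s` in the order of appearance around the tree. -/
def activeLeaves (B : BinTree) (s : Side) : List Address :=
  ((leavesFrom [] B).filter (fun x => x.2 && decide (x.1.head? = some s))).map Prod.fst

/-- The leaf `l` precedes the leaf `l'` around `B`. -/
def Leaf.Precedes {B : BinTree} (l l' : B.Leaf) : Prop :=
  B.leafList.idxOf l.1 < B.leafList.idxOf l'.1

/-- Replace by `C` the subtree to which one descends along the given sides. -/
def replaceDown : BinTree → List Side → BinTree → BinTree
  | _, [], C => C
  | node l r, .left :: q, C => node (replaceDown l q C) r
  | node l r, .right :: q, C => node l (replaceDown r q C)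
  | leaf act, _ :: _, _ => leaf act

/-- Replace the subtree at an address, if there is one. -/
def replaceAt (B : BinTree) (p : Option Address) (C : BinTree) : BinTree :=
  match p with
  | some p => B.replaceDown p.reverse C
  | none => B

/-- The binary tree `B₁` with one node and two active leaves. -/
def B₁ : BinTree := node (leaf true) (leaf true)

/-- The effect of a letter appended to the word. -/
def step (B : BinTree) : Letter → BinTree
  | .a => B.replaceAt (B.activeLeaves .left).getLast? B₁
  | .b => B.replaceAt (B.activeLeaves .right).head? B₁
  | .abar => B.replaceAt (B.activeLeaves .right).head? (leaf false)
  | .bbar => B.replaceAt (B.activeLeaves .left).getLast? (leaf false)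

end BinTree

/-- The binary tree `λ₁(w)`. -/
def lambda₁ (w : List Letter) : BinTree := w.foldl BinTree.step BinTree.B₁

/-! ### The prefix-map `M_w` -/

namespace PrefixMap

/-- The word `w⁺`: `w` followed by as many letters `ā` as there are non-paired letters `a`. -/
def plus (w : List Letter) : List Letter :=
  w ++ List.replicate (w.count .a - w.count .abar) .abar

/-- The half-edges of `M_w`, in the order in which the tour of `T_w` meets them: `0` is the root,
and `i + 1` is the half-edge that is met when the letter at position `i` of `w⁺` is written. This is
the tail of a tree edge for `a` (the edge is followed for the first time, from the father to the
son), the head of a tree edge for `ā`, a head not in the tree for `b`, a tail not in the tree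
for `b̄`. -/
abbrev HalfEdge (w : List Letter) : Type := Fin ((plus w).length + 1)

def root (w : List Letter) : HalfEdge w := 0

/-- `d` carries the letter `c`. -/
def HasLetter (w : List Letter) (d : HalfEdge w) (c : Letter) : Prop :=
  ∃ i, d.val = i + 1 ∧ (plus w)[i]? = some c

/-- The letters of `d` and `e` are paired, in one order or the other. -/
def Linked (w : List Letter) (c c' : Letter) (d e : HalfEdge w) : Prop :=
  ∃ i j, d.val = i + 1 ∧ e.val = j + 1 ∧
    (IsPaired c c' (plus w) i j ∨ IsPaired c c' (plus w) j i)

theorem Linked.symm {w : List Letter} {c c' : Letter} {d e : HalfEdge w}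
    (h : Linked w c c' d e) : Linked w c c' e d := by
  obtain ⟨i, j, h1, h2, h3⟩ := h
  exact ⟨j, i, h2, h1, h3.symm⟩

theorem Linked.letter {w : List Letter} {c c' : Letter} {d e : HalfEdge w}
    (h : Linked w c c' d e) : HasLetter w d c ∨ HasLetter w d c' := by
  obtain ⟨i, j, h1, h2, h3 | h3⟩ := h
  · exact Or.inl ⟨i, h1, h3.2.1⟩
  · exact Or.inr ⟨i, h1, h3.2.2.1⟩

theorem HasLetter.unique {w : List Letter} {c c' : Letter} {d : HalfEdge w}
    (h : HasLetter w d c) (h' : HasLetter w d c') : c = c' := by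
  obtain ⟨i, h1, h2⟩ := h
  obtain ⟨j, h3, h4⟩ := h'
  obtain rfl : i = j := by omega
  rw [h2] at h4
  exact Option.some.inj h4

theorem Linked.unique {w : List Letter} {c c' : Letter} (hc : c ≠ c') {d e f : HalfEdge w}
    (h : Linked w c c' d e) (h' : Linked w c c' d f) : e = f := by
  obtain ⟨i, j, h1, h2, h3⟩ := h
  obtain ⟨i', k, h1', h2', h3'⟩ := h'
  obtain rfl : i = i' := by omega
  have : j = k := by
    rcases h3 with h3 | h3 <;> rcases h3' with h3' | h3'
    · exact h3.right_unique hc h3'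
    · exact absurd (Option.some.inj (h3.2.1.symm.trans h3'.2.2.1)) hc
    · exact absurd (Option.some.inj (h3'.2.1.symm.trans h3.2.2.1)) hc
    · exact h3.left_unique hc h3'
  subst this
  exact Fin.ext (by omega)

/-- The involution exchanging the two halves of each edge of the tree `T_w`. -/
noncomputable def treeOpp (w : List Letter) : Perm (HalfEdge w) :=
  matchPerm (Linked w .a .abar) (fun _ _ h => h.symm) (fun _ _ _ h h' => h.unique (by simp) h')

/-- The half-edge following `d` in counterclockwise order around its vertex. The tour of `T_w` goes
counterclockwise around the tree. When it meets a half-edge `d`, it follows the edge of `d` if this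
is in the tree, crosses `d` otherwise, and then meets the next half-edge in counterclockwise order
after the half-edge `treeOpp w d` on which it has arrived. As the tour meets the half-edges in
cyclic order, `ccw w (treeOpp w d) = d + 1`. -/
noncomputable def ccw (w : List Letter) : Perm (HalfEdge w) :=
  finRotate _ * (treeOpp w)⁻¹

/-- The involution exchanging the two halves of each edge of `M_w`: the edges in `T_w`, and the
edges made of the heads and tails of paired letters `b` and `b̄`. -/
noncomputable def opp (w : List Letter) : Perm (HalfEdge w) :=
  matchPerm (fun d e => Linked w .a .abar d e ∨ Linked w .b .bbar d e)
    (fun _ _ h => h.imp Linked.symm Linked.symm) (by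
      rintro d e f (h | h) (h' | h')
      · exact h.unique (by simp) h'
      · exfalso
        rcases h.letter with h | h <;> rcases h'.letter with h' | h' <;> cases h.unique h'
      · exfalso
        rcases h.letter with h | h <;> rcases h'.letter with h' | h' <;> cases h.unique h'
      · exact h.unique (by simp) h')

theorem opp_root (w : List Letter) : opp w (root w) = root w := by
  change partner (fun d e => Linked w .a .abar d e ∨ Linked w .b .bbar d e) (root w) = root w
  refine partner_of_not ?_
  rintro ⟨y, h | h⟩ <;>
  · obtain ⟨i, _, h, _⟩ := h
    simp [root] at h

/-- The heads; the root is one of them. The other half-edges are tails. -/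
def IsHead (w : List Letter) (d : HalfEdge w) : Prop :=
  d = root w ∨ HasLetter w d .abar ∨ HasLetter w d .b

abbrev Head (w : List Letter) : Type := {d : HalfEdge w // IsHead w d}

def rootHead (w : List Letter) : Head w := ⟨root w, Or.inl rfl⟩

/-- The dangling heads: the heads of the non-paired letters `b`. -/
def IsDangling (w : List Letter) (d : HalfEdge w) : Prop :=
  HasLetter w d .b ∧ ¬ ∃ e, Linked w .b .bbar d e

/-- The rooting heads: the root, and the heads of the active edges, that is, of the tree edges of
which the letter `a` is not paired in `w`. -/
def IsRooting (w : List Letter) (d : HalfEdge w) : Prop :=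
  d = root w ∨ ∃ i j, d.val = j + 1 ∧ IsPaired .a .abar (plus w) i j ∧
    ¬ ∃ k, IsPaired .a .abar w i k

/-- The time at which the vertex of `d` first appears in the tour of `T_w`. -/
noncomputable def firstVisit (w : List Letter) (d : HalfEdge w) : ℕ :=
  sInf {n | ∃ e : HalfEdge w, (ccw w).SameCycle d e ∧ e.val = n}

/-! ### The exploded map `M★_w` -/

/-- The head following a head in counterclockwise order around its vertex in `M_w`. -/
noncomputable def nextHead (w : List Letter) : Perm (Head w) :=
  (returnPerm (ccw w) (IsHead w)).subtypePerm
    (fun d => iff_of_eq (returnPerm_label (ccw w) (IsHead w) d))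

/-- The half-edges of `M★_w`: those of `M_w`, and two for every permeable edge. A vertex `v` of `M_w`
is replaced by a cell (a black face) with one vertex `x_h` on its border for each head `h` at `v`.
These vertices are in the cyclic order of the heads around `v`, and the border of the cell consists
of one permeable edge from `x_h` to `x_{h'}` for each `h`, where `h' = nextHead h`. `near h` is the
half of this edge at `x_h`, and `far h` the half at `x_{h'}`. -/
abbrev StarHalfEdge (w : List Letter) : Type := HalfEdge w ⊕ (Head w ⊕ Head w)

def old {w : List Letter} (d : HalfEdge w) : StarHalfEdge w := Sum.inl d

def near {w : List Letter} (h : Head w) : StarHalfEdge w := Sum.inr (Sum.inl h)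

def far {w : List Letter} (h : Head w) : StarHalfEdge w := Sum.inr (Sum.inr h)

/-- The two halves of an edge of `M★_w`. -/
noncomputable def starOpp (w : List Letter) : Perm (StarHalfEdge w) :=
  Equiv.sumCongr (opp w) (Equiv.sumComm (Head w) (Head w))

open Classical in
/-- Counterclockwise order around the vertices of `M★_w`. A tail is attached to `x_h` for the first
head `h` that follows it counterclockwise in `M_w`. Around `x_h` there are, in this order: `h`; the
permeable edge to the next head; the black cell; the permeable edge from the previous head `h₀`; the
tails between `h₀` and `h` in the order of `M_w`. -/
noncomputable def starCcw (w : List Letter) : Perm (StarHalfEdge w) where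
  toFun
    | Sum.inl d => if h : IsHead w d then near ⟨d, h⟩ else old (ccw w d)
    | Sum.inr (Sum.inl h) => far ((nextHead w).symm h)
    | Sum.inr (Sum.inr h) => old (ccw w h.1)
  invFun
    | Sum.inl d => if h : IsHead w ((ccw w).symm d) then far ⟨_, h⟩ else old ((ccw w).symm d)
    | Sum.inr (Sum.inl h) => old h.1
    | Sum.inr (Sum.inr h) => near (nextHead w h)
  left_inv := by
    rintro (d | h | h)
    · by_cases hd : IsHead w d <;> simp [hd, near, old]
    · simp [near, far]
    · simp [far, old, h.2]
  right_inv := by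
    rintro (d | h | h)
    · by_cases hd : IsHead w ((ccw w).symm d) <;> simp [hd, far, old]
    · simp [old, near, h.2]
    · simp [near, far]

/-- Following the border of the faces of `M★_w`. The border of the root-face is followed from the
root in the direction of the tour of `T_w`. As one turns to the next half-edge counterclockwise at
each vertex, the face is on the right, and its border is followed clockwise around its inner
points. -/
noncomputable def starFace (w : List Letter) : Perm (StarHalfEdge w) := starCcw w * starOpp w

/-- The faces of `M★_w`. -/
abbrev Face (w : List Letter) : Type := Orbit (starFace w)

noncomputable def faceOf {w : List Letter} (d : StarHalfEdge w) : Face w := orbitOf (starFace w) d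

noncomputable def rootFace (w : List Letter) : Face w := faceOf (old (root w))

/-- The white faces correspond to the faces of `M_w`: there are half-edges of `M_w` on their
border. -/
def IsWhiteFace {w : List Letter} (f : Face w) : Prop := ∃ d : HalfEdge w, f = faceOf (old d)

/-- The black face corresponding to the vertex of `M_w` to which the head `h` is incident. -/
noncomputable def cell {w : List Letter} (h : Head w) : Face w := faceOf (far h)

/-- The black faces correspond to the vertices of `M_w`. -/
def IsBlackFace {w : List Letter} (f : Face w) : Prop := ∃ h : Head w, f = cell h

/-- The number of steps after which `d` is met around the root-face, starting from the root. -/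
noncomputable def rank {w : List Letter} (d : StarHalfEdge w) : ℕ :=
  sInf {n | ((starFace w) ^ n) (old (root w)) = d}

/-! ### The partition-tree `P_w` -/

abbrev Dangling (w : List Letter) : Type := {d : HalfEdge w // IsDangling w d}

/-- The vertices of `P_w`: one in each face of `M★_w`, and one more for each dangling head. -/
abbrev PVertex (w : List Letter) : Type := Face w ⊕ Dangling w

/-- The exterior vertex `v₀`. -/
noncomputable def exterior (w : List Letter) : PVertex w := Sum.inl (rootFace w)

/-- The half-edges of `P_w`: its root, which is identified with the root of `M★_w`, and for each
half `d` of a permeable edge, one half of the dual edge, which is in the face that has `d` on its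
border. -/
def IsPHalfEdge {w : List Letter} (d : StarHalfEdge w) : Prop :=
  d = old (root w) ∨ (∃ h, d = near h) ∨ ∃ h, d = far h

/-- `h` is the last dangling head encountered before `d` around the root-face. -/
def IsLastDanglingBefore {w : List Letter} (h : Dangling w) (d : StarHalfEdge w) : Prop :=
  (faceOf (old h.1) = rootFace w ∧ rank (old h.1) < rank d) ∧
    ∀ h' : Dangling w, faceOf (old h'.1) = rootFace w → rank (old h'.1) < rank d →
      rank (old h'.1) ≤ rank (old h.1)

open Classical in
/-- The vertex of `P_w` to which a half-edge of `P_w` is incident. -/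
noncomputable def pvert {w : List Letter} (d : StarHalfEdge w) : PVertex w :=
  if faceOf d = rootFace w then
    if h : ∃ h : Dangling w, IsLastDanglingBefore h d then Sum.inr h.choose else exterior w
  else Sum.inl (faceOf d)

open Classical in
/-- Half-edges of `P_w` are labelled by the vertex to which they are incident. -/
noncomputable def plabel {w : List Letter} (d : StarHalfEdge w) : Option (PVertex w) :=
  if IsPHalfEdge d then some (pvert d) else none

theorem plabel_isSome {w : List Letter} (d : StarHalfEdge w) :
    (plabel d).isSome ↔ IsPHalfEdge d := by
  unfold plabel
  split_ifs with h <;> simp [h]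

theorem isPHalfEdge_return {w : List Letter} (d : StarHalfEdge w) :
    IsPHalfEdge (returnPerm (starFace w) plabel d) ↔ IsPHalfEdge d := by
  rw [← plabel_isSome, ← plabel_isSome, returnPerm_label (starFace w) plabel d]

theorem isPHalfEdge_starOpp {w : List Letter} (d : StarHalfEdge w) :
    IsPHalfEdge (starOpp w d) ↔ IsPHalfEdge d := by
  rcases d with d | h | h
  · have : opp w d = root w ↔ d = root w := by
      rw [← (opp w).injective.eq_iff (a := d), opp_root]
    simp [IsPHalfEdge, starOpp, old, near, far, this]
  · simp [IsPHalfEdge, starOpp, old, near, far]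
  · simp [IsPHalfEdge, starOpp, old, near, far]

/-- The partition-tree `P_w`. The half-edges at a vertex drawn in a face are in the order in which
the border of the face is followed, which is clockwise. In particular the dual of the first edge
around the root-face follows the root in clockwise order around `v₀`. -/
noncomputable def partitionTree (w : List Letter) : RootedMap where
  V := PVertex w
  D := {d : StarHalfEdge w // IsPHalfEdge d}
  finV := inferInstance
  finD := inferInstance
  vert d := pvert d.1
  cw := (returnPerm (starFace w) plabel).subtypePerm isPHalfEdge_return
  opp := (starOpp w).subtypePerm isPHalfEdge_starOpp
  root := ⟨old (root w), Or.inl rfl⟩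

/-- The white vertices of `P_w`. -/
def IsWhite {w : List Letter} : PVertex w → Prop
  | Sum.inl f => IsWhiteFace f
  | Sum.inr _ => True

/-- The black vertices of `P_w`. -/
def IsBlack {w : List Letter} : PVertex w → Prop
  | Sum.inl f => IsBlackFace f
  | Sum.inr _ => False

/-- The active vertices: `v₀`, the vertices associated with the dangling heads, and the black
vertices corresponding to the rooting vertices of `M_w`. -/
def IsActive {w : List Letter} : PVertex w → Prop
  | Sum.inl f => f = rootFace w ∨ ∃ h : Head w, IsRooting w h.1 ∧ f = cell h
  | Sum.inr _ => True

/-- The position of an active white vertex around the root-face: that of its dangling head, and `0`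
for `v₀`. -/
noncomputable def whiteRank {w : List Letter} : PVertex w → ℕ
  | Sum.inl _ => 0
  | Sum.inr h => rank (old h.1)

/-- The order on active white vertices: `v₀` comes first, and the others are in the order in which
their dangling heads are encountered around the root-face. -/
def WhitePrecedes {w : List Letter} (x y : PVertex w) : Prop :=
  (IsWhite x ∧ IsActive x) ∧ (IsWhite y ∧ IsActive y) ∧ whiteRank x < whiteRank y

/-- The order on active black vertices: the order of appearance of the rooting vertices around
`T_w`. -/
def BlackPrecedes {w : List Letter} (x y : PVertex w) : Prop :=
  ∃ h h' : Head w, IsRooting w h.1 ∧ IsRooting w h'.1 ∧ x = Sum.inl (cell h) ∧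
    y = Sum.inl (cell h') ∧ firstVisit w h.1 < firstVisit w h'.1

end PrefixMap

/-! ### First-return permutations -/

/-- `y` is reached from `x` by iterating `σ` at least once, with all the intermediate points
in `S`. -/
inductive Via {X : Type} (σ : Perm X) (S : X → Prop) (x : X) : X → Prop
  | one : Via σ S x (σ x)
  | next {y : X} : Via σ S x y → S y → Via σ S x (σ y)

theorem Via.exists_pow {X : Type} {σ : Perm X} {S : X → Prop} {x y : X} (h : Via σ S x y) :
    ∃ n, 1 ≤ n ∧ (σ ^ n) x = y ∧ ∀ m, 1 ≤ m → m < n → S ((σ ^ m) x) := by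
  induction h with
  | one => exact ⟨1, le_rfl, by simp, fun m h1 h2 => by omega⟩
  | @next y _ hS ih =>
    obtain ⟨n, h1, h2, h3⟩ := ih
    refine ⟨n + 1, by omega, by rw [pow_succ', Perm.mul_apply, h2], fun m hm1 hm2 => ?_⟩
    rcases Nat.lt_succ_iff_lt_or_eq.1 hm2 with h | rfl
    · exact h3 m hm1 h
    · rwa [h2]

theorem Via.returnPerm_eq {X Y : Type} [Finite X] {σ : Perm X} {S : X → Prop} {f : X → Y}
    {x y : X} (h : Via σ S x y) (hS : ∀ z, S z → f z ≠ f x) (hy : f y = f x) :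
    returnPerm σ f x = y := by
  obtain ⟨n, h1, h2, h3⟩ := h.exists_pow
  have hn : returnTime σ f x = n := by
    apply le_antisymm
    · exact Nat.sInf_le ⟨h1, by rw [h2, hy]⟩
    · by_contra hlt
      push Not at hlt
      obtain ⟨h4, h5⟩ := returnTime_spec σ f x
      exact hS _ (h3 _ h4 hlt) h5
  change (σ ^ returnTime σ f x) x = y
  rw [hn, h2]

theorem Via.one' {X : Type} {σ : Perm X} {S : X → Prop} {x y : X} (h : σ x = y) : Via σ S x y :=
  h ▸ Via.one

theorem Via.next' {X : Type} {σ : Perm X} {S : X → Prop} {x y z : X} (h : Via σ S x y) (hS : S y)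
    (hz : σ y = z) : Via σ S x z :=
  hz ▸ h.next hS

theorem Via.invariant {X Y : Type} {σ : Perm X} {S : X → Prop} {x y : X} (h : Via σ S x y)
    (g : X → Y) (hg : ∀ z, S z → g (σ z) = g z) : g y = g (σ x) := by
  induction h with
  | one => rfl
  | next _ hS ih => rw [hg _ hS, ih]

theorem via_returnPerm {X Y : Type} [Finite X] (σ : Perm X) (f : X → Y) (x : X) :
    Via σ (fun z => f z ≠ f x) x (returnPerm σ f x) := by
  have key : ∀ n, n + 1 ≤ returnTime σ f x → Via σ (fun z => f z ≠ f x) x ((σ ^ (n + 1)) x) := by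
    intro n
    induction n with
    | zero => exact fun _ => Via.one' (by simp)
    | succ n ih =>
      intro h
      refine (ih (by omega)).next' (fun he => ?_) (by rw [← Perm.mul_apply, ← pow_succ'])
      have : returnTime σ f x ≤ n + 1 := Nat.sInf_le ⟨by omega, he⟩
      omega
  have h1 := (returnTime_spec σ f x).1
  have := key (returnTime σ f x - 1) (by omega)
  rwa [Nat.sub_add_cancel h1] at this

theorem returnPerm_sameCycle {X Y : Type} [Finite X] (σ : Perm X) (f : X → Y) (x : X) :
    σ.SameCycle x (returnPerm σ f x) :=
  ⟨returnTime σ f x, by simp [returnPerm]⟩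

/-- Two points of the same orbit with the same label are in the same orbit of the first-return
permutation. -/
theorem sameCycle_returnPerm {X Y : Type} [Finite X] {σ : Perm X} {f : X → Y} {x y : X}
    (h : σ.SameCycle x y) (hf : f x = f y) : (returnPerm σ f).SameCycle x y := by
  obtain ⟨n, -, hn⟩ := h.exists_pow_eq'
  induction n using Nat.strong_induction_on generalizing x with
  | _ n ih =>
    rcases Nat.eq_zero_or_pos n with rfl | hpos
    · simp at hn
      subst hn
      exact Perm.SameCycle.refl _ _
    · have hle : returnTime σ f x ≤ n := Nat.sInf_le ⟨hpos, by rw [hn, hf]⟩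
      have h1 := (returnTime_spec σ f x).1
      have e : (σ ^ (n - returnTime σ f x)) (returnPerm σ f x) = y := by
        change (σ ^ (n - returnTime σ f x)) ((σ ^ returnTime σ f x) x) = y
        rw [← Perm.mul_apply, ← pow_add, Nat.sub_add_cancel hle, hn]
      have h2 := ih (n - returnTime σ f x) (by omega) (x := returnPerm σ f x)
        ((returnPerm_sameCycle σ f x).symm.trans h) ((returnPerm_label σ f x).trans hf) e
      exact Perm.SameCycle.trans ⟨1, by simp⟩ h2

theorem eq_of_sameCycle {X Y : Type} {σ : Perm X} {g : X → Y}
    (hg : ∀ x, g (σ x) = g x) {x y : X} (h : σ.SameCycle x y) : g x = g y := by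
  obtain ⟨n, rfl⟩ := h
  have hinv : ∀ x, g (σ⁻¹ x) = g x := fun x => by
    have := hg (σ⁻¹ x)
    simpa using this.symm
  have hnat : ∀ (m : ℕ) x, g ((σ ^ m) x) = g x := by
    intro m
    induction m with
    | zero => simp
    | succ m ih => intro x; rw [pow_succ', Perm.mul_apply, hg, ih]
  have hnat' : ∀ (m : ℕ) x, g ((σ⁻¹ ^ m) x) = g x := by
    intro m
    induction m with
    | zero => simp
    | succ m ih => intro x; rw [pow_succ', Perm.mul_apply, hinv, ih]
  rcases n with n | n
  · simp [hnat]
  · rw [zpow_negSucc, ← inv_pow, hnat']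

/-- Two permutations that preserve a map `g` coincide on an invariant set, if each `y` of this set
has a common preimage, unless it satisfies `f`, and `g` is injective on these exceptions. -/
theorem perm_eq_on {X Z : Type} {C T : Perm X} {g : X → Z} {s f : X → Prop}
    (hC : ∀ x, g (C x) = g x) (hT : ∀ x, g (T x) = g x)
    (hCs : ∀ x, s x → s (C x)) (hTs : ∀ x, s x → s (T x))
    (hf : ∀ y z, s y → s z → f y → f z → g y = g z → y = z)
    (h : ∀ y, s y → f y ∨ ∃ x, C x = y ∧ T x = y) (x : X) (hx : s x) : C x = T x := by
  rcases h _ (hCs x hx) with h1 | ⟨x', h1, h2⟩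
  · rcases h _ (hTs x hx) with h3 | ⟨x', h3, h4⟩
    · exact hf _ _ (hCs x hx) (hTs x hx) h1 h3 (by rw [hC, hT])
    · rw [T.injective h4] at h3
      exact h3
  · rw [C.injective h1] at h2
    exact h2.symm

theorem sameCycle_subtypePerm {X : Type} {σ : Perm X} {p : X → Prop} (h : ∀ x, p (σ x) ↔ p x)
    {x y : {x // p x}} : (σ.subtypePerm h).SameCycle x y ↔ σ.SameCycle x.1 y.1 :=
  Perm.sameCycle_subtypePerm

/-! ### Lists -/

/-- Two asymmetric relations by which the elements of a list increase coincide on this list. -/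
theorem List.Pairwise.iff_of_asymm {α : Type} {R S : α → α → Prop} {l : List α}
    (hR : l.Pairwise R) (hS : l.Pairwise S) (aR : ∀ x y, R x y → ¬ R y x)
    (aS : ∀ x y, S x y → ¬ S y x) : ∀ x ∈ l, ∀ y ∈ l, (R x y ↔ S x y) := by
  have key : l.Pairwise (fun x y => (R x y ↔ S x y) ∧ (R y x ↔ S y x)) :=
    (hR.and hS).imp fun h =>
      ⟨iff_of_true h.1 h.2, iff_of_false (aR _ _ h.1) (aS _ _ h.2)⟩
  intro x hx y hy
  have : Std.Symm fun x y => (R x y ↔ S x y) ∧ (R y x ↔ S y x) := { symm _ _ h := ⟨h.2, h.1⟩ }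
  have hrefl : ∀ x ∈ l, (R x x ↔ S x x) ∧ (R x x ↔ S x x) := fun x _ =>
    have h := iff_of_false (fun h => aR x x h h) (fun h => aS x x h h)
    ⟨h, h⟩
  exact (List.Pairwise.forall_of_forall hrefl key hx hy).1

theorem List.Nodup.pairwise_idxOf {α : Type} [BEq α] [LawfulBEq α] {l : List α} (h : l.Nodup) :
    l.Pairwise (fun x y => l.idxOf x < l.idxOf y) := by
  rw [List.pairwise_iff_getElem]
  intro i j hi hj hij
  rwa [h.idxOf_getElem, h.idxOf_getElem]

/-! ### The stacks of non-paired letters -/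

def Side.other : Side → Side
  | .left => .right
  | .right => .left

@[simp] theorem Side.other_other (s : Side) : s.other.other = s := by cases s <;> rfl

theorem Side.other_ne (s : Side) : s.other ≠ s := by cases s <;> simp [Side.other]

/-- The letter that opens an active vertex: `b` for white (left), `a` for black (right). -/
def Side.opn : Side → Letter
  | .left => .b
  | .right => .a

/-- The letter that inactivates an active vertex: `b̄` for white (left), `ā` for black (right). -/
def Side.cls : Side → Letter
  | .left => .bbar
  | .right => .abar

@[simp] theorem Side.cls_ne_opn (s t : Side) : s.cls ≠ t.opn := by
  cases s <;> cases t <;> simp [Side.cls, Side.opn]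

@[simp] theorem Side.opn_ne_cls (s t : Side) : s.opn ≠ t.cls := (Side.cls_ne_opn t s).symm

@[simp] theorem Side.opn_other_ne (s : Side) : s.other.opn ≠ s.opn := by
  cases s <;> simp [Side.other, Side.opn]

@[simp] theorem Side.cls_other_ne (s : Side) : s.other.cls ≠ s.cls := by
  cases s <;> simp [Side.other, Side.cls]

theorem Letter.cases_side (s : Side) (x : Letter) :
    x = s.opn ∨ x = s.cls ∨ x = s.other.opn ∨ x = s.other.cls := by
  cases s <;> cases x <;> simp [Side.other, Side.opn, Side.cls]

/-- The stack of the active vertices on side `s` after `n` letters, from the last to the first.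
The letter at position `i` has label `i + 1`, and the label `0` stands for the start. An entry
`(k, e)` stands for a vertex opened by the letter of label `k`, such that `e` is the last label of
an edge attached to it. -/
def stk (u : List Letter) (s : Side) : ℕ → List (ℕ × ℕ)
  | 0 => [(0, 0)]
  | n + 1 =>
    if u[n]? = some s.opn then (n + 1, n + 1) :: stk u s n
    else if u[n]? = some s.cls then (stk u s n).tail
    else if u[n]? = some s.other.opn then
      match stk u s n with
      | [] => []
      | (k, _) :: r => (k, n + 1) :: r
    else stk u s n

/-- The labels of the edges: `0` and those of the letters `a` and `b`. -/
def IsLabel (u : List Letter) (e : ℕ) : Prop :=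
  e = 0 ∨ ∃ i, e = i + 1 ∧ ∃ s : Side, u[i]? = some s.opn

theorem IsLabel.cases {u : List Letter} {e : ℕ} (h : IsLabel u e) :
    e = 0 ∨ (∃ n, e = n + 1 ∧ u[n]? = some .a) ∨ ∃ n, e = n + 1 ∧ u[n]? = some .b := by
  rcases h with rfl | ⟨n, rfl, _ | _, h⟩
  · exact Or.inl rfl
  · exact Or.inr (Or.inr ⟨n, rfl, h⟩)
  · exact Or.inr (Or.inl ⟨n, rfl, h⟩)

section Stack

variable {u : List Letter} {s : Side} {n : ℕ}

theorem stk_open (h : u[n]? = some s.opn) : stk u s (n + 1) = (n + 1, n + 1) :: stk u s n := by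
  simp [stk, h]

theorem stk_close (h : u[n]? = some s.cls) : stk u s (n + 1) = (stk u s n).tail := by
  simp [stk, h]

theorem stk_touch (h : u[n]? = some s.other.opn) {k e : ℕ} {r : List (ℕ × ℕ)}
    (hr : stk u s n = (k, e) :: r) : stk u s (n + 1) = (k, n + 1) :: r := by
  simp [stk, h, hr]

theorem stk_other (h : u[n]? = some s.other.cls) : stk u s (n + 1) = stk u s n := by
  simp [stk, h]

theorem stk_none (h : u[n]? = none) : stk u s (n + 1) = stk u s n := by
  simp [stk, h]

theorem getElem?_cases (u : List Letter) (s : Side) (n : ℕ) : u[n]? = none ∨ u[n]? = some s.opn ∨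
    u[n]? = some s.cls ∨ u[n]? = some s.other.opn ∨ u[n]? = some s.other.cls := by
  rcases u[n]? with _ | x
  · simp
  · simpa using Letter.cases_side s x

theorem IsPrefixShuffle.count_le (hu : IsPrefixShuffle u) (s : Side) (n : ℕ) :
    (u.take n).count s.cls ≤ (u.take n).count s.opn := by
  have := hu _ (List.take_prefix n u)
  cases s
  · exact this.2
  · exact this.1

theorem length_stk (hu : IsPrefixShuffle u) (s : Side) (n : ℕ) :
    (stk u s n).length + (u.take n).count s.cls = 1 + (u.take n).count s.opn := by
  induction n with
  | zero => simp [stk]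
  | succ n ih =>
    have hle := hu.count_le s n
    have hl : 1 ≤ (stk u s n).length := by omega
    obtain ⟨⟨k, e⟩, r, hr⟩ := List.exists_cons_of_length_pos hl
    rw [hr] at ih
    simp only [List.length_cons] at ih
    rw [List.take_add_one]
    rcases getElem?_cases u s n with h | h | h | h | h
    · rw [stk_none h, hr, h]; simpa using ih
    · rw [stk_open h, hr, h]
      simp [List.count_append]
      omega
    · rw [stk_close h, hr, h]
      simp [List.count_append]
      omega
    · rw [stk_touch h hr, h]
      simp [List.count_append]
      omega
    · rw [stk_other h, hr, h]
      simp [List.count_append]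
      omega

/-- The label that opens the last active vertex. -/
def opening (u : List Letter) (s : Side) (n : ℕ) : ℕ := ((stk u s n).headD (0, 0)).1

/-- The last label at the last active vertex. -/
def latest (u : List Letter) (s : Side) (n : ℕ) : ℕ := ((stk u s n).headD (0, 0)).2

theorem stk_eq_cons (hu : IsPrefixShuffle u) (s : Side) (n : ℕ) :
    ∃ r, stk u s n = (opening u s n, latest u s n) :: r := by
  have h1 := length_stk hu s n
  have h2 := hu.count_le s n
  obtain ⟨⟨k, e⟩, r, hr⟩ := List.exists_cons_of_length_pos (l := stk u s n) (by omega)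
  exact ⟨r, by simp [opening, latest, hr]⟩

theorem opening_eq {k e : ℕ} {r : List (ℕ × ℕ)} (h : stk u s n = (k, e) :: r) :
    opening u s n = k := by simp [opening, h]

theorem latest_eq {k e : ℕ} {r : List (ℕ × ℕ)} (h : stk u s n = (k, e) :: r) :
    latest u s n = e := by simp [latest, h]

theorem stk_close_cons (hu : IsPrefixShuffle u) (h : u[n]? = some s.cls) : ∃ k e k' e' r,
    stk u s n = (k, e) :: (k', e') :: r ∧ stk u s (n + 1) = (k', e') :: r := by
  obtain ⟨r, hr⟩ := stk_eq_cons hu s n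
  obtain ⟨r', hr'⟩ := stk_eq_cons hu s (n + 1)
  rw [stk_close h, hr, List.tail_cons] at hr'
  subst hr'
  exact ⟨_, _, _, _, _, hr, by rw [stk_close h, hr]; rfl⟩

theorem mem_stk (hu : IsPrefixShuffle u) {k e : ℕ} (h : (k, e) ∈ stk u s n) :
    e ≤ n ∧ k ≤ e ∧ opening u s e = k ∧ latest u s e = e ∧ IsLabel u e ∧
      (k = 0 ∨ ∃ i, k = i + 1 ∧ u[i]? = some s.opn) := by
  induction n generalizing k e with
  | zero =>
    simp only [stk, List.mem_singleton, Prod.mk.injEq] at h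
    obtain ⟨rfl, rfl⟩ := h
    simp [opening, latest, stk, IsLabel]
  | succ n ih =>
    obtain ⟨r, hr⟩ := stk_eq_cons hu s n
    rcases getElem?_cases u s n with hl | hl | hl | hl | hl
    · rw [stk_none hl] at h
      obtain ⟨h1, h2⟩ := ih h
      exact ⟨by omega, h2⟩
    · rw [stk_open hl, List.mem_cons] at h
      rcases h with h | h
      · obtain ⟨rfl, rfl⟩ := Prod.mk.inj h
        exact ⟨le_rfl, le_rfl, opening_eq (stk_open hl), latest_eq (stk_open hl),
          Or.inr ⟨n, rfl, s, hl⟩, Or.inr ⟨n, rfl, hl⟩⟩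
      · obtain ⟨h1, h2⟩ := ih h
        exact ⟨by omega, h2⟩
    · rw [stk_close hl] at h
      obtain ⟨h1, h2⟩ := ih (List.mem_of_mem_tail h)
      exact ⟨by omega, h2⟩
    · have hs := stk_touch hl hr
      rw [hs, List.mem_cons] at h
      rcases h with h | h
      · obtain ⟨rfl, rfl⟩ := Prod.mk.inj h
        have htop : (opening u s n, latest u s n) ∈ stk u s n := by rw [hr]; simp
        obtain ⟨h1, h2, -, -, -, h3⟩ := ih htop
        exact ⟨le_rfl, by omega, opening_eq hs, latest_eq hs, Or.inr ⟨n, rfl, s.other, hl⟩, h3⟩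
      · obtain ⟨h1, h2⟩ := ih (by rw [hr]; exact List.mem_cons_of_mem _ h)
        exact ⟨by omega, h2⟩
    · rw [stk_other hl] at h
      obtain ⟨h1, h2⟩ := ih h
      exact ⟨by omega, h2⟩

theorem top_mem_stk (hu : IsPrefixShuffle u) (s : Side) (n : ℕ) :
    (opening u s n, latest u s n) ∈ stk u s n := by
  obtain ⟨r, hr⟩ := stk_eq_cons hu s n
  rw [hr]
  simp

theorem subwordBetween_succ (c c' : Letter) (u : List Letter) {i n : ℕ} (h : i < n) :
    subwordBetween c c' u i (n + 1) =
      subwordBetween c c' u i n ++ u[n]?.toList.filter (fun x => x = c ∨ x = c') := by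
  unfold subwordBetween
  rw [show n + 1 - (i + 1) = n - (i + 1) + 1 by omega, List.take_add_one, List.filter_append,
    List.getElem?_drop, show i + 1 + (n - (i + 1)) = n by omega]

theorem IsParenSystem.append_wrap {c c' : Letter} (hc : c ≠ c') {U V : List Letter}
    (hU : IsParenSystem c c' U) (hV : IsParenSystem c c' V) :
    IsParenSystem c c' (U ++ c :: V ++ [c']) := by
  obtain ⟨a1, a2, a3⟩ := hU
  obtain ⟨b1, b2, b3⟩ := hV
  refine ⟨?_, ?_, ?_⟩
  · intro x hx
    simp only [List.mem_append, List.mem_cons, List.not_mem_nil, or_false] at hx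
    rcases hx with (hx | hx | hx) | hx
    · exact a1 x hx
    · exact Or.inl hx
    · exact b1 x hx
    · exact Or.inr hx
  · simp [List.count_append, hc, hc.symm, a2, b2]
  · intro v hv
    rw [List.append_assoc, List.cons_append] at hv
    rcases List.prefix_or_prefix_of_prefix hv (List.prefix_append U _) with h | ⟨t, rfl⟩
    · exact a3 v h
    · rw [List.prefix_append_right_inj] at hv
      rcases t with _ | ⟨x, t⟩
      · simpa using a2.ge
      · rw [List.cons_prefix_cons] at hv
        obtain ⟨rfl, hv⟩ := hv
        rcases List.prefix_concat_iff.1 hv with rfl | h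
        · simp [List.count_append, hc, hc.symm, a2, b2]
        · have := b3 t h
          simp [List.count_append, hc, a2]
          omega

theorem stk_cons (hu : IsPrefixShuffle u) {k e : ℕ} {r : List (ℕ × ℕ)}
    (h : stk u s n = (k, e) :: r) : (k = 0 ∧ r = []) ∨ ∃ i, k = i + 1 ∧ i < n ∧
      u[i]? = some s.opn ∧ stk u s i = r ∧
      IsParenSystem s.opn s.cls (subwordBetween s.opn s.cls u i n) := by
  induction n using Nat.strong_induction_on generalizing k e r with
  | _ n ih =>
    rcases n with _ | n
    · simp only [stk, List.cons.injEq, Prod.mk.injEq] at h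
      exact Or.inl ⟨h.1.1.symm, h.2.symm⟩
    · have same : ∀ {e'}, u[n]? ≠ some s.opn → u[n]? ≠ some s.cls → stk u s n = (k, e') :: r →
          (k = 0 ∧ r = []) ∨ ∃ i, k = i + 1 ∧ i < n + 1 ∧ u[i]? = some s.opn ∧ stk u s i = r ∧
            IsParenSystem s.opn s.cls (subwordBetween s.opn s.cls u i (n + 1)) := by
        intro e' ho hc h
        rcases ih n (by omega) h with h | ⟨i, h1, h2, h3, h4, h5⟩
        · exact Or.inl h
        · refine Or.inr ⟨i, h1, by omega, h3, h4, ?_⟩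
          rw [subwordBetween_succ _ _ _ h2]
          have : u[n]?.toList.filter (fun x => x = s.opn ∨ x = s.cls) = [] := by
            rcases hx : u[n]? with _ | x
            · simp
            · rw [hx] at ho hc
              simp only [ne_eq, Option.some.injEq] at ho hc
              simp [ho, hc]
          rwa [this, List.append_nil]
      rcases getElem?_cases u s n with hl | hl | hl | hl | hl
      · rw [stk_none hl] at h
        exact same (by simp [hl]) (by simp [hl]) h
      · rw [stk_open hl] at h
        simp only [List.cons.injEq, Prod.mk.injEq] at h
        obtain ⟨⟨rfl, -⟩, rfl⟩ := h
        exact Or.inr ⟨n, rfl, by omega, hl, rfl, by simp [subwordBetween, IsParenSystem]⟩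
      · obtain ⟨k0, e0, k', e', r', h1, h2⟩ := stk_close_cons hu hl
        rw [h2] at h
        simp only [List.cons.injEq, Prod.mk.injEq] at h
        obtain ⟨⟨rfl, rfl⟩, rfl⟩ := h
        rcases ih n (by omega) h1 with ⟨-, h⟩ | ⟨i, -, hin, hi, h3, h4⟩
        · simp at h
        · rcases ih i (by omega) h3 with h | ⟨j, hj1, hji, hj, h5, h6⟩
          · exact Or.inl h
          · refine Or.inr ⟨j, hj1, by omega, hj, h5, ?_⟩
            have e : subwordBetween s.opn s.cls u j (n + 1) =
                subwordBetween s.opn s.cls u j i ++ s.opn :: subwordBetween s.opn s.cls u i n ++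
                  [s.cls] := by
              rw [subwordBetween_succ _ _ _ (by omega), hl]
              congr 1
              · unfold subwordBetween
                rw [drop_take_split u hji hin hi, List.filter_append, List.filter_cons]
                simp
              · simp
            rw [e]
            exact h6.append_wrap (by simp) h4
      · obtain ⟨r', hr'⟩ := stk_eq_cons hu s n
        have h' := stk_touch hl hr'
        rw [h'] at h
        simp only [List.cons.injEq, Prod.mk.injEq] at h
        obtain ⟨⟨rfl, -⟩, rfl⟩ := h
        exact same (by simp [hl]) (by simp [hl]) hr'
      · rw [stk_other hl] at h
        exact same (by simp [hl]) (by simp [hl]) h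

theorem stk_pairwise (hu : IsPrefixShuffle u) (s : Side) (n : ℕ) :
    (stk u s n).Pairwise (fun x y => y.1 < x.1) := by
  induction n using Nat.strong_induction_on with
  | _ n ih =>
    obtain ⟨r, hr⟩ := stk_eq_cons hu s n
    rcases stk_cons hu hr with ⟨-, h⟩ | ⟨i, hi, hin, -, h, -⟩
    · rw [hr, h]; simp
    · rw [hr, List.pairwise_cons, ← h]
      refine ⟨fun x hx => ?_, ih i hin⟩
      obtain ⟨h1, h2, -⟩ := mem_stk hu (k := x.1) (e := x.2) hx
      simp only [hi]
      omega

/-- A closing letter is paired with the letter that opens the vertex on top of the stack. -/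
theorem isPaired_of_close (hu : IsPrefixShuffle u) (h : u[n]? = some s.cls) :
    ∃ i e, stk u s n = (i + 1, e) :: stk u s i ∧ stk u s (n + 1) = stk u s i ∧
      IsPaired s.opn s.cls u i n := by
  obtain ⟨k, e, k', e', r, h1, h2⟩ := stk_close_cons hu h
  rcases stk_cons hu h1 with ⟨-, h3⟩ | ⟨i, rfl, hin, hi, h3, h4⟩
  · simp at h3
  · exact ⟨i, e, by rw [h1, h3], by rw [h2, h3], hin, hi, h, h4⟩

theorem IsPaired.stk_eq (hu : IsPrefixShuffle u) {i j : ℕ} (h : IsPaired s.opn s.cls u i j) :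
    (∃ e, stk u s j = (i + 1, e) :: stk u s i) ∧ stk u s (j + 1) = stk u s i := by
  obtain ⟨i', e, h1, h2, h3⟩ := isPaired_of_close hu h.2.2.1
  obtain rfl := h.left_unique (by simp) h3
  exact ⟨⟨e, h1⟩, h2⟩

/-- The label `k` opens an active vertex. -/
def IsOpened (u : List Letter) (s : Side) (n k : ℕ) : Prop := ∃ e, (k, e) ∈ stk u s n

theorem IsOpened.of_succ (hu : IsPrefixShuffle u) {k : ℕ} (hk : k ≤ n) (h : IsOpened u s (n + 1) k) :
    IsOpened u s n k := by
  obtain ⟨e, h⟩ := h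
  obtain ⟨r, hr⟩ := stk_eq_cons hu s n
  rcases getElem?_cases u s n with hl | hl | hl | hl | hl
  · rw [stk_none hl] at h
    exact ⟨e, h⟩
  · rw [stk_open hl, List.mem_cons] at h
    rcases h with h | h
    · obtain ⟨rfl, -⟩ := Prod.mk.inj h
      omega
    · exact ⟨e, h⟩
  · rw [stk_close hl] at h
    exact ⟨e, List.mem_of_mem_tail h⟩
  · rw [stk_touch hl hr, List.mem_cons] at h
    rcases h with h | h
    · obtain ⟨rfl, -⟩ := Prod.mk.inj h
      exact ⟨latest u s n, top_mem_stk hu s n⟩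
    · exact ⟨e, by rw [hr]; exact List.mem_cons_of_mem _ h⟩
  · rw [stk_other hl] at h
    exact ⟨e, h⟩

theorem IsOpened.mono (hu : IsPrefixShuffle u) {k m : ℕ} (hk : k ≤ n) (hnm : n ≤ m)
    (h : IsOpened u s m k) : IsOpened u s n k := by
  induction m, hnm using Nat.le_induction with
  | base => exact h
  | succ m hm ih => exact ih (h.of_succ hu (by omega))

theorem IsOpened.succ (hu : IsPrefixShuffle u) {k : ℕ} (h : IsOpened u s n k) :
    IsOpened u s (n + 1) k ∨ ∃ i, k = i + 1 ∧ IsPaired s.opn s.cls u i n := by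
  obtain ⟨e, h⟩ := h
  obtain ⟨r, hr⟩ := stk_eq_cons hu s n
  rcases getElem?_cases u s n with hl | hl | hl | hl | hl
  · rw [← stk_none hl] at h
    exact Or.inl ⟨e, h⟩
  · exact Or.inl ⟨e, by rw [stk_open hl]; exact List.mem_cons_of_mem _ h⟩
  · obtain ⟨i, e', h1, h2, h3⟩ := isPaired_of_close hu hl
    rw [h1, List.mem_cons] at h
    rcases h with h | h
    · exact Or.inr ⟨i, (Prod.mk.inj h).1, h3⟩
    · exact Or.inl ⟨e, by rwa [h2]⟩
  · rw [hr, List.mem_cons] at h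
    rcases h with h | h
    · exact Or.inl ⟨n + 1, by rw [stk_touch hl hr, (Prod.mk.inj h).1]; simp⟩
    · exact Or.inl ⟨e, by rw [stk_touch hl hr]; exact List.mem_cons_of_mem _ h⟩
  · rw [← stk_other hl] at h
    exact Or.inl ⟨e, h⟩

theorem isOpened_zero (hu : IsPrefixShuffle u) (s : Side) (n : ℕ) : IsOpened u s n 0 := by
  induction n with
  | zero => exact ⟨0, by simp [stk]⟩
  | succ n ih =>
    rcases ih.succ hu with h | ⟨i, h, -⟩
    · exact h
    · omega

theorem isOpened_iff (hu : IsPrefixShuffle u) {i m : ℕ} (hi : u[i]? = some s.opn) (him : i < m) :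
    IsOpened u s m (i + 1) ↔ ¬ ∃ j < m, IsPaired s.opn s.cls u i j := by
  constructor
  · rintro h ⟨j, hjm, hj⟩
    obtain ⟨e, he⟩ := h.mono hu (n := j + 1) (by have := hj.1; omega) hjm
    rw [(hj.stk_eq hu).2] at he
    have := mem_stk hu he
    omega
  · intro h
    induction m, him using Nat.le_induction with
    | base => exact ⟨i + 1, by rw [stk_open hi]; simp⟩
    | succ m hm ih =>
      have hm : i + 1 ≤ m := hm
      rcases (ih fun ⟨j, h1, h2⟩ => h ⟨j, by omega, h2⟩).succ hu with h' | ⟨i', h1, h2⟩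
      · exact h'
      · obtain rfl : i = i' := by omega
        exact absurd ⟨m, by omega, h2⟩ h

theorem isLabel_latest (hu : IsPrefixShuffle u) (s : Side) (n : ℕ) : IsLabel u (latest u s n) :=
  (mem_stk hu (top_mem_stk hu s n)).2.2.2.2.1

theorem latest_le (hu : IsPrefixShuffle u) (s : Side) (n : ℕ) : latest u s n ≤ n :=
  (mem_stk hu (top_mem_stk hu s n)).1

theorem opening_latest (hu : IsPrefixShuffle u) (s : Side) (n : ℕ) :
    opening u s (latest u s n) = opening u s n :=
  (mem_stk hu (top_mem_stk hu s n)).2.2.1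

theorem opening_touch (hu : IsPrefixShuffle u) (h : u[n]? = some s.other.opn) :
    opening u s (n + 1) = opening u s n := by
  obtain ⟨r, hr⟩ := stk_eq_cons hu s n
  exact opening_eq (stk_touch h hr)

theorem opening_open (h : u[n]? = some s.opn) : opening u s (n + 1) = n + 1 :=
  opening_eq (stk_open h)

theorem opening_other (h : u[n]? = some s.other.cls) : opening u s (n + 1) = opening u s n := by
  simp [opening, stk_other h]

theorem opening_lt (hu : IsPrefixShuffle u) (s : Side) (n : ℕ) : opening u s n ≤ n :=
  (mem_stk hu (top_mem_stk hu s n)).2.1.trans (latest_le hu s n)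

theorem eq_stk_of_suffix (hu : IsPrefixShuffle u) {i e : ℕ} {r : List (ℕ × ℕ)}
    (h : (i + 1, e) :: r <:+ stk u s n) : r = stk u s i := by
  induction n using Nat.strong_induction_on with
  | _ n ih =>
    obtain ⟨r', hr'⟩ := stk_eq_cons hu s n
    rw [hr', List.suffix_cons_iff] at h
    rcases h with h | h
    · obtain ⟨h1, rfl⟩ := List.cons.inj h
      rcases stk_cons hu hr' with ⟨h2, -⟩ | ⟨j, h2, -, -, h3, -⟩
      · have := (Prod.mk.inj h1).1
        omega
      · have := (Prod.mk.inj h1).1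
        obtain rfl : i = j := by omega
        exact h3.symm
    · rcases stk_cons hu hr' with ⟨-, rfl⟩ | ⟨j, -, hj, -, h3, -⟩
      · simp at h
      · rw [← h3] at h
        exact ih j hj h

theorem IsOpened.below (hu : IsPrefixShuffle u) {i : ℕ} (h : IsOpened u s n (i + 1)) :
    IsOpened u s n (opening u s i) := by
  obtain ⟨e, h⟩ := h
  obtain ⟨A, r, hA⟩ := List.append_of_mem h
  have hs : (i + 1, e) :: r <:+ stk u s n := ⟨A, hA.symm⟩
  obtain rfl := eq_stk_of_suffix hu hs
  exact ⟨_, hs.subset (List.mem_cons_of_mem _ (top_mem_stk hu s i))⟩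

theorem IsOpened.le_opening (hu : IsPrefixShuffle u) {k : ℕ} (h : IsOpened u s n k) :
    k ≤ opening u s n := by
  obtain ⟨e, h⟩ := h
  obtain ⟨r, hr⟩ := stk_eq_cons hu s n
  have hp := stk_pairwise hu s n
  rw [hr] at h hp
  rcases List.mem_cons.1 h with h | h
  · exact (Prod.mk.inj h).1.le
  · exact ((List.pairwise_cons.1 hp).1 _ h).le

theorem isOpened_opening (hu : IsPrefixShuffle u) (s : Side) (n : ℕ) :
    IsOpened u s n (opening u s n) := ⟨_, top_mem_stk hu s n⟩

theorem isLabel_opening (hu : IsPrefixShuffle u) (s : Side) (n : ℕ) :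
    IsLabel u (opening u s n) := by
  rcases (mem_stk hu (top_mem_stk hu s n)).2.2.2.2.2 with h | ⟨i, h1, h2⟩
  · exact Or.inl h
  · exact Or.inr ⟨i, h1, s, h2⟩

theorem opening_opening (hu : IsPrefixShuffle u) (s : Side) (n : ℕ) :
    opening u s (opening u s n) = opening u s n := by
  rcases (mem_stk hu (top_mem_stk hu s n)).2.2.2.2.2 with h | ⟨i, h1, h2⟩
  · rw [h]; rfl
  · rw [h1, opening_open h2]

theorem IsLabel.le {e : ℕ} (h : IsLabel u e) : e ≤ u.length := by
  rcases h with rfl | ⟨i, rfl, s, h⟩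
  · omega
  · exact (List.getElem?_eq_some_iff.1 h).1

/-- A relation between the labels and the positions that is compatible with skipping the letters
that do not touch an active vertex on side `s` holds between the last label at the last active
vertex and the current position. -/
theorem latest_induction (hu : IsPrefixShuffle u) (s : Side) (V : ℕ → ℕ → Prop)
    (h1 : ∀ e, IsLabel u e → V e (e + 1))
    (h2 : ∀ e n, IsLabel u e → u[n]? = some s.other.cls → V e (n + 1) → V e (n + 2))
    (h3 : ∀ e i j, IsLabel u e → IsPaired s.opn s.cls u i j → V e (i + 1) → V e (j + 2))
    (hn : n ≤ u.length) : V (latest u s n) (n + 1) := by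
  induction n using Nat.strong_induction_on with
  | _ n ih =>
    rcases n with _ | n
    · exact h1 0 (Or.inl rfl)
    · rcases getElem?_cases u s n with hl | hl | hl | hl | hl
      · rw [List.getElem?_eq_none_iff] at hl
        omega
      · rw [latest_eq (stk_open hl)]
        exact h1 _ (Or.inr ⟨n, rfl, _, hl⟩)
      · obtain ⟨i, e, -, h, hp⟩ := isPaired_of_close hu hl
        have hi := hp.1
        have hv := ih i (by omega) (by omega)
        have he : latest u s (n + 1) = latest u s i := by simp [latest, h]
        rw [he]
        exact h3 _ _ _ (isLabel_latest hu s i) hp hv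
      · obtain ⟨r, hr⟩ := stk_eq_cons hu s n
        rw [latest_eq (stk_touch hl hr)]
        exact h1 _ (Or.inr ⟨n, rfl, _, hl⟩)
      · have he : latest u s (n + 1) = latest u s n := by simp [latest, stk_other hl]
        rw [he]
        exact h2 _ _ (isLabel_latest hu s n) hl (ih n (by omega) (by omega))

/-- Induction over the labels at a vertex. -/
theorem label_induction (hu : IsPrefixShuffle u) (s : Side) (P : ℕ → Prop)
    (h1 : ∀ e, IsLabel u e → opening u s e = e → P e)
    (h2 : ∀ n, u[n]? = some s.other.opn → P (latest u s n) → P (n + 1)) {e : ℕ}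
    (he : IsLabel u e) : P e := by
  induction e using Nat.strong_induction_on with
  | _ e ih =>
    rcases he with rfl | ⟨i, rfl, t, ht⟩
    · exact h1 0 (Or.inl rfl) rfl
    · by_cases hts : t = s
      · subst hts
        exact h1 _ (Or.inr ⟨i, rfl, t, ht⟩) (opening_open ht)
      · have hts : t = s.other := by cases t <;> cases s <;> simp_all [Side.other]
        subst hts
        exact h2 i ht (ih _ (by have := latest_le hu s i; omega) (isLabel_latest hu s i))

end Stack

/-! ### Binary trees and their leaves -/

namespace BinTree

theorem sub_append (B : BinTree) (q p : Address) :
    B.sub (q ++ p) = (B.sub p).bind (fun C => C.sub q) := by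
  induction q with
  | nil => simp [sub]
  | cons s q ih =>
    rw [List.cons_append, sub, ih, Option.bind_assoc]
    rfl

theorem sub_leaf_concat (act : Bool) (q : Address) (s : Side) : (leaf act).sub (q ++ [s]) = none := by
  rw [sub_append]
  simp [sub, son]

theorem sub_node_left (l r : BinTree) (q : Address) : (node l r).sub (q ++ [.left]) = l.sub q := by
  rw [sub_append]
  simp [sub, son]

theorem sub_node_right (l r : BinTree) (q : Address) :
    (node l r).sub (q ++ [.right]) = r.sub q := by
  rw [sub_append]
  simp [sub, son]

theorem mem_leavesFrom {B : BinTree} {p q : Address} {act : Bool} :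
    (q, act) ∈ leavesFrom p B ↔ ∃ r, q = r ++ p ∧ B.sub r = some (leaf act) := by
  induction B generalizing p with
  | leaf act' =>
    simp only [leavesFrom, List.mem_singleton, Prod.mk.injEq]
    constructor
    · rintro ⟨rfl, rfl⟩
      exact ⟨[], rfl, rfl⟩
    · rintro ⟨r, rfl, h⟩
      rcases List.eq_nil_or_concat r with rfl | ⟨r, s, rfl⟩
      · simp only [sub, Option.some.injEq, leaf.injEq] at h
        exact ⟨rfl, h.symm⟩
      · rw [List.concat_eq_append, sub_leaf_concat] at h
        cases h
  | node l r ihl ihr =>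
    simp only [leavesFrom, List.mem_append, ihl, ihr]
    constructor
    · rintro (⟨t, rfl, h⟩ | ⟨t, rfl, h⟩)
      · exact ⟨t ++ [.left], by simp, by rwa [sub_node_left]⟩
      · exact ⟨t ++ [.right], by simp, by rwa [sub_node_right]⟩
    · rintro ⟨t, rfl, h⟩
      rcases List.eq_nil_or_concat t with rfl | ⟨t, s, rfl⟩
      · simp [sub] at h
      · rw [List.concat_eq_append] at h ⊢
        cases s
        · rw [sub_node_left] at h
          exact Or.inl ⟨t, by simp, h⟩
        · rw [sub_node_right] at h
          exact Or.inr ⟨t, by simp, h⟩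

theorem nodup_leavesFrom (B : BinTree) (p : Address) : ((leavesFrom p B).map Prod.fst).Nodup := by
  induction B generalizing p with
  | leaf act => simp [leavesFrom]
  | node l r ihl ihr =>
    rw [leavesFrom, List.map_append, List.nodup_append]
    refine ⟨ihl _, ihr _, ?_⟩
    rintro x hx y hy rfl
    rw [List.mem_map] at hx hy
    obtain ⟨⟨_, _⟩, hx, rfl⟩ := hx
    obtain ⟨⟨_, _⟩, hy, e⟩ := hy
    obtain ⟨t, rfl, -⟩ := mem_leavesFrom.1 hx
    obtain ⟨t', rfl, -⟩ := mem_leavesFrom.1 hy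
    have e' := List.append_inj_right' e (by simp)
    simp at e'

theorem leavesFrom_replaceDown {B : BinTree} {p : Address} {act : Bool}
    (h : B.sub p = some (leaf act)) (p₀ : Address) :
    ∃ L R, leavesFrom p₀ B = L ++ (p ++ p₀, act) :: R ∧
      ∀ C, leavesFrom p₀ (B.replaceDown p.reverse C) = L ++ leavesFrom (p ++ p₀) C ++ R := by
  induction B generalizing p p₀ with
  | leaf act' =>
    rcases List.eq_nil_or_concat p with rfl | ⟨p, s, rfl⟩
    · simp only [sub, Option.some.injEq, leaf.injEq] at h
      subst h
      exact ⟨[], [], by simp [leavesFrom], by simp [replaceDown]⟩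
    · rw [List.concat_eq_append, sub_leaf_concat] at h
      cases h
  | node l r ihl ihr =>
    rcases List.eq_nil_or_concat p with rfl | ⟨p, s, rfl⟩
    · simp [sub] at h
    · rw [List.concat_eq_append] at h ⊢
      cases s
      · rw [sub_node_left] at h
        obtain ⟨L, R, h1, h2⟩ := ihl h (.left :: p₀)
        exact ⟨L, R ++ leavesFrom (.right :: p₀) r, by simp [leavesFrom, h1], fun C => by
          simp [leavesFrom, replaceDown, h2]⟩
      · rw [sub_node_right] at h
        obtain ⟨L, R, h1, h2⟩ := ihr h (.right :: p₀)
        exact ⟨leavesFrom (.left :: p₀) l ++ L, R, by simp [leavesFrom, h1], fun C => by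
          simp [leavesFrom, replaceDown, h2]⟩

theorem isNode_nil_node (l r : BinTree) : (node l r).IsNode [] := ⟨l, r, rfl⟩

theorem isNode_leaf (act : Bool) (p : Address) : ¬ (leaf act).IsNode p := by
  rintro ⟨l, r, h⟩
  rcases List.eq_nil_or_concat p with rfl | ⟨p, s, rfl⟩
  · simp [sub] at h
  · rw [List.concat_eq_append, sub_leaf_concat] at h
    cases h

theorem isNode_node_left (l r : BinTree) (q : Address) :
    (node l r).IsNode (q ++ [.left]) ↔ l.IsNode q := by
  simp [IsNode, sub_node_left]

theorem isNode_node_right (l r : BinTree) (q : Address) :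
    (node l r).IsNode (q ++ [.right]) ↔ r.IsNode q := by
  simp [IsNode, sub_node_right]

theorem isNode_B₁ (p : Address) : B₁.IsNode p ↔ p = [] := by
  rcases List.eq_nil_or_concat p with rfl | ⟨p, s, rfl⟩
  · simp [B₁, isNode_nil_node]
  · rw [List.concat_eq_append]
    cases s <;> simp [B₁, isNode_node_left, isNode_node_right, isNode_leaf]

theorem isNode_replaceDown {B : BinTree} {p : Address} {act : Bool}
    (h : B.sub p = some (leaf act)) (C : BinTree) (q : Address) :
    (B.replaceDown p.reverse C).IsNode q ↔ B.IsNode q ∨ ∃ t, q = t ++ p ∧ C.IsNode t := by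
  induction B generalizing p q with
  | leaf act' =>
    rcases List.eq_nil_or_concat p with rfl | ⟨p, s, rfl⟩
    · simp [replaceDown, isNode_leaf]
    · rw [List.concat_eq_append, sub_leaf_concat] at h
      cases h
  | node l r ihl ihr =>
    rcases List.eq_nil_or_concat p with rfl | ⟨p, s, rfl⟩
    · simp [sub] at h
    · rw [List.concat_eq_append] at h ⊢
      have key : ∀ (t q : Address) (s s' : Side), q ++ [s] = t ++ (p ++ [s']) ↔
          q = t ++ p ∧ s = s' := by
        intro t q s s'
        rw [← List.append_assoc, List.append_singleton_inj]
      rcases List.eq_nil_or_concat q with rfl | ⟨q, s', rfl⟩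
      · cases s <;> simp [replaceDown, isNode_nil_node]
      · rw [List.concat_eq_append]
        cases s
        · rw [sub_node_left] at h
          cases s'
          · simp [replaceDown, isNode_node_left, ihl h, key, - List.append_assoc]
          · simp [replaceDown, isNode_node_right, key, - List.append_assoc]
        · rw [sub_node_right] at h
          cases s'
          · simp [replaceDown, isNode_node_left, key, - List.append_assoc]
          · simp [replaceDown, isNode_node_right, ihr h, key, - List.append_assoc]

/-- All the active leaves in the order of appearance around the tree. -/
def actives (B : BinTree) : List Address := ((leavesFrom [] B).filter Prod.snd).map Prod.fst

theorem activeLeaves_eq (B : BinTree) (s : Side) :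
    B.activeLeaves s = B.actives.filter (fun p => decide (p.head? = some s)) := by
  rw [activeLeaves, actives, List.filter_map, List.filter_filter]
  congr 1
  apply List.filter_congr
  simp [Bool.and_comm]

theorem mem_actives {B : BinTree} {p : Address} : p ∈ B.actives ↔ B.sub p = some (leaf true) := by
  simp [actives, mem_leavesFrom]

theorem nodup_leafList (B : BinTree) : B.leafList.Nodup := nodup_leavesFrom B []

theorem actives_sublist (B : BinTree) : B.actives.Sublist B.leafList :=
  List.filter_sublist.map _

theorem actives_replaceAt {B : BinTree} {p : Address} {X Y : List Address}
    (h : B.actives = X ++ p :: Y) (C : BinTree) :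
    (B.replaceAt (some p) C).actives = X ++ ((leavesFrom p C).filter Prod.snd).map Prod.fst ++ Y := by
  have hp : B.sub p = some (leaf true) := mem_actives.1 (by rw [h]; simp)
  obtain ⟨L, R, h1, h2⟩ := leavesFrom_replaceDown hp []
  have hnd := (actives_sublist B).nodup (nodup_leafList B)
  rw [List.append_nil] at h1 h2
  have e : B.actives = (L.filter Prod.snd).map Prod.fst ++ p :: (R.filter Prod.snd).map Prod.fst := by
    simp [actives, h1]
  rw [h] at e hnd
  obtain ⟨hX, hY⟩ : X = (L.filter Prod.snd).map Prod.fst ∧ Y = (R.filter Prod.snd).map Prod.fst := by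
    have hd := List.nodup_append.1 hnd
    have hd' := hnd
    rw [e] at hd'
    have hd' := List.nodup_append.1 hd'
    have := (List.append_cons_inj_of_notMem (fun h => hd.2.2 _ h p (by simp) rfl)
      (List.nodup_cons.1 hd.2.1).1).1 e
    exact ⟨this.1, this.2.2⟩
  simp only [replaceAt, actives, h2, hX, hY, List.filter_append, List.map_append]

theorem isLeaf_or_isNode {B : BinTree} {p : Address} (h : B.IsVertex p) : B.IsLeaf p ∨ B.IsNode p := by
  obtain ⟨C, hC⟩ := Option.isSome_iff_exists.1 h
  rcases C with act | ⟨l, r⟩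
  · exact Or.inl ⟨act, hC⟩
  · exact Or.inr ⟨l, r, hC⟩

theorem IsLeaf.not_isNode {B : BinTree} {p : Address} (h : B.IsLeaf p) : ¬ B.IsNode p := by
  obtain ⟨act, h⟩ := h
  rintro ⟨l, r, h'⟩
  rw [h] at h'
  cases h'

end BinTree

/-! ### The nodes and the active leaves of `λ₁(w)` -/

open BinTree

/-- The address of the node created by the letter of label `e`. -/
def addr (u : List Letter) : ℕ → Address
  | 0 => []
  | n + 1 =>
    if u[n]? = some .a then .left :: addr u (min (latest u .left n) n)
    else if u[n]? = some .b then .right :: addr u (min (latest u .right n) n)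
    else []
termination_by n => n
decreasing_by all_goals omega

section Lambda

variable {u : List Letter} {s : Side} {n : ℕ}

theorem addr_zero : addr u 0 = [] := by rw [addr]

theorem addr_touch (hu : IsPrefixShuffle u) (h : u[n]? = some s.other.opn) :
    addr u (n + 1) = s :: addr u (latest u s n) := by
  have := latest_le hu s n
  rw [addr]
  cases s <;> simp_all [Side.other, Side.opn]

theorem lambda₁_take_succ {x : Letter} (h : u[n]? = some x) :
    lambda₁ (u.take (n + 1)) = (lambda₁ (u.take n)).step x := by
  rw [lambda₁, List.take_add_one, h, List.foldl_append]
  rfl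

theorem lambda₁_take_none (h : u[n]? = none) :
    lambda₁ (u.take (n + 1)) = lambda₁ (u.take n) := by
  rw [List.take_add_one, h]
  simp

/-- The list of the active leaves, according to the stacks. -/
def stackLeaves (u : List Letter) (S T : List (ℕ × ℕ)) : List Address :=
  (S.map (fun x => .left :: addr u x.2)).reverse ++ T.map (fun x => .right :: addr u x.2)

theorem filter_stackLeaves_left (u : List Letter) (S T : List (ℕ × ℕ)) :
    (stackLeaves u S T).filter (fun p => decide (p.head? = some .left)) =
      (S.map (fun x => .left :: addr u x.2)).reverse := by
  rw [stackLeaves, List.filter_append, List.filter_eq_self.2, List.filter_eq_nil_iff.2,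
    List.append_nil] <;> simp <;> rintro _ _ _ _ rfl <;> simp

theorem filter_stackLeaves_right (u : List Letter) (S T : List (ℕ × ℕ)) :
    (stackLeaves u S T).filter (fun p => decide (p.head? = some .right)) =
      T.map (fun x => .right :: addr u x.2) := by
  rw [stackLeaves, List.filter_append, List.filter_eq_nil_iff.2, List.filter_eq_self.2,
    List.nil_append] <;> simp <;> rintro _ _ _ _ rfl <;> simp

theorem step_of_actives (hu : IsPrefixShuffle u) {B : BinTree} {s : Side} (n : ℕ)
    (h : B.actives = stackLeaves u (stk u .left n) (stk u .right n)) :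
    B.step s.other.opn = B.replaceAt (some (s :: addr u (latest u s n))) B₁ ∧
    B.step s.cls = B.replaceAt (some (s :: addr u (latest u s n))) (leaf false) := by
  obtain ⟨r, hr⟩ := stk_eq_cons hu s n
  cases s
  · have e : (B.activeLeaves .left).getLast? = some (.left :: addr u (latest u .left n)) := by
      rw [activeLeaves_eq, h, filter_stackLeaves_left, hr]
      simp
    simp [step, Side.other, Side.opn, Side.cls, e]
  · have e : (B.activeLeaves .right).head? = some (.right :: addr u (latest u .right n)) := by
      rw [activeLeaves_eq, h, filter_stackLeaves_right, hr]
      simp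
    simp [step, Side.other, Side.opn, Side.cls, e]

theorem stackLeaves_split (u : List Letter) (s : Side) (S : Side → List (ℕ × ℕ)) (k e : ℕ)
    (r : List (ℕ × ℕ)) (h : S s = (k, e) :: r) : ∃ X Y,
    stackLeaves u (S .left) (S .right) = X ++ (s :: addr u e) :: Y ∧
    ∀ S' : Side → List (ℕ × ℕ), S' s.other = S s.other → S' s = r →
      stackLeaves u (S' .left) (S' .right) = X ++ Y := by
  cases s
  · refine ⟨(r.map (fun x => .left :: addr u x.2)).reverse,
      (S .right).map (fun x => .right :: addr u x.2), by simp [stackLeaves, h], ?_⟩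
    intro S' h1 h2
    simp only [Side.other] at h1
    simp [stackLeaves, h1, h2]
  · refine ⟨((S .left).map (fun x => .left :: addr u x.2)).reverse,
      r.map (fun x => .right :: addr u x.2), by simp [stackLeaves, h], ?_⟩
    intro S' h1 h2
    simp only [Side.other] at h1
    simp [stackLeaves, h1, h2]

theorem stackLeaves_touch (u : List Letter) (s : Side) (S S' : Side → List (ℕ × ℕ)) {k e k' n : ℕ}
    {r : List (ℕ × ℕ)} (h : S s = (k, e) :: r) (h' : S' s = (k, n) :: r)
    (ho : S' s.other = (k', n) :: S s.other) (hn : addr u n = s :: addr u e) : ∃ X Y,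
    stackLeaves u (S .left) (S .right) = X ++ addr u n :: Y ∧
    stackLeaves u (S' .left) (S' .right) = X ++ [.left :: addr u n, .right :: addr u n] ++ Y := by
  cases s <;> simp only [Side.other] at ho
  · exact ⟨(r.map (fun x => .left :: addr u x.2)).reverse,
      (S .right).map (fun x => .right :: addr u x.2), by simp [stackLeaves, h, hn], by
        simp [stackLeaves, h', ho]⟩
  · exact ⟨((S .left).map (fun x => .left :: addr u x.2)).reverse,
      r.map (fun x => .right :: addr u x.2), by simp [stackLeaves, h, hn], by
        simp [stackLeaves, h', ho]⟩

theorem lambda₁_spec (hu : IsPrefixShuffle u) (n : ℕ) :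
    (lambda₁ (u.take n)).actives = stackLeaves u (stk u .left n) (stk u .right n) ∧
    (∀ p, (lambda₁ (u.take n)).IsNode p ↔ ∃ e, e ≤ n ∧ IsLabel u e ∧ p = addr u e) ∧
    ∀ e e', e ≤ n → e' ≤ n → IsLabel u e → IsLabel u e' → addr u e = addr u e' → e = e' := by
  induction n with
  | zero =>
    refine ⟨by simp [lambda₁, stackLeaves, stk, actives, B₁, leavesFrom, addr_zero], fun p => ?_, ?_⟩
    · simp [lambda₁, isNode_B₁, IsLabel, addr_zero]
    · intro e e' h h'
      omega
  | succ n ih =>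
    obtain ⟨ih1, ih2, ih3⟩ := ih
    have lab : ∀ (h : ¬ ∃ s : Side, u[n]? = some s.opn) (e : ℕ), e ≤ n + 1 → IsLabel u e → e ≤ n := by
      rintro h e he (rfl | ⟨i, rfl, hi⟩)
      · omega
      · by_contra hlt
        obtain rfl : i = n := by omega
        exact h hi
    rcases hx : u[n]? with _ | x
    · have hno : ¬ ∃ s : Side, u[n]? = some s.opn := by simp [hx]
      rw [lambda₁_take_none hx, stk_none hx, stk_none hx]
      refine ⟨ih1, fun p => (ih2 p).trans ?_, fun e e' h h' hl hl' => ?_⟩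
      · exact ⟨fun ⟨e, h1, h2⟩ => ⟨e, by omega, h2⟩, fun ⟨e, h1, h2, h3⟩ => ⟨e, lab hno e h1 h2, h2, h3⟩⟩
      · exact ih3 e e' (lab hno e h hl) (lab hno e' h' hl') hl hl'
    · rw [lambda₁_take_succ hx]
      rcases show (∃ s : Side, x = s.other.opn) ∨ ∃ s : Side, x = s.cls by
        cases x
        · exact Or.inl ⟨.left, rfl⟩
        · exact Or.inr ⟨.right, rfl⟩
        · exact Or.inl ⟨.right, rfl⟩
        · exact Or.inr ⟨.left, rfl⟩ with ⟨s, rfl⟩ | ⟨s, rfl⟩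
      · obtain ⟨r, hr⟩ := stk_eq_cons hu s n
        have ha := addr_touch hu hx
        rw [(step_of_actives hu n ih1).1, ← ha]
        obtain ⟨X, Y, hXY, hXY'⟩ := stackLeaves_touch u s (fun s => stk u s n)
          (fun s => stk u s (n + 1)) hr (stk_touch hx hr) (stk_open hx) ha
        rw [← ih1] at hXY
        have hp : (lambda₁ (u.take n)).sub (addr u (n + 1)) = some (leaf true) :=
          mem_actives.1 (by rw [hXY]; simp)
        have hnn : ∀ e, e ≤ n → IsLabel u e → addr u (n + 1) ≠ addr u e := fun e he hl h =>
          IsLeaf.not_isNode ⟨_, hp⟩ ((ih2 _).2 ⟨e, he, hl, h⟩)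
        refine ⟨?_, fun p => ?_, ?_⟩
        · rw [actives_replaceAt hXY, hXY']
          simp [leavesFrom, B₁]
        · rw [replaceAt, isNode_replaceDown hp, ih2]
          simp only [isNode_B₁]
          constructor
          · rintro (⟨e, h1, h2⟩ | ⟨t, rfl, rfl⟩)
            · exact ⟨e, by omega, h2⟩
            · exact ⟨n + 1, le_rfl, Or.inr ⟨n, rfl, _, hx⟩, rfl⟩
          · rintro ⟨e, h1, h2, rfl⟩
            rcases Nat.lt_succ_iff_lt_or_eq.1 (Nat.lt_succ_of_le h1) with h | rfl
            · exact Or.inl ⟨e, by omega, h2, rfl⟩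
            · exact Or.inr ⟨[], rfl, rfl⟩
        · intro e e' h h' hl hl' hee
          rcases Nat.lt_or_ge n e with h1 | h1 <;> rcases Nat.lt_or_ge n e' with h2 | h2
          · omega
          · obtain rfl : e = n + 1 := by omega
            exact absurd hee (hnn _ h2 hl')
          · obtain rfl : e' = n + 1 := by omega
            exact absurd hee.symm (hnn _ h1 hl)
          · exact ih3 e e' h1 h2 hl hl' hee
      · have hno : ¬ ∃ t : Side, u[n]? = some t.opn := by simp [hx]
        obtain ⟨r, hr⟩ := stk_eq_cons hu s n
        rw [(step_of_actives hu n ih1).2]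
        obtain ⟨X, Y, hXY, hXY'⟩ := stackLeaves_split u s (fun s => stk u s n) _ _ _ hr
        have hXY' := hXY' (fun s => stk u s (n + 1)) (stk_other (by simpa using hx))
          (by simp only [stk_close hx, hr, List.tail_cons])
        rw [← ih1] at hXY
        have hp : (lambda₁ (u.take n)).sub (s :: addr u (latest u s n)) = some (leaf true) :=
          mem_actives.1 (by rw [hXY]; simp)
        refine ⟨?_, fun p => ?_, ?_⟩
        · rw [actives_replaceAt hXY, hXY']
          simp [leavesFrom]
        · rw [replaceAt, isNode_replaceDown hp, ih2]
          simp only [isNode_leaf, and_false, exists_false, or_false]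
          exact ⟨fun ⟨e, h1, h2⟩ => ⟨e, by omega, h2⟩,
            fun ⟨e, h1, h2, h3⟩ => ⟨e, lab hno e h1 h2, h2, h3⟩⟩
        · intro e e' h h' hl hl'
          exact ih3 e e' (lab hno e h hl) (lab hno e' h' hl') hl hl'

end Lambda

/-! ### The map `θ(B)` -/

namespace RootedMap

theorem contract_face_val {M : RootedMap} {S : M.D → Prop} {hS : ∀ d, S (M.opp d) ↔ S d}
    {hroot : ¬ S M.root} (x : (M.contract S hS hroot).D) :
    ((M.contract S hS hroot).face x).1 = returnPerm M.face S x.1 := by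
  have key : ∀ (O R : Perm {d // ¬ S d}) (x : {d // ¬ S d}), R (O⁻¹ (O x)) = R x := by
    intro O R x
    simp
  exact congrArg Subtype.val (key (M.opp.subtypePerm (p := fun d => ¬ S d)
    (fun d => not_congr (hS d))) ((returnPerm M.face S).subtypePerm (p := fun d => ¬ S d)
        (fun d => not_congr (iff_of_eq (returnPerm_label M.face S d)))) x)

theorem contract_cw_eq {M : RootedMap} {S : M.D → Prop} {hS : ∀ d, S (M.opp d) ↔ S d}
    {hroot : ¬ S M.root} (hopp : ∀ d, M.opp (M.opp d) = d) {d e : (M.contract S hS hroot).D}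
    (h : Via M.face S (M.opp d.1) e.1) : (M.contract S hS hroot).cw d = e := by
  have hd : ¬ S (M.opp d.1) := fun h => d.2 ((hS _).1 h)
  obtain ⟨x, hx, rfl⟩ : ∃ x : (M.contract S hS hroot).D, x.1 = M.opp d.1 ∧
      (M.contract S hS hroot).opp x = d := ⟨⟨M.opp d.1, hd⟩, rfl, Subtype.ext (hopp _)⟩
  rw [← hx] at h hd
  exact Subtype.ext ((contract_face_val x).trans
    (h.returnPerm_eq (fun z hz h => hd (h ▸ hz)) (propext (iff_of_false e.2 hd))))

theorem contract_vert_cw {M : RootedMap} {S : M.D → Prop} {hS : ∀ d, S (M.opp d) ↔ S d}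
    {hroot : ¬ S M.root} (hcw : ∀ d, M.vert (M.cw d) = M.vert d)
    (d : (M.contract S hS hroot).D) :
    (M.contract S hS hroot).vert ((M.contract S hS hroot).cw d) = (M.contract S hS hroot).vert d := by
  obtain ⟨x, rfl⟩ := (M.contract S hS hroot).opp.surjective d
  have h1 := contract_face_val x
  have hface : ∀ z, M.vert (M.face z) = M.vert (M.opp z) := fun z => hcw _
  have := (via_returnPerm M.face S x.1).invariant
    (fun z => (Quot.mk _ (M.vert z) : (M.contract S hS hroot).V)) (fun z hz => by
      have hz : S z := by
        by_contra h
        exact hz (propext (iff_of_false h x.2))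
      rw [hface]
      exact (Quot.sound ⟨z, hz, rfl, rfl⟩).symm)
  rw [hface, ← h1] at this
  exact this

theorem contract_face_sameCycle {M : RootedMap} {S : M.D → Prop} {hS : ∀ d, S (M.opp d) ↔ S d}
    {hroot : ¬ S M.root} {d e : (M.contract S hS hroot).D} (h : M.face.SameCycle d.1 e.1) :
    (M.contract S hS hroot).face.SameCycle d e := by
  have h1 : (M.contract S hS hroot).face = (returnPerm M.face S).subtypePerm (p := fun d => ¬ S d)
      (fun d => not_congr (iff_of_eq (returnPerm_label M.face S d))) :=
    Equiv.ext fun x => Subtype.ext (contract_face_val x)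
  rw [h1]
  exact sameCycle_subtypePerm _ |>.2 (sameCycle_returnPerm h (propext (iff_of_false d.2 e.2)))

end RootedMap

namespace BinTree

/-- The side of a vertex, the root-vertex being considered as a left son. -/
def kind : Address → Side
  | [] => .left
  | s :: _ => s

@[simp] theorem kind_nil : kind [] = .left := rfl

@[simp] theorem kind_cons (s : Side) (p : Address) : kind (s :: p) = s := rfl

theorem isBranching_cons (s : Side) (p : Address) : IsBranching (s :: p) ↔ s ≠ kind p := by
  rcases p with _ | ⟨t, p⟩ <;> cases s <;> try cases t
  all_goals simp [IsBranching, IsLeftSon, IsRightSon]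

theorem ne_kind_iff {s : Side} {p : Address} : s ≠ kind p ↔ s = (kind p).other := by
  cases s <;> cases kind p <;> simp [Side.other]

/-- The highest vertex contracted with `p`. -/
def chainTop : Address → Address
  | [] => []
  | s :: p => if s = kind p then chainTop p else s :: p

theorem chainTop_of_eq {s : Side} {p : Address} (h : s = kind p) :
    chainTop (s :: p) = chainTop p := by simp [chainTop, h]

theorem chainTop_of_ne {s : Side} {p : Address} (h : s ≠ kind p) : chainTop (s :: p) = s :: p := by
  simp [chainTop, h]

theorem eq_replicate_append_chainTop (p : Address) :
    ∃ n, p = List.replicate n (kind p) ++ chainTop p ∧ kind (chainTop p) = kind p := by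
  induction p with
  | nil => exact ⟨0, rfl, rfl⟩
  | cons s p ih =>
    by_cases h : s = kind p
    · obtain ⟨n, h1, h2⟩ := ih
      rw [chainTop_of_eq h]
      refine ⟨n + 1, ?_, by rw [h2, kind_cons, h]⟩
      rw [kind_cons, List.replicate_succ, List.cons_append, h, ← h1]
    · exact ⟨0, by rw [chainTop_of_ne h]; rfl, by rw [chainTop_of_ne h]⟩

variable {B : BinTree}

theorem opp_opp (d : B.HalfEdge) : B.opp (B.opp d) = d := B.oppFun_involutive d

theorem opp_val (d : B.HalfEdge) (h : d.1.1 ≠ []) : (B.opp d).1 = (d.1.1, !d.1.2) := by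
  change (B.oppFun d).1 = _
  simp [oppFun, h]

theorem opp_of_nil (d : B.HalfEdge) (h : d.1.1 = []) : B.opp d = d := by
  change B.oppFun d = _
  simp [oppFun, h]

theorem face_eq {d e : B.HalfEdge} (h : d.1.1 ≠ []) (he : B.cwFun (d.1.1, !d.1.2) = e.1) :
    B.toMap.face d = e := by
  have : B.cwFun (B.opp d).1 = e.1 := by rw [opp_val d h, he]
  exact Subtype.ext this

theorem toMap_cw_eq {d e : B.HalfEdge} (h : B.cwFun d.1 = e.1) : B.toMap.cw d = e := Subtype.ext h

theorem toMap_vert_cw (d : B.toMap.D) : B.toMap.vert (B.toMap.cw d) = B.toMap.vert d := by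
  obtain ⟨⟨p, b⟩, h⟩ := d
  rcases b with _ | _
  · by_cases hN : B.IsNode p
    · rw [toMap_cw_eq (e := ⟨(.right :: p, true), (isVertex_cons B _ p).2 hN, by simp⟩)
        (by simp [cwFun, hN])]
      rfl
    · rw [toMap_cw_eq (e := ⟨(p, false), h⟩) (by simp [cwFun, hN])]
  · rcases p with _ | ⟨_ | _, p⟩
    · simp at h
    · rw [toMap_cw_eq (e := ⟨(p, false), isVertex_tail h.1, by simp⟩) (by simp [cwFun])]
      rfl
    · rw [toMap_cw_eq (e := ⟨(.left :: p, true), (isVertex_cons B _ p).2 ((isVertex_cons B _ p).1 h.1),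
        by simp⟩) (by simp [cwFun])]
      rfl

theorem face_sameCycle_of_eq {d e : B.HalfEdge} (h : d.1.1 ≠ [])
    (he : B.cwFun (d.1.1, !d.1.2) = e.1) : B.toMap.face.SameCycle d e :=
  ⟨1, face_eq h he⟩

theorem toMap_face_sameCycle (p : Address) (hp : B.IsVertex p) (hne : p ≠ []) :
    B.toMap.face.SameCycle (⟨(p, true), hp, fun _ => hne⟩ : B.HalfEdge)
      (⟨(p, false), hp, fun h => absurd h (by simp)⟩ : B.HalfEdge) := by
  obtain ⟨n, hn⟩ : ∃ n, B.depth - p.length = n := ⟨_, rfl⟩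
  induction n using Nat.strong_induction_on generalizing p with
  | _ n ih =>
    by_cases hN : B.IsNode p
    · have hv : ∀ s, B.IsVertex (s :: p) := fun s => (isVertex_cons B s p).2 hN
      have hd : ∀ s, B.depth - (s :: p).length < n := by
        intro s
        obtain ⟨C, hC⟩ := Option.isSome_iff_exists.1 (hv s)
        have := B.length_add_depth_le _ C hC
        simp only [List.length_cons] at this ⊢
        omega
      refine (face_sameCycle_of_eq (e := ⟨(.right :: p, true), hv _, by simp⟩) hne
        (by simp [cwFun, hN])).trans ?_
      refine (ih _ (hd .right) _ (hv _) (by simp) rfl).trans ?_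
      refine (face_sameCycle_of_eq (e := ⟨(.left :: p, true), hv _, by simp⟩) (by simp)
        (by simp [cwFun])).trans ?_
      refine (ih _ (hd .left) _ (hv _) (by simp) rfl).trans ?_
      exact face_sameCycle_of_eq (by simp) (by simp [cwFun])
    · exact face_sameCycle_of_eq hne (by simp [cwFun, hN])

theorem toMap_face_sameCycle_root (p : Address) (hp : B.IsVertex p) :
    B.toMap.face.SameCycle B.toMap.root
      (⟨(p, false), hp, fun h => absurd h (by simp)⟩ : B.HalfEdge) := by
  induction p with
  | nil => exact Perm.SameCycle.refl _ _
  | cons s p ih =>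
    have hN := (isVertex_cons B s p).1 hp
    have hr : B.IsVertex (.right :: p) := (isVertex_cons B _ p).2 hN
    have h1 : B.toMap.face.SameCycle B.toMap.root
        (⟨(.right :: p, true), hr, by simp⟩ : B.HalfEdge) := by
      rcases p with _ | ⟨t, p⟩
      · have : B.cwFun (B.opp ⟨([], false), by simp [IsVertex, sub]⟩).1 =
            ([.right], true) := by
          rw [opp_of_nil _ rfl]
          simp [cwFun, hN]
        exact ⟨1, Subtype.ext this⟩
      · exact ((ih hN.isVertex).trans (toMap_face_sameCycle _ hN.isVertex (by simp)).symm).trans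
          (face_sameCycle_of_eq (by simp) (by simp [cwFun, hN]))
    have h2 := h1.trans (toMap_face_sameCycle _ hr (by simp))
    cases s
    · exact (h2.trans (face_sameCycle_of_eq (e := ⟨(.left :: p, true), hp, by simp⟩) (by simp)
        (by simp [cwFun]))).trans (toMap_face_sameCycle _ hp (by simp))
    · exact h2

theorem theta_face_sameCycle (d e : B.theta.D) : B.theta.face.SameCycle d e := by
  have key : ∀ d : B.toMap.D, B.toMap.face.SameCycle B.toMap.root d := by
    rintro ⟨⟨p, _ | _⟩, hp, h⟩
    · exact toMap_face_sameCycle_root p hp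
    · exact (toMap_face_sameCycle_root p hp).trans (toMap_face_sameCycle p hp (h rfl)).symm
  exact RootedMap.contract_face_sameCycle ((key d.1).symm.trans (key e.1))

/-- The vertex of `θ(B)` into which a vertex of `B` is contracted. -/
noncomputable def thetaVertex (p : Address) (hp : B.IsVertex p) : B.theta.V :=
  Quot.mk _ (⟨p, hp⟩ : {p // B.IsVertex p})

theorem toMap_vert_opp (s : Side) (p : Address) (b : Bool) (h : B.IsVertex (s :: p)) :
    B.toMap.vert (B.opp ⟨(s :: p, b), h, by simp⟩) = B.toMap.vert
      (⟨(s :: p, !b), h, by simp⟩ : B.HalfEdge) :=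
  congrArg B.toMap.vert (Subtype.ext (opp_val _ (by simp)) :
    B.opp ⟨(s :: p, b), h, by simp⟩ = ⟨(s :: p, !b), h, by simp⟩)

theorem thetaVertex_cons {s : Side} {p : Address} (hs : B.IsVertex (s :: p)) (hp : B.IsVertex p)
    (h : s = kind p) : thetaVertex (s :: p) hs = thetaVertex p hp :=
  Quot.sound ⟨(⟨(s :: p, false), hs, by simp⟩ : B.HalfEdge),
    ⟨by simp, by rw [isBranching_cons]; simpa using h⟩, rfl, toMap_vert_opp s p false hs⟩

/-- The highest vertex of `B` contracted into a vertex of `θ(B)`. -/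
noncomputable def thetaTop : B.theta.V → Address :=
  Quot.lift (fun p => chainTop p.1) (by
    rintro x y ⟨⟨⟨p, b⟩, h1, h2⟩, ⟨h3, h4⟩, rfl, rfl⟩
    rcases p with _ | ⟨s, p⟩
    · simp at h3
    · rw [isBranching_cons, not_not] at h4
      refine Eq.trans ?_ (congrArg (fun v => chainTop v.1) (toMap_vert_opp s p b h1)).symm
      cases b
      · exact chainTop_of_eq h4
      · exact (chainTop_of_eq h4).symm)

theorem thetaTop_thetaVertex (p : Address) (hp : B.IsVertex p) :
    thetaTop (thetaVertex p hp) = chainTop p := rfl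

theorem isVertex_chainTop {p : Address} (hp : B.IsVertex p) : B.IsVertex (chainTop p) := by
  induction p with
  | nil => exact hp
  | cons s p ih =>
    by_cases h : s = kind p
    · rw [chainTop_of_eq h]
      exact ih (isVertex_tail hp)
    · rwa [chainTop_of_ne h]

theorem thetaVertex_congr {p q : Address} {hp : B.IsVertex p} {hq : B.IsVertex q} (h : p = q) :
    thetaVertex p hp = thetaVertex q hq := by
  subst h
  rfl

theorem thetaVertex_chainTop (p : Address) (hp : B.IsVertex p) :
    thetaVertex (chainTop p) (isVertex_chainTop hp) = thetaVertex p hp := by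
  induction p with
  | nil => rfl
  | cons s p ih =>
    by_cases h : s = kind p
    · have hp' : B.IsVertex p := isVertex_tail hp
      rw [thetaVertex_cons hp hp' h, ← ih hp']
      exact thetaVertex_congr (chainTop_of_eq h)
    · exact thetaVertex_congr (chainTop_of_ne h)

theorem thetaTop_injective : Function.Injective (thetaTop (B := B)) := by
  rintro ⟨⟨p, hp⟩⟩ ⟨⟨q, hq⟩⟩ h
  change thetaVertex p hp = thetaVertex q hq
  rw [← thetaVertex_chainTop, ← thetaVertex_chainTop q]
  exact thetaVertex_congr h

/-- The half-edge at the son on side `s` of a node `p`, or at `p` itself if this is contracted with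
its son on side `s`, of the branching edge from `p` to one of its sons. -/
noncomputable def thetaHalf (p : Address) (hp : B.IsNode p) (s : Side) : B.theta.D :=
  ⟨(⟨((kind p).other :: p, decide (s = kind p)), (isVertex_cons B _ p).2 hp, by simp⟩ : B.HalfEdge),
    fun h => h.2 ((isBranching_cons _ _).2 (Side.other_ne _))⟩

theorem thetaHalf_inj {p p' : Address} {hp : B.IsNode p} {hp' : B.IsNode p'} {s s' : Side}
    (h : thetaHalf p hp s = thetaHalf p' hp' s') : p = p' ∧ s = s' := by
  have h := congrArg (fun d => d.1.1) h
  simp only [thetaHalf, Prod.mk.injEq, List.cons.injEq, decide_eq_decide] at h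
  obtain ⟨⟨-, rfl⟩, h⟩ := h
  refine ⟨rfl, ?_⟩
  revert h
  cases s <;> cases s' <;> cases kind p <;> simp

theorem thetaHalf_ne_root {p : Address} {hp : B.IsNode p} {s : Side} :
    thetaHalf p hp s ≠ B.theta.root := by
  intro h
  have h := congrArg (fun d => d.1.1.1) h
  exact List.cons_ne_nil _ _ h

theorem theta_cases (d : B.theta.D) : d = B.theta.root ∨ ∃ p hp s, d = thetaHalf p hp s := by
  obtain ⟨⟨⟨p, b⟩, h1, h2⟩, h3⟩ := d
  rcases p with _ | ⟨t, p⟩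
  · left
    rcases b with _ | _
    · rfl
    · simp at h2
  · right
    have h4 : t ≠ kind p := by
      rw [← isBranching_cons]
      by_contra h
      exact h3 ⟨by simp, h⟩
    refine ⟨p, (isVertex_cons B t p).1 h1, if b then kind p else (kind p).other, ?_⟩
    refine Subtype.ext (Subtype.ext (Prod.ext ?_ ?_))
    · simp [thetaHalf, ← ne_kind_iff, h4]
    · rcases b with _ | _ <;> simp [thetaHalf, Side.other_ne]

theorem theta_opp_root : B.theta.opp B.theta.root = B.theta.root := by
  exact Subtype.ext (opp_of_nil _ rfl)

theorem theta_opp_thetaHalf (p : Address) (hp : B.IsNode p) (s : Side) :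
    B.theta.opp (thetaHalf p hp s) = thetaHalf p hp s.other := by
  have h : (!decide (s = kind p)) = decide (s.other = kind p) := by
    cases s <;> cases kind p <;> simp [Side.other]
  exact Subtype.ext (Subtype.ext ((opp_val _ (List.cons_ne_nil _ _)).trans
    (congrArg (Prod.mk _) h)))

theorem theta_vert_thetaHalf (p : Address) (hp : B.IsNode p) (s : Side) :
    B.theta.vert (thetaHalf p hp s) = thetaVertex (s :: p) ((isVertex_cons B s p).2 hp) := by
  by_cases h : s = kind p
  · rw [thetaVertex_cons _ hp.isVertex h]
    simp [thetaHalf, theta, RootedMap.contract, toMap, h, thetaVertex]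
  · obtain rfl := ne_kind_iff.1 h
    simp [thetaHalf, theta, RootedMap.contract, toMap, thetaVertex, Side.other_ne]

theorem theta_vert_root : B.theta.vert B.theta.root = thetaVertex [] (by simp [IsVertex, sub]) := by
  simp [theta, RootedMap.contract, toMap, thetaVertex]

theorem theta_vert_cw (d : B.theta.D) : B.theta.vert (B.theta.cw d) = B.theta.vert d :=
  RootedMap.contract_vert_cw toMap_vert_cw d

theorem via_face_opp {S : B.toMap.D → Prop} {d e : B.HalfEdge} (h : B.cwFun d.1 = e.1) :
    Via B.toMap.face S (B.toMap.opp d) e := by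
  refine Via.one' (Subtype.ext ?_)
  have : B.cwFun (B.opp (B.opp d)).1 = e.1 := by rw [opp_opp, h]
  exact this

theorem theta_cw_root (h : B.IsNode []) : B.theta.cw B.theta.root = thetaHalf [] h .left := by
  refine RootedMap.contract_cw_eq opp_opp (via_face_opp ?_)
  simp [theta, RootedMap.contract, toMap, cwFun, h, thetaHalf, Side.other]

theorem theta_cw_left (p : Address) (hp : B.IsNode p) (hq : B.IsNode (.left :: p)) :
    B.theta.cw (thetaHalf p hp .left) = thetaHalf (.left :: p) hq .left := by
  refine RootedMap.contract_cw_eq opp_opp ?_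
  rcases hk : kind p with _ | _
  · refine (via_face_opp (e := ⟨(.left :: p, true), hq.isVertex, by simp⟩) ?_).next' ?_
      (face_eq (by simp) ?_)
    · simp [thetaHalf, hk, Side.other, cwFun]
    · exact ⟨by simp, by rw [isBranching_cons]; simpa using hk.symm⟩
    · simp [cwFun, hq, thetaHalf, Side.other]
  · refine via_face_opp ?_
    simp [thetaHalf, hk, Side.other, cwFun, hq]

theorem theta_cw_right (p : Address) (hp : B.IsNode p) (hq : B.IsNode (.right :: p)) :
    B.theta.cw (thetaHalf (.right :: p) hq .right) = thetaHalf p hp .right := by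
  refine RootedMap.contract_cw_eq opp_opp ?_
  rcases hk : kind p with _ | _
  · refine via_face_opp ?_
    simp [thetaHalf, hk, Side.other, cwFun]
  · refine (via_face_opp (e := ⟨(.right :: p, false), hq.isVertex, by simp⟩) ?_).next' ?_
      (face_eq (by simp) ?_)
    · simp [thetaHalf, Side.other, cwFun]
    · exact ⟨by simp, by rw [isBranching_cons]; simpa using hk.symm⟩
    · simp [cwFun, hk, thetaHalf, Side.other]

theorem theta_vert_surjective : Function.Surjective B.theta.vert := by
  rintro ⟨⟨p, hp⟩⟩
  rcases p with _ | ⟨s, p⟩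
  · exact ⟨B.theta.root, theta_vert_root⟩
  · exact ⟨thetaHalf p ((isVertex_cons B s p).1 hp) s, theta_vert_thetaHalf _ _ _⟩

theorem theta_connected (x y : B.theta.V) : Relation.ReflTransGen
    (fun x y => ∃ d, B.theta.vert d = x ∧ B.theta.vert (B.theta.opp d) = y) x y := by
  have key : ∀ p (hp : B.IsVertex p),
      Relation.ReflTransGen
        (fun x y => ∃ d, B.theta.vert d = x ∧ B.theta.vert (B.theta.opp d) = y)
        (thetaVertex [] (by simp [IsVertex, sub])) (thetaVertex p hp) ∧
      Relation.ReflTransGen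
        (fun x y => ∃ d, B.theta.vert d = x ∧ B.theta.vert (B.theta.opp d) = y)
        (thetaVertex p hp) (thetaVertex [] (by simp [IsVertex, sub])) := by
    intro p
    induction p with
    | nil => exact fun _ => ⟨.refl, .refl⟩
    | cons s p ih =>
      intro hp
      have hN := (isVertex_cons B s p).1 hp
      obtain ⟨h1, h2⟩ := ih hN.isVertex
      by_cases h : s = kind p
      · rw [thetaVertex_cons hp hN.isVertex h]
        exact ⟨h1, h2⟩
      · obtain rfl := ne_kind_iff.1 h
        have e1 : B.theta.vert (thetaHalf p hN (kind p)) = thetaVertex p hN.isVertex := by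
          rw [theta_vert_thetaHalf, thetaVertex_cons _ hN.isVertex rfl]
        have e2 := theta_vert_thetaHalf p hN (kind p).other
        exact ⟨h1.tail ⟨thetaHalf p hN (kind p), e1, by rw [theta_opp_thetaHalf, e2]⟩,
          .head ⟨thetaHalf p hN (kind p).other, e2, by
            rw [theta_opp_thetaHalf, Side.other_other, e1]⟩ h2⟩
  obtain ⟨⟨p, hp⟩⟩ := x
  obtain ⟨⟨q, hq⟩⟩ := y
  exact (key p hp).2.trans (key q hq).1

theorem isNode_of_isVertex_append {p : Address} {s : Side} {n : ℕ}
    (h : B.IsVertex (List.replicate (n + 1) s ++ p)) : B.IsNode p := by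
  induction n with
  | zero => simpa [isVertex_cons] using h
  | succ n ih =>
    rw [List.replicate_succ, List.cons_append, isVertex_cons] at h
    exact ih h.isVertex

theorem Leaf.vertex_injective : Function.Injective (Leaf.vertex (B := B)) := by
  intro l m h
  have h : chainTop l.1 = chainTop m.1 := congrArg thetaTop h
  obtain ⟨i, hi, hi'⟩ := eq_replicate_append_chainTop l.1
  obtain ⟨j, hj, hj'⟩ := eq_replicate_append_chainTop m.1
  rw [h] at hi hi'
  rw [← hi'] at hi
  rw [← hj'] at hj
  have key : ∀ (l m : B.Leaf) (i j : ℕ) (s : Side) (t : Address), l.1 = List.replicate i s ++ t →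
      m.1 = List.replicate j s ++ t → ¬ i < j := by
    intro l m i j s t h1 h2 hij
    obtain ⟨n, rfl⟩ := Nat.exists_eq_add_of_lt hij
    rw [show i + n + 1 = (n + 1) + i by omega, ← List.replicate_append_replicate,
      List.append_assoc, ← h1] at h2
    have := m.2.isVertex
    rw [h2] at this
    exact l.2.not_isNode (isNode_of_isVertex_append this)
  have h1 := key _ _ _ _ _ _ hi hj
  have h2 := key _ _ _ _ _ _ hj hi
  obtain rfl : i = j := by omega
  exact Subtype.ext (hi.trans hj.symm)

theorem Leaf.vertex_surjective : Function.Surjective (Leaf.vertex (B := B)) := by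
  rintro ⟨⟨p, hp⟩⟩
  change ∃ l : B.Leaf, l.vertex = thetaVertex p hp
  obtain ⟨n, hn⟩ : ∃ n, B.depth - p.length = n := ⟨_, rfl⟩
  induction n using Nat.strong_induction_on generalizing p with
  | _ n ih =>
    rcases isLeaf_or_isNode hp with h | h
    · exact ⟨⟨p, h⟩, rfl⟩
    · have hv := (isVertex_cons B (kind p) p).2 h
      have hlt : B.depth - (kind p :: p).length < n := by
        obtain ⟨C, hC⟩ := Option.isSome_iff_exists.1 hv
        have := B.length_add_depth_le _ C hC
        simp only [List.length_cons] at this ⊢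
        omega
      obtain ⟨l, hl⟩ := ih _ hlt _ hv rfl
      exact ⟨l, hl.trans (thetaVertex_cons hv hp rfl)⟩

end BinTree

section Lambda

open BinTree

/-- The address of the highest vertex of the chain of the vertex opened at label `k`. -/
def fatherAddr (u : List Letter) (s : Side) (k : ℕ) : Address :=
  if s = .left ∧ k = 0 then [] else s :: addr u k

theorem chainTop_addr {u : List Letter} (hu : IsPrefixShuffle u) (s : Side) (e : ℕ)
    (he : IsLabel u e) : chainTop (s :: addr u e) = fatherAddr u s (opening u s e) := by
  induction e using Nat.strong_induction_on with
  | _ e ih =>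
    rcases he with rfl | ⟨i, rfl, t, ht⟩
    · cases s <;> simp [addr_zero, fatherAddr, opening, stk, chainTop]
    · by_cases hts : t = s
      · subst hts
        have ha : addr u (i + 1) = _ := addr_touch (s := t.other) hu (by simpa using ht)
        rw [opening_open ht, chainTop_of_ne (by rw [ha]; exact (Side.other_ne t).symm), fatherAddr]
        simp
      · have hts : t = s.other := by cases t <;> cases s <;> simp_all [Side.other]
        subst hts
        have ha := addr_touch hu ht
        rw [chainTop_of_eq (by rw [ha]; rfl), ha,
          ih _ (by have := latest_le hu s i; omega) (isLabel_latest hu s i),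
          opening_latest hu, opening_touch hu ht]

theorem fatherAddr_inj {u : List Letter} (hu : IsPrefixShuffle u) {s s' : Side} {k k' : ℕ}
    (hk : IsLabel u k) (hk' : IsLabel u k') (h : fatherAddr u s k = fatherAddr u s' k') :
    s = s' ∧ k = k' := by
  have inj : addr u k = addr u k' → k = k' :=
    (lambda₁_spec hu (max k k')).2.2 k k' (by omega) (by omega) hk hk'
  unfold fatherAddr at h
  split_ifs at h with h1 h2 h2
  · exact ⟨h1.1.trans h2.1.symm, h1.2.trans h2.2.symm⟩
  · exact ⟨(List.cons.inj h).1, inj (List.cons.inj h).2⟩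

end Lambda

/-! ### The half-edges of `M_w` and of `M★_w` -/

namespace PrefixMap

variable {w : List Letter}

theorem isPrefixShuffle_plus (hw : IsPrefixShuffle w) : IsPrefixShuffle (plus w) := by
  intro v hv
  have hc := hw w (List.prefix_refl w)
  rcases List.prefix_or_prefix_of_prefix hv (List.prefix_append w _) with h | ⟨t, rfl⟩
  · exact hw v h
  · rw [plus, List.prefix_append_right_inj, List.prefix_replicate_iff] at hv
    obtain ⟨h1, h2⟩ := hv
    rw [h2]
    simp [List.count_append, List.count_replicate]
    omega

theorem take_plus (w : List Letter) : (plus w).take w.length = w := by simp [plus]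

theorem length_le_plus (w : List Letter) : w.length ≤ (plus w).length := by simp [plus]

theorem count_plus (hw : IsPrefixShuffle w) : (plus w).count .a = (plus w).count .abar := by
  have hc := hw w (List.prefix_refl w)
  simp [plus, List.count_append, List.count_replicate]
  omega

theorem getElem?_plus_of_le {n : ℕ} (h : w.length ≤ n) (hn : n < (plus w).length) :
    (plus w)[n]? = some .abar := by
  rw [plus, List.length_append, List.length_replicate] at hn
  rw [plus, List.getElem?_append_right h, List.getElem?_replicate]
  simp
  omega

/-- After `w⁺` there is no active black vertex but the root-vertex of `M_w`. -/
theorem isOpened_right_length (hw : IsPrefixShuffle w) {k : ℕ}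
    (h : IsOpened (plus w) .right (plus w).length k) : k = 0 := by
  have hl := length_stk (isPrefixShuffle_plus hw) .right (plus w).length
  rw [List.take_length] at hl
  have hc := count_plus hw
  obtain ⟨r, hr⟩ := stk_eq_cons (isPrefixShuffle_plus hw) .right (plus w).length
  simp only [hr, List.length_cons, Side.cls, Side.opn, hc] at hl
  obtain rfl : r = [] := List.length_eq_zero_iff.1 (by omega)
  obtain ⟨e, h⟩ := h
  rw [hr, List.mem_singleton] at h
  rcases stk_cons (isPrefixShuffle_plus hw) hr with ⟨h1, -⟩ | ⟨i, -, -, -, h2, -⟩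
  · rw [(Prod.mk.inj h).1, h1]
  · obtain ⟨r', hr'⟩ := stk_eq_cons (isPrefixShuffle_plus hw) .right i
    simp [hr'] at h2

theorem IsPaired.lt_length {c c' : Letter} {u : List Letter} {i j : ℕ} (h : IsPaired c c' u i j) :
    j < u.length := (List.getElem?_eq_some_iff.1 h.2.2.1).1

/-- The half-edge met at position `n` of the tour. -/
def pos (w : List Letter) (n : ℕ) : HalfEdge w := Fin.ofNat _ n

theorem pos_val {n : ℕ} (h : n ≤ (plus w).length) : (pos w n).val = n := by
  simp [pos, Fin.ofNat]
  omega

theorem pos_val_self (d : HalfEdge w) : pos w d.val = d := by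
  apply Fin.ext
  rw [pos_val (by omega)]

theorem pos_zero : pos w 0 = root w := rfl

theorem exists_pos (d : HalfEdge w) : d = root w ∨ ∃ n x, d = pos w (n + 1) ∧ (plus w)[n]? = some x := by
  obtain ⟨_ | n, h⟩ := d
  · exact Or.inl rfl
  · have h' : n < (plus w).length := by omega
    exact Or.inr ⟨n, _, (pos_val_self _).symm, List.getElem?_eq_getElem h'⟩

theorem finRotate_pos (n : ℕ) : finRotate _ (pos w n) = pos w (n + 1) := by
  rw [finRotate_apply]
  apply Fin.ext
  simp [pos, Fin.ofNat, Fin.val_add]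

theorem hasLetter_pos {n : ℕ} {c x : Letter} (h : (plus w)[n]? = some x) :
    HasLetter w (pos w (n + 1)) c ↔ c = x := by
  have hn := (List.getElem?_eq_some_iff.1 h).1
  unfold HasLetter
  rw [pos_val (by omega)]
  constructor
  · rintro ⟨i, h1, h2⟩
    obtain rfl : n = i := by omega
    rw [h] at h2
    exact (Option.some.inj h2).symm
  · rintro rfl
    exact ⟨n, rfl, h⟩

theorem pos_succ_ne_root {n : ℕ} (h : n < (plus w).length) : pos w (n + 1) ≠ root w := by
  intro e
  have := congrArg Fin.val e
  rw [pos_val (by omega)] at this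
  simp [root] at this

theorem isHead_pos {n : ℕ} {x : Letter} (h : (plus w)[n]? = some x) :
    IsHead w (pos w (n + 1)) ↔ x = .abar ∨ x = .b := by
  rw [IsHead, hasLetter_pos h, hasLetter_pos h]
  simp [pos_succ_ne_root (List.getElem?_eq_some_iff.1 h).1, eq_comm]

theorem linked_pos {c c' : Letter} {i j : ℕ} (h : IsPaired c c' (plus w) i j) :
    Linked w c c' (pos w (i + 1)) (pos w (j + 1)) := by
  have h1 := h.1
  have h2 := IsPaired.lt_length h
  exact ⟨i, j, pos_val (by omega), pos_val (by omega), Or.inl h⟩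

theorem treeOpp_eq {d e : HalfEdge w} (h : Linked w .a .abar d e) : treeOpp w d = e :=
  partner_eq (fun _ _ _ h h' => h.unique (by simp) h') h

theorem treeOpp_treeOpp (d : HalfEdge w) : treeOpp w (treeOpp w d) = d :=
  partner_involutive (R := Linked w .a .abar) (fun _ _ h => h.symm)
    (fun _ _ _ h h' => h.unique (by simp) h') d

theorem opp_eq {d e : HalfEdge w} (h : Linked w .a .abar d e ∨ Linked w .b .bbar d e) :
    opp w d = e := by
  refine partner_eq (R := fun d e => Linked w .a .abar d e ∨ Linked w .b .bbar d e) ?_ h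
  rintro d e f (h | h) (h' | h')
  · exact h.unique (by simp) h'
  · exfalso
    rcases h.letter with h | h <;> rcases h'.letter with h' | h' <;> cases h.unique h'
  · exfalso
    rcases h.letter with h | h <;> rcases h'.letter with h' | h' <;> cases h.unique h'
  · exact h.unique (by simp) h'

theorem treeOpp_root : treeOpp w (root w) = root w := by
  refine partner_of_not ?_
  rintro ⟨y, i, _, h, _⟩
  simp [root] at h

theorem treeOpp_pos {n : ℕ} {x : Letter} (h : (plus w)[n]? = some x) (ha : x ≠ .a)
    (ha' : x ≠ .abar) : treeOpp w (pos w (n + 1)) = pos w (n + 1) := by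
  refine partner_of_not ?_
  rintro ⟨y, hy⟩
  rcases hy.letter with h' | h' <;> rw [hasLetter_pos h] at h'
  · exact ha h'.symm
  · exact ha' h'.symm

theorem ccw_treeOpp_pos (n : ℕ) : ccw w (treeOpp w (pos w n)) = pos w (n + 1) := by
  rw [ccw, Perm.mul_apply, ← finRotate_pos]
  simp

/-- Every letter `a` of `w⁺` is paired. -/
theorem exists_paired_a (hw : IsPrefixShuffle w) {i : ℕ} (h : (plus w)[i]? = some .a) :
    ∃ j, IsPaired .a .abar (plus w) i j := by
  have hi := (List.getElem?_eq_some_iff.1 h).1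
  by_contra hno
  have := (isOpened_iff (s := .right) (isPrefixShuffle_plus hw) h hi).2
    (fun ⟨j, _, hj⟩ => hno ⟨j, hj⟩)
  have := isOpened_right_length hw this
  omega

theorem exists_paired_abar (hw : IsPrefixShuffle w) {j : ℕ} (h : (plus w)[j]? = some .abar) :
    ∃ i, IsPaired .a .abar (plus w) i j := by
  obtain ⟨i, _, _, _, h⟩ := isPaired_of_close (s := .right) (isPrefixShuffle_plus hw) h
  exact ⟨i, h⟩

theorem exists_paired_bbar (hw : IsPrefixShuffle w) {j : ℕ} (h : (plus w)[j]? = some .bbar) :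
    ∃ i, IsPaired .b .bbar (plus w) i j := by
  obtain ⟨i, _, _, _, h⟩ := isPaired_of_close (s := .left) (isPrefixShuffle_plus hw) h
  exact ⟨i, h⟩

theorem isDangling_pos (hw : IsPrefixShuffle w) {k : ℕ} (hk : k ≤ (plus w).length) :
    IsDangling w (pos w k) ↔ k ≠ 0 ∧ IsOpened (plus w) .left (plus w).length k := by
  rcases k with _ | i
  · simp only [IsDangling, HasLetter, pos_zero, root]
    simp
  · have hx := List.getElem?_eq_getElem (l := plus w) (i := i) (by omega)
    have hu := isPrefixShuffle_plus hw
    constructor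
    · rintro ⟨h1, h2⟩
      rw [hasLetter_pos hx] at h1
      rw [← h1] at hx
      refine ⟨by omega, (isOpened_iff (s := .left) hu hx (by omega)).2 ?_⟩
      rintro ⟨j, -, hj⟩
      exact h2 ⟨_, linked_pos hj⟩
    · rintro ⟨-, e, h⟩
      obtain ⟨-, -, -, -, -, h1⟩ := mem_stk hu h
      rcases h1 with h1 | ⟨i', h1, h2⟩
      · omega
      · obtain rfl : i = i' := by omega
        refine ⟨(hasLetter_pos h2).2 rfl, ?_⟩
        rintro ⟨d, i', j, h3, h4, h5⟩
        rw [pos_val hk] at h3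
        obtain rfl : i = i' := by omega
        rcases h5 with h5 | h5
        · exact (isOpened_iff (s := .left) hu h2 (by omega)).1 ⟨e, h⟩ ⟨j, IsPaired.lt_length h5, h5⟩
        · rw [h5.2.2.1] at h2
          cases h2

/-! ### Heads and labels -/

/-- The label of the edge of a head. -/
noncomputable def lab (h : Head w) : ℕ := (treeOpp w h.1).val

theorem isHead_treeOpp_pos (hw : IsPrefixShuffle w) {e : ℕ} (he : IsLabel (plus w) e) :
    IsHead w (treeOpp w (pos w e)) := by
  rcases he with rfl | ⟨i, rfl, s, hs⟩
  · rw [pos_zero, treeOpp_root]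
    exact Or.inl rfl
  · cases s
    · rw [treeOpp_pos hs (by simp [Side.opn]) (by simp [Side.opn]), isHead_pos hs]
      simp [Side.opn]
    · obtain ⟨j, hj⟩ := exists_paired_a hw hs
      rw [treeOpp_eq (linked_pos hj), isHead_pos hj.2.2.1]
      simp

/-- The head of the edge of label `e`. -/
noncomputable def hd (hw : IsPrefixShuffle w) {e : ℕ} (he : IsLabel (plus w) e) : Head w :=
  ⟨treeOpp w (pos w e), isHead_treeOpp_pos hw he⟩

theorem hd_val (hw : IsPrefixShuffle w) {e : ℕ} (he : IsLabel (plus w) e) :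
    (hd hw he).1 = treeOpp w (pos w e) := rfl

theorem isLabel_zero (u : List Letter) : IsLabel u 0 := Or.inl rfl

theorem lab_hd (hw : IsPrefixShuffle w) {e : ℕ} (he : IsLabel (plus w) e) : lab (hd hw he) = e := by
  rw [lab, hd, treeOpp_treeOpp, pos_val he.le]

theorem isLabel_lab (hw : IsPrefixShuffle w) (h : Head w) : IsLabel (plus w) (lab h) := by
  obtain ⟨d, hd⟩ := h
  rcases exists_pos d with rfl | ⟨n, x, rfl, hx⟩
  · left
    rw [lab, treeOpp_root]
    rfl
  · have hn := (List.getElem?_eq_some_iff.1 hx).1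
    rcases (isHead_pos hx).1 hd with rfl | rfl
    · obtain ⟨i, hi⟩ := exists_paired_abar hw hx
      rw [lab, treeOpp_eq (linked_pos hi).symm, pos_val (by have := hi.1; omega)]
      exact Or.inr ⟨i, rfl, .right, hi.2.1⟩
    · rw [lab, treeOpp_pos hx (by simp) (by simp), pos_val (by omega)]
      exact Or.inr ⟨n, rfl, .left, hx⟩

theorem hd_lab (hw : IsPrefixShuffle w) (h : Head w) : hd hw (isLabel_lab hw h) = h := by
  apply Subtype.ext
  rw [hd_val]
  unfold lab
  rw [pos_val_self, treeOpp_treeOpp]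

theorem exists_hd (hw : IsPrefixShuffle w) (h : Head w) : ∃ e, ∃ he : IsLabel (plus w) e, h = hd hw he :=
  ⟨lab h, isLabel_lab hw h, (hd_lab hw h).symm⟩

theorem hd_congr (hw : IsPrefixShuffle w) {e e' : ℕ} {he : IsLabel (plus w) e}
    {he' : IsLabel (plus w) e'} (h : e = e') : hd hw he = hd hw he' := by
  subst h
  rfl

theorem ccw_hd (hw : IsPrefixShuffle w) {e : ℕ} (he : IsLabel (plus w) e) :
    ccw w (hd hw he).1 = pos w (e + 1) := ccw_treeOpp_pos e

theorem ccw_pos_of_paired {i j : ℕ} (h : IsPaired .a .abar (plus w) i j) :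
    ccw w (pos w (i + 1)) = pos w (j + 2) := by
  rw [← treeOpp_eq (linked_pos h).symm, ccw_treeOpp_pos]

theorem ccw_pos {n : ℕ} {x : Letter} (h : (plus w)[n]? = some x) (ha : x ≠ .a)
    (ha' : x ≠ .abar) : ccw w (pos w (n + 1)) = pos w (n + 2) := by
  conv_lhs => rw [← treeOpp_pos h ha ha', ccw_treeOpp_pos]

theorem hd_val_b (hw : IsPrefixShuffle w) {i : ℕ} (h : (plus w)[i]? = some .b)
    (he : IsLabel (plus w) (i + 1)) : (hd hw he).1 = pos w (i + 1) :=
  treeOpp_pos h (by simp) (by simp)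

theorem hd_zero (hw : IsPrefixShuffle w) (he : IsLabel (plus w) 0) : (hd hw he).1 = root w := by
  rw [hd_val, pos_zero, treeOpp_root]

/-! ### Following the borders of the faces of `M★_w` -/

theorem starFace_near (h : Head w) : starFace w (near h) = old (ccw w h.1) := rfl

theorem starFace_far (h : Head w) : starFace w (far h) = far ((nextHead w).symm h) := rfl

theorem starFace_old_head {d : HalfEdge w} (h : IsHead w (opp w d)) :
    starFace w (old d) = near ⟨opp w d, h⟩ :=
  dif_pos h

theorem starFace_old_tail {d : HalfEdge w} (h : ¬ IsHead w (opp w d)) :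
    starFace w (old d) = old (ccw w (opp w d)) :=
  dif_neg h

theorem starFace_old_eq_near {d : HalfEdge w} {h : Head w} (hd : opp w d = h.1) :
    starFace w (old d) = near h := by
  rw [starFace_old_head (by rw [hd]; exact h.2)]
  congr 1
  exact Subtype.ext hd

theorem starFace_near_hd (hw : IsPrefixShuffle w) {e : ℕ} (he : IsLabel (plus w) e) :
    starFace w (near (hd hw he)) = old (pos w (e + 1)) := by
  rw [starFace_near, ccw_hd]

theorem starFace_root (hw : IsPrefixShuffle w) :
    starFace w (old (root w)) = near (hd hw (isLabel_zero _)) :=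
  starFace_old_eq_near (by rw [opp_root, hd_zero])

theorem starFace_a (hw : IsPrefixShuffle w) {i : ℕ} (h : (plus w)[i]? = some .a)
    (he : IsLabel (plus w) (i + 1)) : starFace w (old (pos w (i + 1))) = near (hd hw he) := by
  obtain ⟨j, hj⟩ := exists_paired_a hw h
  exact starFace_old_eq_near (by rw [opp_eq (Or.inl (linked_pos hj)), hd_val, treeOpp_eq (linked_pos hj)])

theorem starFace_abar (hw : IsPrefixShuffle w) {j : ℕ} (h : (plus w)[j]? = some .abar) :
    starFace w (old (pos w (j + 1))) = old (pos w (j + 2)) := by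
  obtain ⟨i, hi⟩ := exists_paired_abar hw h
  have e := opp_eq (Or.inl (linked_pos hi).symm)
  rw [starFace_old_tail, e, ccw_pos_of_paired hi]
  rw [e, isHead_pos hi.2.1]
  simp

theorem starFace_b {i j : ℕ} (h : IsPaired .b .bbar (plus w) i j) :
    starFace w (old (pos w (i + 1))) = old (pos w (j + 2)) := by
  have e := opp_eq (Or.inr (linked_pos h))
  rw [starFace_old_tail, e, ccw_pos h.2.2.1 (by simp) (by simp)]
  rw [e, isHead_pos h.2.2.1]
  simp

theorem starFace_bbar (hw : IsPrefixShuffle w) {i j : ℕ} (h : IsPaired .b .bbar (plus w) i j)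
    (he : IsLabel (plus w) (i + 1)) : starFace w (old (pos w (j + 1))) = near (hd hw he) :=
  starFace_old_eq_near (by rw [opp_eq (Or.inr (linked_pos h).symm), hd_val_b hw h.2.1])

theorem opp_of_isDangling {d : HalfEdge w} (h : IsDangling w d) : opp w d = d := by
  refine partner_of_not (R := fun d e => Linked w .a .abar d e ∨ Linked w .b .bbar d e) ?_
  rintro ⟨y, hy | hy⟩
  · rcases hy.letter with h' | h' <;> cases h.1.unique h'
  · exact h.2 ⟨y, hy⟩

theorem starFace_dangling {d : HalfEdge w} (h : IsDangling w d) {h' : Head w} (e : h'.1 = d) :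
    starFace w (old d) = near h' :=
  starFace_old_eq_near ((opp_of_isDangling h).trans e.symm)

theorem IsDangling.hd_eq (hw : IsPrefixShuffle w) {k : ℕ} (h : IsDangling w (pos w k))
    (he : IsLabel (plus w) k) : (hd hw he).1 = pos w k := by
  rcases he with rfl | ⟨i, rfl, s, hs⟩
  · exact hd_zero hw _
  · have e : Letter.b = s.opn := (hasLetter_pos hs).1 h.1
    exact hd_val_b hw (e ▸ hs) _

end PrefixMap

/-! ### The faces of `M★_w` -/

namespace PrefixMap

variable {w : List Letter}

theorem IsPaired.opening_eq {u : List Letter} {s : Side} (hu : IsPrefixShuffle u) {i j : ℕ}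
    (h : IsPaired s.opn s.cls u i j) :
    opening u s j = i + 1 ∧ opening u s (j + 1) = opening u s i := by
  obtain ⟨⟨e, h1⟩, h2⟩ := h.stk_eq hu
  exact ⟨_root_.opening_eq h1, by simp [opening, h2]⟩

theorem opening_right_treeOpp (hw : IsPrefixShuffle w) (d : HalfEdge w) :
    opening (plus w) .right ((treeOpp w d).val - 1) = opening (plus w) .right d.val := by
  have hu := isPrefixShuffle_plus hw
  rcases exists_pos d with rfl | ⟨n, x, rfl, hx⟩
  · rw [treeOpp_root]
    rfl
  · have hn := (List.getElem?_eq_some_iff.1 hx).1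
    rw [pos_val (by omega)]
    cases x
    · obtain ⟨j, hj⟩ := exists_paired_a hw hx
      rw [treeOpp_eq (linked_pos hj), pos_val (IsPaired.lt_length hj),
        opening_open (s := .right) hx]
      exact (IsPaired.opening_eq (s := .right) hu hj).1
    · obtain ⟨i, hi⟩ := exists_paired_abar hw hx
      rw [treeOpp_eq (linked_pos hi).symm, pos_val (by have := hi.1; omega)]
      exact (IsPaired.opening_eq (s := .right) hu hi).2.symm
    · rw [treeOpp_pos hx (by simp) (by simp), pos_val (by omega)]
      exact (opening_touch (s := .right) hu hx).symm
    · rw [treeOpp_pos hx (by simp) (by simp), pos_val (by omega)]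
      exact (opening_other (s := .right) hx).symm

theorem opening_right_length (hw : IsPrefixShuffle w) :
    opening (plus w) .right (plus w).length = 0 :=
  isOpened_right_length hw (isOpened_opening (isPrefixShuffle_plus hw) _ _)

theorem pos_length_succ : pos w ((plus w).length + 1) = root w := by
  apply Fin.ext
  simp [pos, Fin.ofNat, root]

theorem opening_right_ccw (hw : IsPrefixShuffle w) (d : HalfEdge w) :
    opening (plus w) .right ((ccw w d).val - 1) = opening (plus w) .right (d.val - 1) := by
  obtain ⟨d', rfl⟩ := (treeOpp w).surjective d
  rw [opening_right_treeOpp hw]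
  conv_lhs => rw [← pos_val_self d', ccw_treeOpp_pos]
  have hd := d'.isLt
  rcases Nat.lt_or_ge d'.val (plus w).length with h | h
  · rw [pos_val (by omega)]
    rfl
  · have e : d'.val = (plus w).length := by omega
    rw [e, pos_length_succ, opening_right_length hw]
    rfl

theorem opening_right_of_sameCycle (hw : IsPrefixShuffle w) {d e : HalfEdge w}
    (h : (ccw w).SameCycle d e) :
    opening (plus w) .right (d.val - 1) = opening (plus w) .right (e.val - 1) :=
  eq_of_sameCycle (g := fun d : HalfEdge w => opening (plus w) .right (d.val - 1))
    (opening_right_ccw hw) h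

theorem opening_right_head (hw : IsPrefixShuffle w) (h : Head w) :
    opening (plus w) .right (h.1.val - 1) = opening (plus w) .right (lab h) := by
  rw [lab, ← opening_right_treeOpp hw, treeOpp_treeOpp]

theorem nextHead_val (h : Head w) : (nextHead w h).1 = returnPerm (ccw w) (IsHead w) h.1 := rfl

theorem opening_right_nextHead (hw : IsPrefixShuffle w) (h : Head w) :
    opening (plus w) .right (lab (nextHead w h)) = opening (plus w) .right (lab h) := by
  rw [← opening_right_head hw, ← opening_right_head hw, nextHead_val]
  exact (opening_right_of_sameCycle hw (returnPerm_sameCycle _ _ _)).symm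

open Classical in
/-- The label that opens a white face of `M★_w`: this is `0` for the root-face, around which the
dangling heads are. -/
noncomputable def whiteOwner (w : List Letter) (k : ℕ) : ℕ :=
  if IsOpened (plus w) .left (plus w).length k then 0 else k

theorem whiteOwner_of_isOpened {k : ℕ} (h : IsOpened (plus w) .left (plus w).length k) :
    whiteOwner w k = 0 := if_pos h

theorem whiteOwner_of_not {k : ℕ} (h : ¬ IsOpened (plus w) .left (plus w).length k) :
    whiteOwner w k = k := if_neg h

/-- The face that has a half-edge on its border, as a color and the label that opens the face. -/
noncomputable def owner : StarHalfEdge w → Side × ℕ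
  | Sum.inl d => (.left, whiteOwner w (opening (plus w) .left (d.val - 1)))
  | Sum.inr (Sum.inl h) => (.left, whiteOwner w (opening (plus w) .left (lab h)))
  | Sum.inr (Sum.inr h) => (.right, opening (plus w) .right (lab h))

theorem owner_old (d : HalfEdge w) :
    owner (old d) = (.left, whiteOwner w (opening (plus w) .left (d.val - 1))) := rfl

theorem owner_near (h : Head w) :
    owner (near h) = (.left, whiteOwner w (opening (plus w) .left (lab h))) := rfl

theorem owner_far (h : Head w) : owner (far h) = (.right, opening (plus w) .right (lab h)) := rfl

theorem owner_old_succ (hw : IsPrefixShuffle w) {n : ℕ} (hn : n ≤ (plus w).length) :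
    owner (old (pos w (n + 1))) = (.left, whiteOwner w (opening (plus w) .left n)) := by
  have hu := isPrefixShuffle_plus hw
  rcases Nat.lt_or_ge n (plus w).length with h | h
  · rw [owner_old, pos_val (by omega)]
    rfl
  · obtain rfl : n = (plus w).length := by omega
    rw [pos_length_succ, owner_old, whiteOwner_of_isOpened (isOpened_opening hu _ _),
      whiteOwner_of_isOpened]
    exact isOpened_zero hu _ _

theorem owner_starFace (hw : IsPrefixShuffle w) (x : StarHalfEdge w) :
    owner (starFace w x) = owner x := by
  have hu := isPrefixShuffle_plus hw
  rcases x with d | h | h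
  · change owner (starFace w (old d)) = owner (old d)
    rcases exists_pos d with rfl | ⟨n, x, rfl, hx⟩
    · rw [starFace_root hw, owner_near, lab_hd]
      rfl
    · have hn := (List.getElem?_eq_some_iff.1 hx).1
      rw [owner_old_succ hw (by omega)]
      cases x
      · have hl : IsLabel (plus w) (n + 1) := Or.inr ⟨n, rfl, .right, hx⟩
        rw [starFace_a hw hx hl, owner_near, lab_hd, opening_touch (s := .left) hu hx]
      · rw [starFace_abar hw hx, owner_old_succ hw (by omega), opening_other (s := .left) hx]
      · have hl : IsLabel (plus w) (n + 1) := Or.inr ⟨n, rfl, .left, hx⟩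
        by_cases ho : IsOpened (plus w) .left (plus w).length (n + 1)
        · have hD : IsDangling w (pos w (n + 1)) := (isDangling_pos hw hn).2 ⟨by omega, ho⟩
          rw [starFace_dangling hD (hD.hd_eq hw hl), owner_near, lab_hd, opening_open (s := .left) hx,
            whiteOwner_of_isOpened ho, whiteOwner_of_isOpened (ho.below hu)]
        · obtain ⟨j, -, hj⟩ := not_not.1 (mt (isOpened_iff (s := .left) hu hx hn).2 ho)
          rw [starFace_b hj, owner_old_succ hw (IsPaired.lt_length hj),
            (IsPaired.opening_eq (s := .left) hu hj).2]
      · obtain ⟨i, hi⟩ := exists_paired_bbar hw hx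
        have hl : IsLabel (plus w) (i + 1) := Or.inr ⟨i, rfl, .left, hi.2.1⟩
        rw [starFace_bbar hw hi hl, owner_near, lab_hd, opening_open (s := .left) hi.2.1,
          (IsPaired.opening_eq (s := .left) hu hi).1]
  · change owner (starFace w (near h)) = owner (near h)
    obtain ⟨e, he, rfl⟩ := exists_hd hw h
    rw [starFace_near_hd, owner_old_succ hw he.le, owner_near, lab_hd]
  · change owner (starFace w (far h)) = owner (far h)
    rw [starFace_far, owner_far, owner_far, ← opening_right_nextHead hw, Equiv.apply_symm_apply]

theorem faceOf_eq_iff {x y : StarHalfEdge w} : faceOf x = faceOf y ↔ (starFace w).SameCycle x y :=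
  Quotient.eq

theorem owner_eq_of_faceOf (hw : IsPrefixShuffle w) {x y : StarHalfEdge w}
    (h : faceOf x = faceOf y) : owner x = owner y :=
  eq_of_sameCycle (owner_starFace hw) (faceOf_eq_iff.1 h)

theorem faceOf_starFace (x : StarHalfEdge w) : faceOf (starFace w x) = faceOf x :=
  faceOf_eq_iff.2 (Perm.SameCycle.symm ⟨1, by simp⟩)

theorem owner_root (hw : IsPrefixShuffle w) : owner (old (root w)) = (.left, 0) := by
  rw [owner_old]
  exact congrArg (Prod.mk _) (whiteOwner_of_isOpened (isOpened_zero (isPrefixShuffle_plus hw) _ _))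

theorem owner_of_rootFace (hw : IsPrefixShuffle w) {x : StarHalfEdge w} (h : faceOf x = rootFace w) :
    owner x = (.left, 0) :=
  (owner_eq_of_faceOf hw h).trans (owner_root hw)

theorem faceOf_far_ne (hw : IsPrefixShuffle w) (h : Head w) : faceOf (far h) ≠ rootFace w := by
  intro e
  have := owner_of_rootFace hw e
  rw [owner_far] at this
  cases this

/-! ### Moving along the borders of the white faces -/

/-- The half-edges of `M_w` that are neither the root nor a dangling head. -/
def Silent (x : StarHalfEdge w) : Prop := ∃ d, x = old d ∧ d ≠ root w ∧ ¬ IsDangling w d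

theorem silent_pos {n : ℕ} {x : Letter} (hx : (plus w)[n]? = some x) (hb : x ≠ .b) :
    Silent (old (pos w (n + 1))) :=
  ⟨_, rfl, pos_succ_ne_root (List.getElem?_eq_some_iff.1 hx).1,
    fun h => hb ((hasLetter_pos hx).1 h.1).symm⟩

theorem silent_pos_of_paired {i j : ℕ} (h : IsPaired .b .bbar (plus w) i j) :
    Silent (old (pos w (i + 1))) :=
  ⟨_, rfl, pos_succ_ne_root (List.getElem?_eq_some_iff.1 h.2.1).1,
    fun hd => hd.2 ⟨_, linked_pos h⟩⟩

/-- From the last edge at the current white vertex one comes to the current position. -/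
theorem via_white (hw : IsPrefixShuffle w) {n : ℕ} (hn : n ≤ (plus w).length)
    (he : IsLabel (plus w) (latest (plus w) .left n)) :
    Via (starFace w) Silent (near (hd hw he)) (old (pos w (n + 1))) := by
  refine latest_induction (isPrefixShuffle_plus hw) .left
    (fun e n => ∀ he : IsLabel (plus w) e, Via (starFace w) Silent (near (hd hw he)) (old (pos w n)))
    ?_ ?_ ?_ hn he
  · exact fun e _ he => Via.one' (starFace_near_hd hw he)
  · exact fun e n _ h hv he => (hv he).next' (silent_pos h (by simp [Side.other, Side.cls]))
      (starFace_abar hw h)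
  · exact fun e i j _ h hv he => (hv he).next' (silent_pos_of_paired h) (starFace_b h)

/-- From the last edge at the current black vertex one comes to the current position. -/
theorem via_black (hw : IsPrefixShuffle w) {n : ℕ} (hn : n ≤ (plus w).length)
    (he : IsLabel (plus w) (latest (plus w) .right n)) :
    Via (ccw w) (fun d => ¬ IsHead w d) (hd hw he).1 (pos w (n + 1)) := by
  refine latest_induction (isPrefixShuffle_plus hw) .right
    (fun e n => ∀ he : IsLabel (plus w) e,
      Via (ccw w) (fun d => ¬ IsHead w d) (hd hw he).1 (pos w n)) ?_ ?_ ?_ hn he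
  · exact fun e _ he => Via.one' (ccw_hd hw he)
  · refine fun e n _ h hv he => (hv he).next' ?_ (ccw_pos h ?_ ?_)
    · rw [isHead_pos h]
      simp [Side.other, Side.cls]
    all_goals simp [Side.other, Side.cls]
  · refine fun e i j _ h hv he => (hv he).next' ?_ (ccw_pos_of_paired h)
    rw [isHead_pos h.2.1]
    simp [Side.opn]

theorem via_near (hw : IsPrefixShuffle w) {n : ℕ} (h : (plus w)[n]? = some .a)
    (he : IsLabel (plus w) (latest (plus w) .left n)) (he' : IsLabel (plus w) (n + 1)) :
    Via (starFace w) Silent (near (hd hw he)) (near (hd hw he')) :=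
  (via_white hw (List.getElem?_eq_some_iff.1 h).1.le he).next' (silent_pos h (by simp))
    (starFace_a hw h he')

theorem nextHead_hd (hw : IsPrefixShuffle w) {n : ℕ} (h : (plus w)[n]? = some .b)
    (he : IsLabel (plus w) (latest (plus w) .right n)) (he' : IsLabel (plus w) (n + 1)) :
    nextHead w (hd hw he) = hd hw he' := by
  have hv := via_black hw (List.getElem?_eq_some_iff.1 h).1.le he
  rw [← hd_val_b hw h he'] at hv
  refine Subtype.ext (hv.returnPerm_eq ?_ ?_)
  · exact fun z hz e => hz (e ▸ (hd hw he).2)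
  · exact propext (iff_of_true (hd hw he').2 (hd hw he).2)

theorem starFace_far_hd (hw : IsPrefixShuffle w) {n : ℕ} (h : (plus w)[n]? = some .b)
    (he : IsLabel (plus w) (latest (plus w) .right n)) (he' : IsLabel (plus w) (n + 1)) :
    starFace w (far (hd hw he')) = far (hd hw he) := by
  rw [starFace_far, ← nextHead_hd hw h he he', Equiv.symm_apply_apply]

/-- A step around a face that does not meet the root and does not leave a dangling head. -/
def Step (x y : StarHalfEdge w) : Prop :=
  starFace w x = y ∧ y ≠ old (root w) ∧ ∀ d, x = old d → ¬ IsDangling w d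

theorem Via.transGen {x y : StarHalfEdge w} (h : Via (starFace w) Silent x y)
    (hx : ∀ d, x = old d → ¬ IsDangling w d) (hy : y ≠ old (root w)) :
    Relation.TransGen Step x y := by
  induction h with
  | one => exact .single ⟨rfl, hy, hx⟩
  | @next y _ hS ih =>
    obtain ⟨d, rfl, h1, h2⟩ := hS
    refine (ih (fun e => h1 (Sum.inl_injective e))).tail ⟨rfl, hy, ?_⟩
    intro d' e
    rwa [← Sum.inl_injective e]

theorem near_ne_old (h : Head w) (d : HalfEdge w) : near h ≠ old d := by simp [near, old]

theorem reflTransGen_near (hw : IsPrefixShuffle w) {e : ℕ} (he : IsLabel (plus w) e)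
    (hk : IsLabel (plus w) (opening (plus w) .left e)) :
    Relation.ReflTransGen Step (near (hd hw hk)) (near (hd hw he)) := by
  have hu := isPrefixShuffle_plus hw
  refine label_induction hu .left (fun e => ∀ (he : IsLabel (plus w) e)
    (hk : IsLabel (plus w) (opening (plus w) .left e)),
    Relation.ReflTransGen Step (near (hd hw hk)) (near (hd hw he))) ?_ ?_ he he hk
  · intro e _ h he hk
    rw [hd_congr hw (he := hk) (he' := he) h]
  · intro n hn ih he hk
    have hl := isLabel_latest hu .left n
    have hk' := isLabel_opening hu .left (latest (plus w) .left n)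
    rw [hd_congr hw (he := hk) (he' := hk')
      (by rw [opening_latest hu, opening_touch (s := .left) hu hn])]
    refine (ih hl hk').trans (Via.transGen (via_near hw hn hl he) ?_ (near_ne_old _ _)).to_reflTransGen
    intro d h
    exact absurd h (near_ne_old _ _)

theorem transGen_old (hw : IsPrefixShuffle w) {n : ℕ} (hn : n < (plus w).length)
    (hk : IsLabel (plus w) (opening (plus w) .left n)) :
    Relation.TransGen Step (near (hd hw hk)) (old (pos w (n + 1))) := by
  have hu := isPrefixShuffle_plus hw
  have hl := isLabel_latest hu .left n
  have h1 := reflTransGen_near hw hl (isLabel_opening hu _ _)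
  rw [hd_congr hw (he' := hk) (opening_latest hu .left n)] at h1
  refine Relation.TransGen.trans_right h1 (Via.transGen (via_white hw hn.le hl) ?_ ?_)
  · intro d h
    exact absurd h (near_ne_old _ _)
  · exact fun e => pos_succ_ne_root hn (Sum.inl_injective e)

theorem Step.faceOf_eq {x y : StarHalfEdge w} (h : Step x y) : faceOf y = faceOf x := by
  rw [← h.1, faceOf_starFace]

theorem faceOf_eq_of_reflTransGen {x y : StarHalfEdge w} (h : Relation.ReflTransGen Step x y) :
    faceOf y = faceOf x := by
  induction h with
  | refl => rfl
  | tail _ h ih => rw [h.faceOf_eq, ih]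

/-! ### The root-face -/

theorem starFace_pow_rank {x : StarHalfEdge w} (h : faceOf x = rootFace w) :
    (starFace w ^ rank x) (old (root w)) = x := by
  obtain ⟨n, -, hn⟩ := (faceOf_eq_iff.1 h).symm.exists_pow_eq'
  exact Nat.sInf_mem (s := {n | ((starFace w) ^ n) (old (root w)) = x}) ⟨n, hn⟩

theorem rank_le {x : StarHalfEdge w} {n : ℕ} (h : (starFace w ^ n) (old (root w)) = x) :
    rank x ≤ n := Nat.sInf_le h

theorem rank_root : rank (old (root w)) = 0 := Nat.le_zero.1 (rank_le rfl)

theorem rank_starFace {x : StarHalfEdge w} (h : faceOf x = rootFace w)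
    (hne : starFace w x ≠ old (root w)) : rank (starFace w x) = rank x + 1 := by
  apply le_antisymm
  · apply rank_le
    rw [pow_succ', Perm.mul_apply, starFace_pow_rank h]
  · have h1 := starFace_pow_rank (x := starFace w x) (by rw [faceOf_starFace, h])
    rcases hr : rank (starFace w x) with _ | m
    · rw [hr] at h1
      exact absurd h1.symm hne
    · rw [hr, pow_succ', Perm.mul_apply] at h1
      have := rank_le ((starFace w).injective h1)
      omega

theorem rank_inj {x y : StarHalfEdge w} (hx : faceOf x = rootFace w) (hy : faceOf y = rootFace w)
    (h : rank x = rank y) : x = y := by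
  rw [← starFace_pow_rank hx, h, starFace_pow_rank hy]

theorem Step.rank_eq {x y : StarHalfEdge w} (h : Step x y) (hx : faceOf x = rootFace w) :
    rank y = rank x + 1 := by
  obtain ⟨rfl, h1, -⟩ := h
  exact rank_starFace hx h1

theorem rank_le_of_reflTransGen {x y : StarHalfEdge w} (h : Relation.ReflTransGen Step x y)
    (hx : faceOf x = rootFace w) : rank x ≤ rank y := by
  induction h with
  | refl => rfl
  | tail h1 h ih =>
    rw [h.rank_eq ((faceOf_eq_of_reflTransGen h1).trans hx)]
    omega

theorem rank_lt_of_transGen {x y : StarHalfEdge w} (h : Relation.TransGen Step x y)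
    (hx : faceOf x = rootFace w) : rank x < rank y := by
  obtain ⟨z, h1, h2⟩ := Relation.TransGen.head'_iff.1 h
  have h3 := rank_le_of_reflTransGen h2 (h1.faceOf_eq.trans hx)
  rw [h1.rank_eq hx] at h3
  omega

theorem starFace_old_of_isOpened (hw : IsPrefixShuffle w) {k : ℕ} (hk : IsLabel (plus w) k)
    (h : IsOpened (plus w) .left (plus w).length k) :
    starFace w (old (pos w k)) = near (hd hw hk) := by
  by_cases h0 : k = 0
  · subst h0
    rw [pos_zero, starFace_root hw]
  · have hD := (isDangling_pos hw hk.le).2 ⟨h0, h⟩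
    exact starFace_dangling hD (hD.hd_eq hw hk)

theorem faceOf_near_of_isOpened (hw : IsPrefixShuffle w) {k : ℕ} (hk : IsLabel (plus w) k)
    (h : IsOpened (plus w) .left (plus w).length k) :
    faceOf (near (hd hw hk)) = faceOf (old (pos w k)) := by
  rw [← starFace_old_of_isOpened hw hk h, faceOf_starFace]

/-- The dangling heads are around the root-face. -/
theorem faceOf_old_of_isOpened (hw : IsPrefixShuffle w) {k : ℕ} (hk : IsLabel (plus w) k)
    (h : IsOpened (plus w) .left (plus w).length k) : faceOf (old (pos w k)) = rootFace w := by
  have hu := isPrefixShuffle_plus hw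
  induction k using Nat.strong_induction_on with
  | _ k ih =>
    rcases k with _ | i
    · rfl
    · have hl := isLabel_opening hu .left i
      have ho := h.below hu
      rw [faceOf_eq_of_reflTransGen (transGen_old hw hk.le hl).to_reflTransGen,
        faceOf_near_of_isOpened hw hl ho]
      exact ih _ (by have := opening_lt hu .left i; omega) hl ho

theorem rank_near_of_isOpened (hw : IsPrefixShuffle w) {k : ℕ} (hk : IsLabel (plus w) k)
    (h : IsOpened (plus w) .left (plus w).length k) :
    rank (near (hd hw hk)) = rank (old (pos w k)) + 1 := by
  rw [← starFace_old_of_isOpened hw hk h]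
  apply rank_starFace (faceOf_old_of_isOpened hw hk h)
  rw [starFace_old_of_isOpened hw hk h]
  exact near_ne_old _ _

theorem rank_lt_rank (hw : IsPrefixShuffle w) {k k' : ℕ} (hk : IsLabel (plus w) k)
    (hk' : IsLabel (plus w) k') (h : IsOpened (plus w) .left (plus w).length k)
    (h' : IsOpened (plus w) .left (plus w).length k') (hlt : k < k') :
    rank (old (pos w k)) < rank (old (pos w k')) := by
  have hu := isPrefixShuffle_plus hw
  induction k' using Nat.strong_induction_on with
  | _ k' ih =>
    rcases k' with _ | i
    · omega
    · have hl := isLabel_opening hu .left i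
      have ho := h'.below hu
      have h1 := rank_lt_of_transGen (transGen_old hw hk'.le hl)
        ((faceOf_near_of_isOpened hw hl ho).trans (faceOf_old_of_isOpened hw hl ho))
      rw [rank_near_of_isOpened hw hl ho] at h1
      have h2 := (h.mono hu (n := i) (by omega) (by have := hk'.le; omega)).le_opening hu
      rcases h2.eq_or_lt with rfl | h2
      · omega
      · have := ih _ (by have := opening_lt hu .left i; omega) hl ho h2
        omega

end PrefixMap

/-! ### The vertices of `P_w` -/

namespace PrefixMap

variable {w : List Letter}

theorem pvert_of_ne {x : StarHalfEdge w} (h : faceOf x ≠ rootFace w) :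
    pvert x = Sum.inl (faceOf x) := if_neg h

theorem old_injective : Function.Injective (old (w := w)) := Sum.inl_injective

theorem IsLastDanglingBefore.unique {x : StarHalfEdge w} {h h' : Dangling w}
    (H : IsLastDanglingBefore h x) (H' : IsLastDanglingBefore h' x) : h = h' := by
  refine Subtype.ext (old_injective (rank_inj H.1.1 H'.1.1 (le_antisymm ?_ ?_)))
  · exact H'.2 h H.1.1 H.1.2
  · exact H.2 h' H'.1.1 H'.1.2

theorem pvert_of_last {x : StarHalfEdge w} {h : Dangling w} (hx : faceOf x = rootFace w)
    (H : IsLastDanglingBefore h x) : pvert x = Sum.inr h := by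
  have hex : ∃ h : Dangling w, IsLastDanglingBefore h x := ⟨h, H⟩
  unfold pvert
  rw [if_pos hx, dif_pos hex, hex.choose_spec.unique H]

theorem pvert_of_not {x : StarHalfEdge w} (hx : faceOf x = rootFace w)
    (H : ¬ ∃ h : Dangling w, IsLastDanglingBefore h x) : pvert x = exterior w := by
  unfold pvert
  rw [if_pos hx, dif_neg H]

theorem pvert_root : pvert (old (root w)) = exterior w := by
  refine pvert_of_not rfl ?_
  rintro ⟨h, ⟨-, h1⟩, -⟩
  rw [rank_root] at h1
  omega

theorem Step.pvert_eq {x y : StarHalfEdge w} (h : Step x y) : pvert y = pvert x := by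
  by_cases hx : faceOf x = rootFace w
  · have hy : faceOf y = rootFace w := h.faceOf_eq.trans hx
    have hr := h.rank_eq hx
    have key : ∀ h' : Dangling w, faceOf (old h'.1) = rootFace w →
        (rank (old h'.1) < rank y ↔ rank (old h'.1) < rank x) := by
      intro h' hf
      rw [hr]
      constructor
      · intro hlt
        rcases Nat.lt_succ_iff_lt_or_eq.1 hlt with h1 | h1
        · exact h1
        · exact absurd h'.2 (h.2.2 _ (rank_inj hf hx h1).symm)
      · omega
    have key' : ∀ h' : Dangling w, IsLastDanglingBefore h' y ↔ IsLastDanglingBefore h' x := by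
      intro h'
      unfold IsLastDanglingBefore
      constructor
      · rintro ⟨⟨h1, h2⟩, h3⟩
        exact ⟨⟨h1, (key _ h1).1 h2⟩, fun h'' h4 h5 => h3 h'' h4 ((key _ h4).2 h5)⟩
      · rintro ⟨⟨h1, h2⟩, h3⟩
        exact ⟨⟨h1, (key _ h1).2 h2⟩, fun h'' h4 h5 => h3 h'' h4 ((key _ h4).1 h5)⟩
    by_cases hex : ∃ h : Dangling w, IsLastDanglingBefore h x
    · obtain ⟨h', H⟩ := hex
      rw [pvert_of_last hx H, pvert_of_last hy ((key' h').2 H)]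
    · rw [pvert_of_not hx hex, pvert_of_not hy (by simpa [key'] using hex)]
  · rw [pvert_of_ne hx, pvert_of_ne (by rwa [h.faceOf_eq]), h.faceOf_eq]

theorem pvert_eq_of_reflTransGen {x y : StarHalfEdge w} (h : Relation.ReflTransGen Step x y) :
    pvert y = pvert x := by
  induction h with
  | refl => rfl
  | tail _ h ih => rw [h.pvert_eq, ih]

theorem step_root (hw : IsPrefixShuffle w) :
    Step (old (root w)) (near (hd hw (isLabel_zero _))) := by
  refine ⟨starFace_root hw, near_ne_old _ _, fun d e hd => ?_⟩
  rw [← old_injective e] at hd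
  exact ((isDangling_pos hw (k := 0) (by omega)).1 hd).1 rfl

theorem pvert_near_zero (hw : IsPrefixShuffle w) :
    pvert (near (hd hw (isLabel_zero _))) = exterior w := by
  rw [(step_root hw).pvert_eq, pvert_root]

theorem pvert_near_dangling (hw : IsPrefixShuffle w) {k : ℕ} (hk : IsLabel (plus w) k)
    (hd' : IsDangling w (pos w k)) : pvert (near (hd hw hk)) = Sum.inr ⟨pos w k, hd'⟩ := by
  have ho := ((isDangling_pos hw hk.le).1 hd').2
  have hf := faceOf_old_of_isOpened hw hk ho
  refine pvert_of_last ((faceOf_near_of_isOpened hw hk ho).trans hf) ⟨⟨hf, ?_⟩, ?_⟩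
  · rw [rank_near_of_isOpened hw hk ho]
    exact Nat.lt_succ_self _
  · intro h' _ h2
    rw [rank_near_of_isOpened hw hk ho] at h2
    exact Nat.le_of_lt_succ h2

theorem pvert_near_of_not_isOpened (hw : IsPrefixShuffle w) {k : ℕ} (hk : IsLabel (plus w) k)
    (hkk : opening (plus w) .left k = k) (h : ¬ IsOpened (plus w) .left (plus w).length k) :
    faceOf (near (hd hw hk)) ≠ rootFace w := by
  intro e
  have := owner_of_rootFace hw e
  rw [owner_near, lab_hd, hkk, whiteOwner_of_not h] at this
  have h0 : k = 0 := (Prod.mk.inj this).2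
  subst h0
  exact h (isOpened_zero (isPrefixShuffle_plus hw) _ _)

theorem pvert_far (hw : IsPrefixShuffle w) (h : Head w) :
    pvert (far h) = Sum.inl (faceOf (far h)) := pvert_of_ne (faceOf_far_ne hw h)

theorem pvert_near_opening (hw : IsPrefixShuffle w) {e : ℕ} (he : IsLabel (plus w) e)
    (hk : IsLabel (plus w) (opening (plus w) .left e)) :
    pvert (near (hd hw he)) = pvert (near (hd hw hk)) :=
  pvert_eq_of_reflTransGen (reflTransGen_near hw he hk)

theorem faceOf_far_opening (hw : IsPrefixShuffle w) {e : ℕ} (he : IsLabel (plus w) e)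
    (hk : IsLabel (plus w) (opening (plus w) .right e)) :
    faceOf (far (hd hw he)) = faceOf (far (hd hw hk)) := by
  have hu := isPrefixShuffle_plus hw
  refine label_induction hu .right (fun e => ∀ (he : IsLabel (plus w) e)
    (hk : IsLabel (plus w) (opening (plus w) .right e)),
    faceOf (far (hd hw he)) = faceOf (far (hd hw hk))) ?_ ?_ he he hk
  · intro e _ h he hk
    rw [hd_congr hw (he := hk) (he' := he) h]
  · intro n hn ih he hk
    have hl := isLabel_latest hu .right n
    have hk' := isLabel_opening hu .right (latest (plus w) .right n)
    rw [hd_congr hw (he := hk) (he' := hk')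
      (by rw [opening_latest hu, opening_touch (s := .right) hu hn]), ← ih hl hk',
      ← faceOf_starFace, starFace_far_hd hw hn hl he]

theorem pvert_far_opening (hw : IsPrefixShuffle w) {e : ℕ} (he : IsLabel (plus w) e)
    (hk : IsLabel (plus w) (opening (plus w) .right e)) :
    pvert (far (hd hw he)) = pvert (far (hd hw hk)) := by
  rw [pvert_far hw, pvert_far hw, faceOf_far_opening hw he hk]

/-- The color of a vertex of `P_w` and the label that opens it. -/
noncomputable def vertexCode (hw : IsPrefixShuffle w) : PVertex w → Side × ℕ
  | Sum.inl f => Quotient.lift owner (fun _ _ h => eq_of_sameCycle (owner_starFace hw) h) f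
  | Sum.inr h => (.left, h.1.val)

/-- The color of the vertex of a half-edge of `P_w` and the label that opens it. -/
noncomputable def code : StarHalfEdge w → Side × ℕ
  | Sum.inl _ => (.left, 0)
  | Sum.inr (Sum.inl h) => (.left, opening (plus w) .left (lab h))
  | Sum.inr (Sum.inr h) => (.right, opening (plus w) .right (lab h))

theorem code_near (h : Head w) : code (near h) = (.left, opening (plus w) .left (lab h)) := rfl

theorem code_far (h : Head w) : code (far h) = (.right, opening (plus w) .right (lab h)) := rfl

theorem vertexCode_face (hw : IsPrefixShuffle w) (x : StarHalfEdge w) :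
    vertexCode hw (Sum.inl (faceOf x)) = owner x := rfl

theorem vertexCode_pvert_father (hw : IsPrefixShuffle w) {k : ℕ} (hk : IsLabel (plus w) k)
    (hkk : opening (plus w) .left k = k) : vertexCode hw (pvert (near (hd hw hk))) = (.left, k) := by
  by_cases ho : IsOpened (plus w) .left (plus w).length k
  · by_cases h0 : k = 0
    · subst h0
      rw [pvert_near_zero hw]
      exact owner_root hw
    · have hD := (isDangling_pos hw hk.le).2 ⟨h0, ho⟩
      rw [pvert_near_dangling hw hk hD]
      exact congrArg (Prod.mk _) (pos_val hk.le)
  · rw [pvert_of_ne (pvert_near_of_not_isOpened hw hk hkk ho), vertexCode_face, owner_near, lab_hd,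
      hkk, whiteOwner_of_not ho]

theorem vertexCode_pvert (hw : IsPrefixShuffle w) {x : StarHalfEdge w} (hx : IsPHalfEdge x) :
    vertexCode hw (pvert x) = code x := by
  have hu := isPrefixShuffle_plus hw
  rcases hx with rfl | ⟨h, rfl⟩ | ⟨h, rfl⟩
  · rw [pvert_root]
    exact owner_root hw
  · obtain ⟨e, he, rfl⟩ := exists_hd hw h
    have hk := isLabel_opening hu .left e
    rw [pvert_near_opening hw he hk, vertexCode_pvert_father hw hk (opening_opening hu _ _),
      code_near, lab_hd]
  · rw [pvert_far hw, vertexCode_face]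
    rfl

theorem pvert_eq_iff (hw : IsPrefixShuffle w) {x y : StarHalfEdge w} (hx : IsPHalfEdge x)
    (hy : IsPHalfEdge y) : pvert x = pvert y ↔ code x = code y := by
  have hu := isPrefixShuffle_plus hw
  refine ⟨fun h => by rw [← vertexCode_pvert hw hx, ← vertexCode_pvert hw hy, h], fun h => ?_⟩
  have key : ∀ {x : StarHalfEdge w}, IsPHalfEdge x → ∃ k, ∃ hk : IsLabel (plus w) k,
      (code x = (.left, k) ∧ pvert x = pvert (near (hd hw hk))) ∨
      (code x = (.right, k) ∧ pvert x = pvert (far (hd hw hk))) := by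
    rintro x (rfl | ⟨h, rfl⟩ | ⟨h, rfl⟩)
    · exact ⟨0, isLabel_zero _, Or.inl ⟨rfl, by rw [pvert_root, pvert_near_zero hw]⟩⟩
    · obtain ⟨e, he, rfl⟩ := exists_hd hw h
      refine ⟨_, isLabel_opening hu .left e, Or.inl ⟨?_, pvert_near_opening hw he _⟩⟩
      rw [code_near, lab_hd]
    · obtain ⟨e, he, rfl⟩ := exists_hd hw h
      refine ⟨_, isLabel_opening hu .right e, Or.inr ⟨?_, pvert_far_opening hw he _⟩⟩
      rw [code_far, lab_hd]
  obtain ⟨k, hk, ⟨h1, h2⟩ | ⟨h1, h2⟩⟩ := key hx <;> obtain ⟨k', hk', ⟨h3, h4⟩ | ⟨h3, h4⟩⟩ := key hy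
  · rw [h1, h3] at h
    obtain rfl := (Prod.mk.inj h).2
    rw [h2, h4]
  · rw [h1, h3] at h
    cases (Prod.mk.inj h).1
  · rw [h1, h3] at h
    cases (Prod.mk.inj h).1
  · rw [h1, h3] at h
    obtain rfl := (Prod.mk.inj h).2
    rw [h2, h4]

theorem isPHalfEdge_near (h : Head w) : IsPHalfEdge (near h) := Or.inr (Or.inl ⟨h, rfl⟩)

theorem isPHalfEdge_far (h : Head w) : IsPHalfEdge (far h) := Or.inr (Or.inr ⟨h, rfl⟩)

theorem exists_pvert (hw : IsPrefixShuffle w) (v : PVertex w) :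
    ∃ x : StarHalfEdge w, IsPHalfEdge x ∧ pvert x = v := by
  have hu := isPrefixShuffle_plus hw
  have face : ∀ x : StarHalfEdge w, IsPHalfEdge x →
      ∃ y : StarHalfEdge w, IsPHalfEdge y ∧ pvert y = Sum.inl (faceOf x) := by
    intro x hx
    by_cases h : faceOf x = rootFace w
    · exact ⟨old (root w), Or.inl rfl, by rw [pvert_root, h]; rfl⟩
    · exact ⟨x, hx, pvert_of_ne h⟩
  rcases v with f | ⟨d, hd'⟩
  · obtain ⟨x, rfl⟩ := Quotient.exists_rep f
    change ∃ y : StarHalfEdge w, IsPHalfEdge y ∧ pvert y = Sum.inl (faceOf x)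
    rcases x with d | h | h
    · rcases exists_pos d with rfl | ⟨n, x, rfl, hx⟩
      · exact face _ (Or.inl rfl)
      · have hn := (List.getElem?_eq_some_iff.1 hx).1
        have hk := isLabel_opening hu .left n
        have := faceOf_eq_of_reflTransGen (transGen_old hw hn hk).to_reflTransGen
        change ∃ y : StarHalfEdge w, IsPHalfEdge y ∧ pvert y = Sum.inl (faceOf (old (pos w (n + 1))))
        rw [this]
        exact face _ (isPHalfEdge_near _)
    · exact face _ (isPHalfEdge_near h)
    · exact face _ (isPHalfEdge_far h)
  · have hk : IsLabel (plus w) d.val := by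
      obtain ⟨i, h1, h2⟩ := hd'.1
      exact Or.inr ⟨i, h1, .left, h2⟩
    have hD : IsDangling w (pos w d.val) := by rwa [pos_val_self]
    refine ⟨_, isPHalfEdge_near _, (pvert_near_dangling hw hk hD).trans ?_⟩
    exact congrArg Sum.inr (Subtype.ext (pos_val_self d))

theorem pvert_surjective (hw : IsPrefixShuffle w) : Function.Surjective (partitionTree w).vert := by
  intro v
  obtain ⟨x, hx, h⟩ := exists_pvert hw v
  exact ⟨⟨x, hx⟩, h⟩

/-! ### The rotations of `P_w` -/

theorem plabel_eq_iff {x y : StarHalfEdge w} (hx : IsPHalfEdge x) (hy : IsPHalfEdge y) :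
    plabel x = plabel y ↔ pvert x = pvert y := by
  simp [plabel, hx, hy]

theorem eq_rootFace_of_pvert {x : StarHalfEdge w} (hx : faceOf x = rootFace w) {f : Face w}
    (h : pvert x = Sum.inl f) : f = rootFace w := by
  by_cases hex : ∃ h : Dangling w, IsLastDanglingBefore h x
  · obtain ⟨h', H⟩ := hex
    rw [pvert_of_last hx H] at h
    cases h
  · rw [pvert_of_not hx hex] at h
    exact (Sum.inl_injective h).symm

theorem faceOf_eq_of_pvert {x y : StarHalfEdge w} (h : pvert x = pvert y) :
    faceOf x = faceOf y := by
  by_cases hx : faceOf x = rootFace w <;> by_cases hy : faceOf y = rootFace w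
  · rw [hx, hy]
  · exact absurd (eq_rootFace_of_pvert hx (h.trans (pvert_of_ne hy))) hy
  · exact absurd (eq_rootFace_of_pvert hy (h.symm.trans (pvert_of_ne hx))) hx
  · rw [pvert_of_ne hx, pvert_of_ne hy] at h
    exact Sum.inl_injective h

theorem partitionTree_vert_cw (x : (partitionTree w).D) :
    (partitionTree w).vert ((partitionTree w).cw x) = (partitionTree w).vert x :=
  (plabel_eq_iff ((partitionTree w).cw x).2 x.2).1 (returnPerm_label (starFace w) plabel x.1)

theorem partitionTree_rotation (x y : (partitionTree w).D) :
    (partitionTree w).vert x = (partitionTree w).vert y ↔ (partitionTree w).cw.SameCycle x y := by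
  constructor
  · intro h
    exact (sameCycle_subtypePerm (p := IsPHalfEdge) isPHalfEdge_return).2 (sameCycle_returnPerm
      (faceOf_eq_iff.1 (faceOf_eq_of_pvert h)) ((plabel_eq_iff x.2 y.2).2 h))
  · exact eq_of_sameCycle partitionTree_vert_cw

theorem plabel_old {d : HalfEdge w} (h : d ≠ root w) : plabel (old d) = none := by
  refine if_neg ?_
  rintro (h' | ⟨_, h'⟩ | ⟨_, h'⟩)
  · exact h (old_injective h')
  · cases h'
  · cases h'

theorem partitionTree_cw_eq {x y : (partitionTree w).D} (h : Via (starFace w) Silent x.1 y.1)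
    (hv : pvert x.1 = pvert y.1) : (partitionTree w).cw x = y := by
  refine Subtype.ext (h.returnPerm_eq ?_ ((plabel_eq_iff y.2 x.2).2 hv.symm))
  rintro z ⟨d, rfl, h1, -⟩ e
  rw [plabel_old h1] at e
  have := (plabel_isSome x.1).2 x.2
  rw [← e] at this
  cases this

/-- The half-edges of `P_w`. -/
noncomputable def pnear (h : Head w) : (partitionTree w).D := ⟨near h, isPHalfEdge_near h⟩

noncomputable def pfar (h : Head w) : (partitionTree w).D := ⟨far h, isPHalfEdge_far h⟩

theorem partitionTree_cases (x : (partitionTree w).D) :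
    x = (partitionTree w).root ∨ (∃ h, x = pnear h) ∨ ∃ h, x = pfar h := by
  obtain ⟨x, rfl | ⟨h, rfl⟩ | ⟨h, rfl⟩⟩ := x
  · exact Or.inl rfl
  · exact Or.inr (Or.inl ⟨h, rfl⟩)
  · exact Or.inr (Or.inr ⟨h, rfl⟩)

theorem partitionTree_cw_root (hw : IsPrefixShuffle w) :
    (partitionTree w).cw (partitionTree w).root = pnear (hd hw (isLabel_zero _)) :=
  partitionTree_cw_eq (Via.one' (starFace_root hw)) ((step_root hw).pvert_eq).symm

theorem partitionTree_cw_near (hw : IsPrefixShuffle w) {n : ℕ} (h : (plus w)[n]? = some .a)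
    (he : IsLabel (plus w) (latest (plus w) .left n)) (he' : IsLabel (plus w) (n + 1)) :
    (partitionTree w).cw (pnear (hd hw he)) = pnear (hd hw he') := by
  have hu := isPrefixShuffle_plus hw
  refine partitionTree_cw_eq (via_near hw h he he') ?_
  refine (pvert_eq_iff hw (isPHalfEdge_near _) (isPHalfEdge_near _)).2 ?_
  rw [code_near, code_near, lab_hd, lab_hd, opening_latest hu, opening_touch (s := .left) hu h]

theorem partitionTree_cw_far (hw : IsPrefixShuffle w) {n : ℕ} (h : (plus w)[n]? = some .b)
    (he : IsLabel (plus w) (latest (plus w) .right n)) (he' : IsLabel (plus w) (n + 1)) :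
    (partitionTree w).cw (pfar (hd hw he')) = pfar (hd hw he) := by
  have hu := isPrefixShuffle_plus hw
  refine partitionTree_cw_eq (Via.one' (starFace_far_hd hw h he he')) ?_
  refine (pvert_eq_iff hw (isPHalfEdge_far _) (isPHalfEdge_far _)).2 ?_
  rw [code_far, code_far, lab_hd, lab_hd, opening_latest hu, opening_touch (s := .right) hu h]

theorem partitionTree_opp_root : (partitionTree w).opp (partitionTree w).root = (partitionTree w).root :=
  Subtype.ext (congrArg Sum.inl (opp_root w))

theorem partitionTree_opp_near (h : Head w) : (partitionTree w).opp (pnear h) = pfar h := rfl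

theorem partitionTree_opp_far (h : Head w) : (partitionTree w).opp (pfar h) = pnear h := rfl

end PrefixMap

/-! ### The isomorphism -/

namespace RootedMap

/-- An isomorphism is determined by its action on half-edges. -/
noncomputable def Iso.ofHalfEdges {M N : RootedMap} (f : M.D ≃ N.D)
    (hM : Function.Surjective M.vert) (hN : Function.Surjective N.vert)
    (hv : ∀ d e, M.vert d = M.vert e ↔ N.vert (f d) = N.vert (f e))
    (hcw : ∀ d, N.cw (f d) = f (M.cw d)) (hopp : ∀ d, N.opp (f d) = f (M.opp d))
    (hroot : f M.root = N.root) : Iso M N where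
  onV := Equiv.ofBijective (fun v => N.vert (f (Function.surjInv hM v))) (by
    constructor
    · intro v v' h
      have := (hv _ _).2 h
      exact (Function.surjInv_eq hM v).symm.trans (this.trans (Function.surjInv_eq hM v'))
    · intro v
      obtain ⟨d, rfl⟩ := hN v
      obtain ⟨d, rfl⟩ := f.surjective d
      exact ⟨M.vert d, (hv _ _).1 (Function.surjInv_eq hM _)⟩)
  onD := f
  vert_eq d := (hv _ _).1 (Function.surjInv_eq hM _).symm
  cw_eq := hcw
  opp_eq := hopp
  root_eq := hroot

theorem Iso.face_sameCycle {M N : RootedMap} (φ : Iso M N) {d e : M.D}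
    (h : N.face.SameCycle (φ.onD d) (φ.onD e)) : M.face.SameCycle d e := by
  have h1 : ∀ (n : ℕ) d, φ.onD ((M.face ^ n) d) = (N.face ^ n) (φ.onD d) := by
    intro n
    induction n with
    | zero => intro d; simp
    | succ n ih =>
      intro d
      rw [pow_succ', pow_succ', Perm.mul_apply, Perm.mul_apply, ← ih]
      simp only [face, Perm.mul_apply, φ.cw_eq, φ.opp_eq]
  have : Finite N.D := N.finD
  obtain ⟨n, -, hn⟩ := h.exists_pow_eq'
  rw [← h1] at hn
  exact ⟨n, by simpa using φ.onD.injective hn⟩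

theorem Iso.connected {M N : RootedMap} (φ : Iso M N)
    (h : ∀ x y, Relation.ReflTransGen (fun x y => ∃ d, N.vert d = x ∧ N.vert (N.opp d) = y) x y)
    (x y : M.V) :
    Relation.ReflTransGen (fun x y => ∃ d, M.vert d = x ∧ M.vert (M.opp d) = y) x y := by
  have key : ∀ {x y : N.V}, Relation.ReflTransGen
      (fun x y => ∃ d, N.vert d = x ∧ N.vert (N.opp d) = y) x y → Relation.ReflTransGen
      (fun x y => ∃ d, M.vert d = x ∧ M.vert (M.opp d) = y) (φ.onV.symm x) (φ.onV.symm y) := by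
    intro x y h
    induction h with
    | refl => exact .refl
    | tail _ h ih =>
      obtain ⟨d, rfl, rfl⟩ := h
      obtain ⟨d, rfl⟩ := φ.onD.surjective d
      refine ih.tail ⟨d, ?_, ?_⟩
      · rw [φ.vert_eq, Equiv.symm_apply_apply]
      · rw [φ.opp_eq, φ.vert_eq, Equiv.symm_apply_apply]
  simpa using key (h (φ.onV x) (φ.onV y))

end RootedMap

namespace PrefixMap

open BinTree

variable {w : List Letter}

theorem label_le (he : IsLabel (plus w) e) : e ≤ w.length := by
  rcases he with rfl | ⟨i, rfl, s, hs⟩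
  · omega
  · by_contra h
    rw [getElem?_plus_of_le (by omega) (List.getElem?_eq_some_iff.1 hs).1] at hs
    cases s <;> simp [Side.opn] at hs

theorem isNode_iff (hw : IsPrefixShuffle w) (p : Address) :
    (lambda₁ w).IsNode p ↔ ∃ e, IsLabel (plus w) e ∧ p = addr (plus w) e := by
  have h := (lambda₁_spec (isPrefixShuffle_plus hw) w.length).2.1 p
  rw [take_plus] at h
  rw [h]
  exact ⟨fun ⟨e, _, h⟩ => ⟨e, h⟩, fun ⟨e, h⟩ => ⟨e, label_le h.1, h⟩⟩

theorem isNode_addr (hw : IsPrefixShuffle w) {e : ℕ} (he : IsLabel (plus w) e) :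
    (lambda₁ w).IsNode (addr (plus w) e) := (isNode_iff hw _).2 ⟨e, he, rfl⟩

theorem addr_inj (hw : IsPrefixShuffle w) {e e' : ℕ} (he : IsLabel (plus w) e)
    (he' : IsLabel (plus w) e') (h : addr (plus w) e = addr (plus w) e') : e = e' :=
  (lambda₁_spec (isPrefixShuffle_plus hw) w.length).2.2 e e' (label_le he) (label_le he') he he' h

/-- The half-edge of `θ(λ₁(w))` corresponding to a half-edge of `P_w`. -/
noncomputable def toTheta (hw : IsPrefixShuffle w) (x : (partitionTree w).D) :
    (lambda₁ w).theta.D :=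
  match x.1 with
  | Sum.inl _ => (lambda₁ w).theta.root
  | Sum.inr (Sum.inl h) => thetaHalf (addr (plus w) (lab h)) (isNode_addr hw (isLabel_lab hw h)) .left
  | Sum.inr (Sum.inr h) => thetaHalf (addr (plus w) (lab h)) (isNode_addr hw (isLabel_lab hw h)) .right

theorem toTheta_root (hw : IsPrefixShuffle w) :
    toTheta hw (partitionTree w).root = (lambda₁ w).theta.root := rfl

theorem toTheta_near' (hw : IsPrefixShuffle w) (h : Head w) : toTheta hw (pnear h) =
    thetaHalf (addr (plus w) (lab h)) (isNode_addr hw (isLabel_lab hw h)) .left := rfl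

theorem toTheta_far' (hw : IsPrefixShuffle w) (h : Head w) : toTheta hw (pfar h) =
    thetaHalf (addr (plus w) (lab h)) (isNode_addr hw (isLabel_lab hw h)) .right := rfl

theorem thetaHalf_congr {B : BinTree} {p q : Address} {hp : B.IsNode p} {hq : B.IsNode q} {s : Side}
    (h : p = q) : thetaHalf p hp s = thetaHalf q hq s := by
  subst h
  rfl

theorem toTheta_near (hw : IsPrefixShuffle w) {e : ℕ} (he : IsLabel (plus w) e) :
    toTheta hw (pnear (hd hw he)) = thetaHalf (addr (plus w) e) (isNode_addr hw he) .left :=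
  thetaHalf_congr (hp := isNode_addr hw (isLabel_lab hw _)) (by rw [lab_hd])

theorem toTheta_far (hw : IsPrefixShuffle w) {e : ℕ} (he : IsLabel (plus w) e) :
    toTheta hw (pfar (hd hw he)) = thetaHalf (addr (plus w) e) (isNode_addr hw he) .right :=
  thetaHalf_congr (hp := isNode_addr hw (isLabel_lab hw _)) (by rw [lab_hd])

theorem lab_injective (hw : IsPrefixShuffle w) : Function.Injective (lab (w := w)) := by
  intro h h' e
  rw [← hd_lab hw h, ← hd_lab hw h']
  exact hd_congr hw e

theorem toTheta_injective (hw : IsPrefixShuffle w) : Function.Injective (toTheta hw) := by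
  have inj : ∀ h h' : Head w, addr (plus w) (lab h) = addr (plus w) (lab h') → h = h' :=
    fun h h' e => lab_injective hw (addr_inj hw (isLabel_lab hw h) (isLabel_lab hw h') e)
  intro x y hxy
  rcases partitionTree_cases x with rfl | ⟨h, rfl⟩ | ⟨h, rfl⟩ <;>
    rcases partitionTree_cases y with rfl | ⟨h', rfl⟩ | ⟨h', rfl⟩ <;>
    simp only [toTheta_root, toTheta_near', toTheta_far'] at hxy
  · rfl
  · exact absurd hxy.symm thetaHalf_ne_root
  · exact absurd hxy.symm thetaHalf_ne_root
  · exact absurd hxy thetaHalf_ne_root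
  · rw [inj _ _ (thetaHalf_inj hxy).1]
  · cases (thetaHalf_inj hxy).2
  · exact absurd hxy thetaHalf_ne_root
  · cases (thetaHalf_inj hxy).2
  · rw [inj _ _ (thetaHalf_inj hxy).1]

theorem toTheta_surjective (hw : IsPrefixShuffle w) : Function.Surjective (toTheta hw) := by
  intro d
  rcases theta_cases d with rfl | ⟨p, hp, s, rfl⟩
  · exact ⟨_, toTheta_root hw⟩
  · obtain ⟨e, he, rfl⟩ := (isNode_iff hw p).1 hp
    cases s
    · exact ⟨_, toTheta_near hw he⟩
    · exact ⟨_, toTheta_far hw he⟩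

noncomputable def toThetaEquiv (hw : IsPrefixShuffle w) :
    (partitionTree w).D ≃ (lambda₁ w).theta.D :=
  Equiv.ofBijective (toTheta hw) ⟨toTheta_injective hw, toTheta_surjective hw⟩

theorem toThetaEquiv_apply (hw : IsPrefixShuffle w) (x : (partitionTree w).D) :
    toThetaEquiv hw x = toTheta hw x := rfl

theorem thetaTop_toTheta (hw : IsPrefixShuffle w) (x : (partitionTree w).D) :
    thetaTop ((lambda₁ w).theta.vert (toTheta hw x)) =
      fatherAddr (plus w) (code x.1).1 (code x.1).2 := by
  have hu := isPrefixShuffle_plus hw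
  rcases partitionTree_cases x with rfl | ⟨h, rfl⟩ | ⟨h, rfl⟩
  · exact congrArg thetaTop theta_vert_root
  · rw [toTheta_near', theta_vert_thetaHalf, thetaTop_thetaVertex,
      chainTop_addr hu _ _ (isLabel_lab hw h)]
    rfl
  · rw [toTheta_far', theta_vert_thetaHalf, thetaTop_thetaVertex,
      chainTop_addr hu _ _ (isLabel_lab hw h)]
    rfl

theorem isLabel_code (hw : IsPrefixShuffle w) (x : (partitionTree w).D) :
    IsLabel (plus w) (code x.1).2 := by
  have hu := isPrefixShuffle_plus hw
  rcases partitionTree_cases x with rfl | ⟨h, rfl⟩ | ⟨h, rfl⟩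
  · exact isLabel_zero _
  · exact isLabel_opening hu _ _
  · exact isLabel_opening hu _ _

theorem theta_vert_eq_iff (hw : IsPrefixShuffle w) (x y : (partitionTree w).D) :
    (lambda₁ w).theta.vert (toTheta hw x) = (lambda₁ w).theta.vert (toTheta hw y) ↔
      code x.1 = code y.1 := by
  rw [← thetaTop_injective.eq_iff, thetaTop_toTheta, thetaTop_toTheta]
  constructor
  · intro h
    obtain ⟨h1, h2⟩ := fatherAddr_inj (isPrefixShuffle_plus hw) (isLabel_code hw x)
      (isLabel_code hw y) h
    exact Prod.ext h1 h2
  · intro h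
    rw [h]

theorem vert_eq_iff (hw : IsPrefixShuffle w) (x y : (partitionTree w).D) :
    (partitionTree w).vert x = (partitionTree w).vert y ↔ code x.1 = code y.1 :=
  pvert_eq_iff hw x.2 y.2

theorem theta_opp_toTheta (hw : IsPrefixShuffle w) (x : (partitionTree w).D) :
    (lambda₁ w).theta.opp (toTheta hw x) = toTheta hw ((partitionTree w).opp x) := by
  rcases partitionTree_cases x with rfl | ⟨h, rfl⟩ | ⟨h, rfl⟩
  · rw [toTheta_root, theta_opp_root, partitionTree_opp_root, toTheta_root]
  · rw [toTheta_near', theta_opp_thetaHalf, partitionTree_opp_near, toTheta_far']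
    rfl
  · rw [toTheta_far', theta_opp_thetaHalf, partitionTree_opp_far, toTheta_near']
    rfl

theorem theta_cw_toTheta (hw : IsPrefixShuffle w) (x : (partitionTree w).D) :
    (lambda₁ w).theta.cw (toTheta hw x) = toTheta hw ((partitionTree w).cw x) := by
  have hu := isPrefixShuffle_plus hw
  set C := (partitionTree w).cw with hC
  set T : Perm (partitionTree w).D := (toThetaEquiv hw).symm.permCongr (lambda₁ w).theta.cw with hT
  have hTx : ∀ x y, (lambda₁ w).theta.cw (toTheta hw x) = toTheta hw y → T x = y := by
    intro x y h
    rw [hT, Equiv.permCongr_apply, Equiv.symm_symm, toThetaEquiv_apply, h, Equiv.symm_apply_eq]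
    rfl
  have hTx' : ∀ x, (lambda₁ w).theta.cw (toTheta hw x) = toTheta hw (T x) := by
    intro x
    exact ((toThetaEquiv hw).apply_symm_apply _).symm
  have gC : ∀ x, code (C x).1 = code x.1 := fun x =>
    (vert_eq_iff hw _ _).1 (partitionTree_vert_cw x)
  have gT : ∀ x, code (T x).1 = code x.1 := fun x => by
    rw [← theta_vert_eq_iff hw, ← hTx', theta_vert_cw]
  have gC' : ∀ x, code (C⁻¹ x).1 = code x.1 := fun x => by
    simpa using (gC (C⁻¹ x)).symm
  have gT' : ∀ x, code (T⁻¹ x).1 = code x.1 := fun x => by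
    simpa using (gT (T⁻¹ x)).symm
  suffices h : C x = T x by rw [h, hTx']
  have white : ∀ x, (code x.1).1 = .left → C x = T x := by
    refine perm_eq_on (g := fun x : (partitionTree w).D => code x.1)
      (f := fun x => x = (partitionTree w).root ∨ ∃ n, ∃ he : IsLabel (plus w) (n + 1),
        (plus w)[n]? = some .b ∧ x = pnear (hd hw he)) gC gT
      (fun x h => by rwa [gC]) (fun x h => by rwa [gT]) ?_ ?_
    · have cn : ∀ (n : ℕ) (he : IsLabel (plus w) (n + 1)), (plus w)[n]? = some .b →
          code (pnear (hd hw he)).1 = (.left, n + 1) := by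
        intro n he hb
        change code (near (hd hw he)) = _
        rw [code_near, lab_hd, opening_open (s := .left) hb]
      rintro y z - - (rfl | ⟨n, he, hb, rfl⟩) (rfl | ⟨n', he', hb', rfl⟩) h
      · rfl
      · rw [cn n' he' hb'] at h
        cases (Prod.mk.inj h).2
      · rw [cn n he hb] at h
        cases (Prod.mk.inj h).2
      · rw [cn n he hb, cn n' he' hb'] at h
        rw [hd_congr hw (Prod.mk.inj h).2]
    · intro y hy
      rcases partitionTree_cases y with rfl | ⟨h, rfl⟩ | ⟨h, rfl⟩
      · exact Or.inl (Or.inl rfl)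
      · obtain ⟨e, he, rfl⟩ := exists_hd hw h
        rcases he.cases with rfl | ⟨n, rfl, hn⟩ | ⟨n, rfl, hn⟩
        · refine Or.inr ⟨_, partitionTree_cw_root hw, hTx _ _ ?_⟩
          rw [toTheta_root, toTheta_near, theta_cw_root (by simpa [addr_zero] using isNode_addr hw he)]
          exact thetaHalf_congr addr_zero.symm
        · have hl := isLabel_latest hu .left n
          refine Or.inr ⟨_, partitionTree_cw_near hw hn hl he, hTx _ _ ?_⟩
          have ha : addr (plus w) (n + 1) = .left :: addr (plus w) (latest (plus w) .left n) :=
            addr_touch (s := .left) hu hn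
          rw [toTheta_near, toTheta_near, theta_cw_left _ _ (ha ▸ isNode_addr hw he)]
          exact thetaHalf_congr ha.symm
        · exact Or.inl (Or.inr ⟨n, he, hn, rfl⟩)
      · cases hy
  have black : ∀ x, (code x.1).1 = .right → C⁻¹ x = T⁻¹ x := by
    refine perm_eq_on (g := fun x : (partitionTree w).D => code x.1)
      (f := fun x => ∃ e, ∃ he : IsLabel (plus w) e, opening (plus w) .right e = e ∧
        x = pfar (hd hw he)) gC' gT'
      (fun x h => by rwa [gC']) (fun x h => by rwa [gT']) ?_ ?_
    · rintro y z - - ⟨e, he, h1, rfl⟩ ⟨e', he', h1', rfl⟩ h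
      have h : code (far (hd hw he)) = code (far (hd hw he')) := h
      rw [code_far, code_far, lab_hd, lab_hd, h1, h1'] at h
      rw [hd_congr hw (Prod.mk.inj h).2]
    · intro y hy
      rcases partitionTree_cases y with rfl | ⟨h, rfl⟩ | ⟨h, rfl⟩
      · cases hy
      · cases hy
      · obtain ⟨e, he, rfl⟩ := exists_hd hw h
        rcases he.cases with rfl | ⟨n, rfl, hn⟩ | ⟨n, rfl, hn⟩
        · exact Or.inl ⟨0, he, rfl, rfl⟩
        · exact Or.inl ⟨_, he, opening_open (s := .right) hn, rfl⟩
        · have hl := isLabel_latest hu .right n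
          refine Or.inr ⟨pfar (hd hw hl), ?_, ?_⟩
          · rw [Perm.inv_eq_iff_eq, partitionTree_cw_far hw hn hl he]
          · rw [Perm.inv_eq_iff_eq]
            refine (hTx _ _ ?_).symm
            have ha : addr (plus w) (n + 1) = .right :: addr (plus w) (latest (plus w) .right n) :=
              addr_touch (s := .right) hu hn
            have hN : (lambda₁ w).IsNode (.right :: addr (plus w) (latest (plus w) .right n)) := by
              rw [← ha]
              exact isNode_addr hw he
            rw [toTheta_far, toTheta_far, ← theta_cw_right _ (isNode_addr hw hl) hN]
            exact congrArg _ (thetaHalf_congr ha)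
  rcases hc : (code x.1).1 with _ | _
  · exact white x hc
  · have h := black (C x) (by rw [gC, hc])
    have h1 : C⁻¹ (C x) = x := by simp
    rw [h1, eq_comm, Perm.inv_eq_iff_eq] at h
    exact h

/-- The isomorphism from `P_w` to `θ(λ₁(w))`. -/
noncomputable def isoTheta (hw : IsPrefixShuffle w) : (partitionTree w).Iso (lambda₁ w).theta :=
  RootedMap.Iso.ofHalfEdges (toThetaEquiv hw) (pvert_surjective hw) theta_vert_surjective
    (fun x y => (vert_eq_iff hw x y).trans (theta_vert_eq_iff hw x y).symm)
    (theta_cw_toTheta hw) (theta_opp_toTheta hw) (toTheta_root hw)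

theorem isoTheta_onV (hw : IsPrefixShuffle w) (x : (partitionTree w).D) :
    (isoTheta hw).onV (pvert x.1) = (lambda₁ w).theta.vert (toTheta hw x) :=
  ((isoTheta hw).vert_eq x).symm

/-! ### `P_w` is a tree -/

theorem opening_left_or_right (hw : IsPrefixShuffle w) {e : ℕ} (he : IsLabel (plus w) e) :
    (e ≠ 0 ∧ opening (plus w) .left e = e) ↔ ¬ opening (plus w) .right e = e := by
  have hu := isPrefixShuffle_plus hw
  rcases he.cases with rfl | ⟨n, rfl, hn⟩ | ⟨n, rfl, hn⟩
  · simp [opening, stk]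
  · have h1 : opening (plus w) .right (n + 1) = n + 1 := opening_open (s := .right) hn
    have h2 : opening (plus w) .left (n + 1) = opening (plus w) .left n :=
      opening_touch (s := .left) hu hn
    have h3 := opening_lt hu .left n
    omega
  · have h1 : opening (plus w) .left (n + 1) = n + 1 := opening_open (s := .left) hn
    have h2 : opening (plus w) .right (n + 1) = opening (plus w) .right n :=
      opening_touch (s := .right) hu hn
    have h3 := opening_lt hu .right n
    omega

open Classical in
/-- The half-edge at the son of an edge of `P_w`. -/
noncomputable def child (h : Head w) : (partitionTree w).D :=
  if opening (plus w) .right (lab h) = lab h then pfar h else pnear h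

theorem code_child (hw : IsPrefixShuffle w) (h : Head w) :
    (opening (plus w) .right (lab h) = lab h ∧ code (child h).1 = (.right, lab h)) ∨
    (lab h ≠ 0 ∧ opening (plus w) .left (lab h) = lab h ∧ code (child h).1 = (.left, lab h)) := by
  by_cases hr : opening (plus w) .right (lab h) = lab h
  · left
    refine ⟨hr, ?_⟩
    rw [child, if_pos hr]
    exact (code_far h).trans (by rw [hr])
  · right
    obtain ⟨h0, hl⟩ := (opening_left_or_right hw (isLabel_lab hw h)).2 hr
    refine ⟨h0, hl, ?_⟩
    rw [child, if_neg hr]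
    exact (code_near h).trans (by rw [hl])

theorem card_V (hw : IsPrefixShuffle w) :
    Nat.card (partitionTree w).V = Nat.card (Head w) + 1 := by
  have hu := isPrefixShuffle_plus hw
  have : Finite (Head w) := inferInstance
  rw [← Finite.card_option]
  refine (Nat.card_congr (Equiv.ofBijective (fun o : Option (Head w) =>
    (partitionTree w).vert (o.elim (partitionTree w).root child)) ⟨?_, ?_⟩)).symm
  · intro o o' h
    have h := (vert_eq_iff hw _ _).1 h
    have hroot : code (partitionTree w).root.1 = (.left, 0) := rfl
    rcases o with _ | o <;> rcases o' with _ | o' <;> simp only [Option.elim] at h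
    · rfl
    · rw [hroot] at h
      rcases code_child hw o' with ⟨-, h'⟩ | ⟨h0, -, h'⟩
      · rw [h'] at h
        cases (Prod.mk.inj h).1
      · rw [h'] at h
        exact absurd (Prod.mk.inj h).2.symm h0
    · rw [hroot] at h
      rcases code_child hw o with ⟨-, h'⟩ | ⟨h0, -, h'⟩
      · rw [h'] at h
        cases (Prod.mk.inj h).1
      · rw [h'] at h
        exact absurd (Prod.mk.inj h).2 h0
    · have h2 : lab o = lab o' := by
        rcases code_child hw o with ⟨-, h'⟩ | ⟨-, -, h'⟩ <;>
          rcases code_child hw o' with ⟨-, h''⟩ | ⟨-, -, h''⟩ <;> rw [h', h''] at h <;>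
          exact (Prod.mk.inj h).2
      rw [lab_injective hw h2]
  · intro v
    obtain ⟨x, rfl⟩ := pvert_surjective hw v
    rcases partitionTree_cases x with rfl | ⟨h, rfl⟩ | ⟨h, rfl⟩
    · exact ⟨none, rfl⟩
    · obtain ⟨e, he, rfl⟩ := exists_hd hw h
      have hk := isLabel_opening hu .left e
      have hc : code (pnear (hd hw he)).1 = (.left, opening (plus w) .left e) :=
        (code_near _).trans (by rw [lab_hd])
      by_cases h0 : opening (plus w) .left e = 0
      · refine ⟨none, (vert_eq_iff hw _ _).2 ?_⟩
        rw [hc, h0]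
        rfl
      · refine ⟨some (hd hw hk), (vert_eq_iff hw _ _).2 ?_⟩
        simp only [Option.elim]
        rw [hc]
        rcases code_child hw (hd hw hk) with ⟨h1, -⟩ | ⟨-, -, h1⟩
        · rw [lab_hd] at h1
          exact absurd h1 ((opening_left_or_right hw hk).1 ⟨h0, opening_opening hu _ _⟩)
        · rw [h1, lab_hd]
    · obtain ⟨e, he, rfl⟩ := exists_hd hw h
      have hk := isLabel_opening hu .right e
      have hc : code (pfar (hd hw he)).1 = (.right, opening (plus w) .right e) :=
        (code_far _).trans (by rw [lab_hd])
      refine ⟨some (hd hw hk), (vert_eq_iff hw _ _).2 ?_⟩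
      simp only [Option.elim]
      rw [hc]
      rcases code_child hw (hd hw hk) with ⟨-, h1⟩ | ⟨h0, h1, -⟩
      · rw [h1, lab_hd]
      · rw [lab_hd] at h0 h1
        exact absurd (opening_opening hu .right e) ((opening_left_or_right hw hk).1 ⟨h0, h1⟩)

/-- The head of the edge of a half-edge of `P_w`. -/
noncomputable def headOf (x : (partitionTree w).D) : Option (Head w) :=
  match x.1 with
  | Sum.inl _ => none
  | Sum.inr (Sum.inl h) => some h
  | Sum.inr (Sum.inr h) => some h

theorem headOf_opp (x : (partitionTree w).D) : headOf ((partitionTree w).opp x) = headOf x := by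
  rcases partitionTree_cases x with rfl | ⟨h, rfl⟩ | ⟨h, rfl⟩ <;> rfl

theorem card_Edge : Nat.card (partitionTree w).Edge = Nat.card (Head w) := by
  have key : ∀ {x y : (partitionTree w).D},
      orbitOf (partitionTree w).opp x = orbitOf (partitionTree w).opp y → headOf x = headOf y :=
    fun h => eq_of_sameCycle headOf_opp (Quotient.exact h)
  refine (Nat.card_congr (Equiv.ofBijective (fun h : Head w =>
    (⟨orbitOf (partitionTree w).opp (pnear h), fun e => ?_⟩ : (partitionTree w).Edge)) ⟨?_, ?_⟩)).symm
  · cases key e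
  · intro h h' e
    exact Option.some.inj (key (Subtype.mk.inj e))
  · rintro ⟨o, ho⟩
    obtain ⟨x, rfl⟩ := Quotient.exists_rep o
    rcases partitionTree_cases x with rfl | ⟨h, rfl⟩ | ⟨h, rfl⟩
    · exact absurd rfl ho
    · exact ⟨h, rfl⟩
    · exact ⟨h, Subtype.ext (Quotient.sound ⟨1, by simp [partitionTree_opp_near]⟩)⟩

theorem partitionTree_one_face (hw : IsPrefixShuffle w) :
    Nat.card (Orbit (partitionTree w).face) = 1 := by
  rw [Nat.card_eq_one_iff_unique]
  refine ⟨⟨?_⟩, ⟨orbitOf _ (partitionTree w).root⟩⟩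
  rintro ⟨x⟩ ⟨y⟩
  exact Quotient.sound ((isoTheta hw).face_sameCycle (theta_face_sameCycle _ _))

theorem partitionTree_isTree (hw : IsPrefixShuffle w) : (partitionTree w).IsTree where
  opp_opp x := by
    rcases partitionTree_cases x with rfl | ⟨h, rfl⟩ | ⟨h, rfl⟩
    · rw [partitionTree_opp_root, partitionTree_opp_root]
    · rfl
    · rfl
  opp_eq_self x := by
    rcases partitionTree_cases x with rfl | ⟨h, rfl⟩ | ⟨h, rfl⟩
    · simp [partitionTree_opp_root]
    · rw [partitionTree_opp_near]
      constructor <;> intro h' <;> cases congrArg Subtype.val h'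
    · rw [partitionTree_opp_far]
      constructor <;> intro h' <;> cases congrArg Subtype.val h'
  rotation := partitionTree_rotation
  connected := (isoTheta hw).connected theta_connected
  euler := by rw [partitionTree_one_face hw, card_V hw, card_Edge]
  one_face := partitionTree_one_face hw

end PrefixMap

/-! ### Leaves and active vertices -/

namespace PrefixMap

open BinTree

variable {w : List Letter}

theorem exists_label_of_leaf (hw : IsPrefixShuffle w) (l : (lambda₁ w).Leaf) :
    ∃ s e, IsLabel (plus w) e ∧ l.1 = s :: addr (plus w) e := by
  rcases hl : l.1 with _ | ⟨s, p⟩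
  · have h := l.2.not_isNode
    rw [hl, ← addr_zero (u := plus w)] at h
    exact absurd (isNode_addr hw (isLabel_zero _)) h
  · have h := l.2.isVertex
    rw [hl, isVertex_cons, isNode_iff hw] at h
    obtain ⟨e, he, rfl⟩ := h
    exact ⟨s, e, he, rfl⟩

theorem eq_pvert_near (hw : IsPrefixShuffle w) {x : PVertex w} {l : (lambda₁ w).Leaf}
    (h : (isoTheta hw).onV x = l.vertex) {e : ℕ} (he : IsLabel (plus w) e)
    (hl : l.1 = .left :: addr (plus w) e) : x = pvert (near (hd hw he)) := by
  apply (isoTheta hw).onV.injective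
  rw [h]
  refine Eq.trans ?_ (isoTheta_onV hw (pnear (hd hw he))).symm
  rw [toTheta_near, theta_vert_thetaHalf]
  exact thetaVertex_congr (hp := l.2.isVertex) hl

theorem eq_pvert_far (hw : IsPrefixShuffle w) {x : PVertex w} {l : (lambda₁ w).Leaf}
    (h : (isoTheta hw).onV x = l.vertex) {e : ℕ} (he : IsLabel (plus w) e)
    (hl : l.1 = .right :: addr (plus w) e) : x = pvert (far (hd hw he)) := by
  apply (isoTheta hw).onV.injective
  rw [h]
  refine Eq.trans ?_ (isoTheta_onV hw (pfar (hd hw he))).symm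
  rw [toTheta_far, theta_vert_thetaHalf]
  exact thetaVertex_congr (hp := l.2.isVertex) hl

theorem actives_lambda₁ (hw : IsPrefixShuffle w) : (lambda₁ w).actives =
    stackLeaves (plus w) (stk (plus w) .left w.length) (stk (plus w) .right w.length) := by
  have h := (lambda₁_spec (isPrefixShuffle_plus hw) w.length).1
  rwa [take_plus] at h

theorem mem_actives_lambda₁ (hw : IsPrefixShuffle w) {s : Side} {e : ℕ}
    (he : IsLabel (plus w) e) : s :: addr (plus w) e ∈ (lambda₁ w).actives ↔
      ∃ k, (k, e) ∈ stk (plus w) s w.length := by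
  have hu := isPrefixShuffle_plus hw
  rw [actives_lambda₁ hw, stackLeaves, List.mem_append, List.mem_reverse, List.mem_map,
    List.mem_map]
  constructor
  · rintro (⟨⟨k, e'⟩, h, h'⟩ | ⟨⟨k, e'⟩, h, h'⟩) <;>
    · obtain ⟨rfl, ha⟩ := List.cons.inj h'
      obtain rfl := addr_inj hw (mem_stk hu h).2.2.2.2.1 he ha
      exact ⟨k, h⟩
  · rintro ⟨k, h⟩
    cases s
    · exact Or.inl ⟨_, h, rfl⟩
    · exact Or.inr ⟨_, h, rfl⟩

theorem leaf_isActive_iff (hw : IsPrefixShuffle w) {l : (lambda₁ w).Leaf} {s : Side} {e : ℕ}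
    (he : IsLabel (plus w) e) (hl : l.1 = s :: addr (plus w) e) :
    l.IsActive ↔ ∃ k, (k, e) ∈ stk (plus w) s w.length := by
  rw [← mem_actives_lambda₁ hw he, ← hl]
  exact mem_actives.symm

theorem leaf_isActive_iff_isOpened (hw : IsPrefixShuffle w) {l : (lambda₁ w).Leaf} {s : Side}
    {e : ℕ} (he : IsLabel (plus w) e) (hl : l.1 = s :: addr (plus w) e) :
    l.IsActive ↔ IsOpened (plus w) s w.length (opening (plus w) s e) := by
  have hu := isPrefixShuffle_plus hw
  rw [leaf_isActive_iff hw he hl]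
  constructor
  · rintro ⟨k, h⟩
    exact ⟨e, by rwa [(mem_stk hu h).2.2.1]⟩
  · rintro ⟨e', h⟩
    obtain ⟨-, -, ho, -, he', -⟩ := mem_stk hu h
    have hm := mem_actives.1 ((mem_actives_lambda₁ hw he').2 ⟨_, h⟩)
    have hv : Leaf.vertex (⟨_, ⟨_, hm⟩⟩ : (lambda₁ w).Leaf) = l.vertex := by
      apply thetaTop_injective
      change chainTop (s :: addr (plus w) e') = chainTop l.1
      rw [hl, chainTop_addr hu _ _ he', chainTop_addr hu _ _ he, ho]
    have h1 := (congrArg Subtype.val (Leaf.vertex_injective hv)).trans hl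
    obtain rfl := addr_inj hw he' he (List.cons.inj h1).2
    exact ⟨_, h⟩

theorem stk_left_length (w : List Letter) :
    stk (plus w) .left w.length = stk (plus w) .left (plus w).length := by
  have key : ∀ n, w.length ≤ n → n ≤ (plus w).length →
      stk (plus w) .left n = stk (plus w) .left w.length := by
    intro n hn
    induction n, hn using Nat.le_induction with
    | base => exact fun _ => rfl
    | succ n hn ih =>
      intro h
      rw [stk_other (s := .left) (getElem?_plus_of_le hn h), ih (by omega)]
  exact (key _ (length_le_plus w) le_rfl).symm

theorem isOpened_left_length (w : List Letter) (k : ℕ) :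
    IsOpened (plus w) .left w.length k ↔ IsOpened (plus w) .left (plus w).length k := by
  rw [IsOpened, IsOpened, stk_left_length]

theorem faceOf_near_ne_far (hw : IsPrefixShuffle w) (h h' : Head w) :
    faceOf (near h) ≠ faceOf (far h') := by
  intro e
  cases (Prod.mk.inj (owner_eq_of_faceOf hw e)).1

theorem isWhite_near (h : Head w) : IsWhite (pvert (near h)) := by
  by_cases hf : faceOf (near h) = rootFace w
  · by_cases hex : ∃ h' : Dangling w, IsLastDanglingBefore h' (near h)
    · obtain ⟨h', H⟩ := hex
      rw [pvert_of_last hf H]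
      trivial
    · rw [pvert_of_not hf hex]
      exact ⟨root w, rfl⟩
  · rw [pvert_of_ne hf]
    exact ⟨ccw w h.1, by rw [← starFace_near, faceOf_starFace]⟩

theorem not_isBlack_near (hw : IsPrefixShuffle w) (h : Head w) : ¬ IsBlack (pvert (near h)) := by
  by_cases hf : faceOf (near h) = rootFace w
  · by_cases hex : ∃ h' : Dangling w, IsLastDanglingBefore h' (near h)
    · obtain ⟨h', H⟩ := hex
      rw [pvert_of_last hf H]
      exact id
    · rw [pvert_of_not hf hex]
      rintro ⟨h', e⟩
      exact faceOf_far_ne hw h' e.symm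
  · rw [pvert_of_ne hf]
    rintro ⟨h', e⟩
    exact faceOf_near_ne_far hw h h' e

theorem isBlack_far (hw : IsPrefixShuffle w) (h : Head w) : IsBlack (pvert (far h)) := by
  rw [pvert_far hw]
  exact ⟨h, rfl⟩

theorem not_isWhite_far (hw : IsPrefixShuffle w) (h : Head w) : ¬ IsWhite (pvert (far h)) := by
  rw [pvert_far hw]
  rintro ⟨d, e⟩
  cases (Prod.mk.inj (owner_eq_of_faceOf hw e)).1

theorem isActive_near_iff (hw : IsPrefixShuffle w) {e : ℕ} (he : IsLabel (plus w) e) :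
    IsActive (pvert (near (hd hw he))) ↔
      IsOpened (plus w) .left (plus w).length (opening (plus w) .left e) := by
  have hu := isPrefixShuffle_plus hw
  have hk := isLabel_opening hu .left e
  have hkk := opening_opening hu .left e
  rw [pvert_near_opening hw he hk]
  generalize opening (plus w) .left e = k at hk hkk
  by_cases ho : IsOpened (plus w) .left (plus w).length k
  · refine iff_of_true ?_ ho
    by_cases h0 : k = 0
    · subst h0
      rw [pvert_near_zero hw]
      exact Or.inl rfl
    · rw [pvert_near_dangling hw hk ((isDangling_pos hw hk.le).2 ⟨h0, ho⟩)]
      trivial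
  · refine iff_of_false ?_ ho
    have hne := pvert_near_of_not_isOpened hw hk hkk ho
    rw [pvert_of_ne hne]
    rintro (h | ⟨h, -, h'⟩)
    · exact hne h
    · exact faceOf_near_ne_far hw _ h h'

theorem isPaired_append {c c' : Letter} {u v : List Letter} {i j : ℕ} :
    IsPaired c c' u i j ↔ IsPaired c c' (u ++ v) i j ∧ j < u.length := by
  have key : j < u.length → i < j → (IsPaired c c' u i j ↔ IsPaired c c' (u ++ v) i j) := by
    intro hj hij
    have hs : subwordBetween c c' (u ++ v) i j = subwordBetween c c' u i j := by
      unfold subwordBetween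
      rw [List.drop_append_of_le_length (by omega),
        List.take_append_of_le_length (by rw [List.length_drop]; omega)]
    rw [IsPaired, IsPaired, hs, List.getElem?_append_left hj, List.getElem?_append_left (by omega)]
  constructor
  · intro h
    exact ⟨(key (IsPaired.lt_length h) h.1).1 h, IsPaired.lt_length h⟩
  · rintro ⟨h, hj⟩
    exact (key hj h.1).2 h

theorem isRooting_iff (hw : IsPrefixShuffle w) (h : Head w) : IsRooting w h.1 ↔
    opening (plus w) .right (lab h) = lab h ∧ IsOpened (plus w) .right w.length (lab h) := by
  have hu := isPrefixShuffle_plus hw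
  have key : ∀ {i}, (plus w)[i]? = some .a →
      (IsOpened (plus w) .right w.length (i + 1) ↔ ¬ ∃ k, IsPaired .a .abar w i k) := by
    intro i hi
    have hlt : i < w.length := label_le (Or.inr ⟨i, rfl, .right, hi⟩)
    rw [isOpened_iff (s := .right) hu hi hlt]
    refine not_congr (exists_congr fun k => ?_)
    rw [isPaired_append (u := w) (v := List.replicate (w.count .a - w.count .abar) .abar), and_comm]
    rfl
  constructor
  · rintro (h0 | ⟨i, j, h1, h2, h3⟩)
    · have : lab h = 0 := by
        rw [lab, h0, treeOpp_root]
        rfl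
      rw [this]
      exact ⟨rfl, isOpened_zero hu _ _⟩
    · have : lab h = i + 1 := by
        rw [lab, ← pos_val_self h.1, h1, treeOpp_eq (linked_pos h2).symm, pos_val]
        have := h2.1
        have := IsPaired.lt_length h2
        omega
      rw [this]
      exact ⟨opening_open (s := .right) h2.2.1, (key h2.2.1).2 h3⟩
  · obtain ⟨e, he, rfl⟩ := exists_hd hw h
    rw [lab_hd]
    rintro ⟨h1, h2⟩
    rcases he.cases with rfl | ⟨n, rfl, hn⟩ | ⟨n, rfl, hn⟩
    · exact Or.inl (hd_zero hw he)
    · obtain ⟨j, hj⟩ := exists_paired_a hw hn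
      refine Or.inr ⟨n, j, ?_, hj, (key hn).1 h2⟩
      rw [hd_val, treeOpp_eq (linked_pos hj), pos_val (IsPaired.lt_length hj)]
    · rw [opening_touch (s := .right) hu hn] at h1
      have := opening_lt hu .right n
      omega

theorem opening_right_eq_of_cell (hw : IsPrefixShuffle w) {e : ℕ} (he : IsLabel (plus w) e)
    {h : Head w} (hr : IsRooting w h.1) (hc : faceOf (far (hd hw he)) = cell h) :
    opening (plus w) .right e = lab h := by
  have h1 := owner_eq_of_faceOf hw hc
  rw [owner_far, owner_far, lab_hd, ((isRooting_iff hw h).1 hr).1] at h1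
  exact (Prod.mk.inj h1).2

theorem isActive_far_iff (hw : IsPrefixShuffle w) {e : ℕ} (he : IsLabel (plus w) e) :
    IsActive (pvert (far (hd hw he))) ↔
      IsOpened (plus w) .right w.length (opening (plus w) .right e) := by
  have hu := isPrefixShuffle_plus hw
  have hk := isLabel_opening hu .right e
  rw [pvert_far hw]
  constructor
  · rintro (h | ⟨h, h1, h2⟩)
    · exact absurd h (faceOf_far_ne hw _)
    · rw [opening_right_eq_of_cell hw he h1 h2]
      exact ((isRooting_iff hw h).1 h1).2
  · intro h
    refine Or.inr ⟨hd hw hk, (isRooting_iff hw _).2 ?_, faceOf_far_opening hw he hk⟩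
    rw [lab_hd]
    exact ⟨opening_opening hu _ _, h⟩

/-! ### The orders on the active vertices -/

theorem pairwise_actives (B : BinTree) :
    B.actives.Pairwise (fun p q => B.leafList.idxOf p < B.leafList.idxOf q) :=
  (nodup_leafList B).pairwise_idxOf.sublist (actives_sublist B)

theorem idxOf_left_lt_iff (hw : IsPrefixShuffle w) {x y : ℕ × ℕ}
    (hx : x ∈ stk (plus w) .left w.length) (hy : y ∈ stk (plus w) .left w.length) :
    (lambda₁ w).leafList.idxOf (.left :: addr (plus w) x.2) <
      (lambda₁ w).leafList.idxOf (.left :: addr (plus w) y.2) ↔ x.1 < y.1 := by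
  have h := pairwise_actives (lambda₁ w)
  rw [actives_lambda₁ hw, stackLeaves] at h
  have h := (List.pairwise_append.1 h).1
  rw [List.pairwise_reverse, List.pairwise_map] at h
  exact h.iff_of_asymm (stk_pairwise (isPrefixShuffle_plus hw) .left w.length)
    (fun _ _ => lt_asymm) (fun _ _ => lt_asymm) y hy x hx

theorem idxOf_right_lt_iff (hw : IsPrefixShuffle w) {x y : ℕ × ℕ}
    (hx : x ∈ stk (plus w) .right w.length) (hy : y ∈ stk (plus w) .right w.length) :
    (lambda₁ w).leafList.idxOf (.right :: addr (plus w) x.2) <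
      (lambda₁ w).leafList.idxOf (.right :: addr (plus w) y.2) ↔ y.1 < x.1 := by
  have h := pairwise_actives (lambda₁ w)
  rw [actives_lambda₁ hw, stackLeaves] at h
  have h := (List.pairwise_append.1 h).2.1
  rw [List.pairwise_map] at h
  exact h.iff_of_asymm (stk_pairwise (isPrefixShuffle_plus hw) .right w.length)
    (fun _ _ => lt_asymm) (fun _ _ => lt_asymm) x hx y hy

theorem whiteRank_near (hw : IsPrefixShuffle w) {e : ℕ} (he : IsLabel (plus w) e)
    (h : IsOpened (plus w) .left (plus w).length (opening (plus w) .left e)) :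
    whiteRank (pvert (near (hd hw he))) = rank (old (pos w (opening (plus w) .left e))) := by
  have hk := isLabel_opening (isPrefixShuffle_plus hw) .left e
  rw [pvert_near_opening hw he hk]
  generalize opening (plus w) .left e = k at h hk
  by_cases h0 : k = 0
  · subst h0
    rw [pvert_near_zero hw, pos_zero, rank_root]
    rfl
  · rw [pvert_near_dangling hw hk ((isDangling_pos hw hk.le).2 ⟨h0, h⟩)]
    rfl

theorem rank_lt_rank_iff (hw : IsPrefixShuffle w) {k k' : ℕ} (hk : IsLabel (plus w) k)
    (hk' : IsLabel (plus w) k') (h : IsOpened (plus w) .left (plus w).length k)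
    (h' : IsOpened (plus w) .left (plus w).length k') :
    rank (old (pos w k)) < rank (old (pos w k')) ↔ k < k' := by
  refine ⟨fun hlt => ?_, rank_lt_rank hw hk hk' h h'⟩
  by_contra hle
  rcases (not_lt.1 hle).eq_or_lt with rfl | h1
  · exact lt_irrefl _ hlt
  · exact lt_asymm hlt (rank_lt_rank hw hk' hk h' h h1)

theorem firstVisit_lt (hw : IsPrefixShuffle w) {h h' : Head w}
    (ho : opening (plus w) .right (lab h') = lab h') (hlt : lab h < lab h') :
    firstVisit w h.1 < firstVisit w h'.1 := by
  have h1 : firstVisit w h.1 ≤ lab h + 1 := by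
    have h2 : firstVisit w h.1 ≤ (ccw w h.1).val := Nat.sInf_le ⟨_, ⟨1, by simp⟩, rfl⟩
    have h3 : (ccw w h.1).val ≤ lab h + 1 := by
      conv_lhs => rw [← hd_lab hw h, ccw_hd]
      exact Nat.mod_le _ _
    exact h2.trans h3
  obtain ⟨d, h2, h3⟩ : firstVisit w h'.1 ∈ {n | ∃ e : HalfEdge w, (ccw w).SameCycle h'.1 e ∧ e.val = n} :=
    Nat.sInf_mem ⟨_, _, Perm.SameCycle.refl _ _, rfl⟩
  have h4 := opening_right_of_sameCycle hw h2
  rw [opening_right_head hw, ho, h3] at h4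
  have h5 := opening_lt (isPrefixShuffle_plus hw) .right (firstVisit w h'.1 - 1)
  omega

theorem firstVisit_lt_iff (hw : IsPrefixShuffle w) {h h' : Head w}
    (ho : opening (plus w) .right (lab h) = lab h)
    (ho' : opening (plus w) .right (lab h') = lab h') :
    firstVisit w h.1 < firstVisit w h'.1 ↔ lab h < lab h' := by
  refine ⟨fun hlt => ?_, firstVisit_lt hw ho'⟩
  by_contra hle
  rcases (not_lt.1 hle).eq_or_lt with h1 | h1
  · rw [lab_injective hw h1] at hlt
    exact lt_irrefl _ hlt
  · exact lt_asymm hlt (firstVisit_lt hw ho h1)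

theorem blackPrecedes_far_iff (hw : IsPrefixShuffle w) {e e' : ℕ} (he : IsLabel (plus w) e)
    (he' : IsLabel (plus w) e')
    (h : IsOpened (plus w) .right w.length (opening (plus w) .right e))
    (h' : IsOpened (plus w) .right w.length (opening (plus w) .right e')) :
    BlackPrecedes (pvert (far (hd hw he))) (pvert (far (hd hw he'))) ↔
      opening (plus w) .right e < opening (plus w) .right e' := by
  have hu := isPrefixShuffle_plus hw
  constructor
  · rintro ⟨h1, h2, hr, hr', hx, hy, hlt⟩
    rw [pvert_far hw] at hx hy
    rw [opening_right_eq_of_cell hw he hr (Sum.inl_injective hx),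
      opening_right_eq_of_cell hw he' hr' (Sum.inl_injective hy)]
    exact (firstVisit_lt_iff hw ((isRooting_iff hw h1).1 hr).1
      ((isRooting_iff hw h2).1 hr').1).1 hlt
  · intro hlt
    have hk := isLabel_opening hu .right e
    have hk' := isLabel_opening hu .right e'
    refine ⟨hd hw hk, hd hw hk', (isRooting_iff hw _).2 ?_, (isRooting_iff hw _).2 ?_, ?_, ?_, ?_⟩
    · rw [lab_hd]
      exact ⟨opening_opening hu _ _, h⟩
    · rw [lab_hd]
      exact ⟨opening_opening hu _ _, h'⟩
    · rw [pvert_far_opening hw he hk, pvert_far hw]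
      rfl
    · rw [pvert_far_opening hw he' hk', pvert_far hw]
      rfl
    · apply firstVisit_lt hw
      · rw [lab_hd, opening_opening hu]
      · rwa [lab_hd, lab_hd]

theorem active_and_color_iff (hw : IsPrefixShuffle w) (x : PVertex w) (l : (lambda₁ w).Leaf)
    (h : (isoTheta hw).onV x = l.vertex) :
    (IsActive x ↔ l.IsActive) ∧ (IsWhite x ↔ IsLeftSon l.1) ∧ (IsBlack x ↔ IsRightSon l.1) := by
  obtain ⟨s, e, he, hl⟩ := exists_label_of_leaf hw l
  rw [leaf_isActive_iff_isOpened hw he hl]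
  cases s
  · obtain rfl := eq_pvert_near hw h he hl
    rw [isActive_near_iff hw he, isOpened_left_length, hl]
    exact ⟨Iff.rfl, iff_of_true (isWhite_near _) rfl,
      iff_of_false (not_isBlack_near hw _) (by simp [IsRightSon])⟩
  · obtain rfl := eq_pvert_far hw h he hl
    rw [isActive_far_iff hw he, hl]
    exact ⟨Iff.rfl, iff_of_false (not_isWhite_far hw _) (by simp [IsLeftSon]),
      iff_of_true (isBlack_far hw _) rfl⟩

theorem whitePrecedes_iff (hw : IsPrefixShuffle w) (x y : PVertex w) (l m : (lambda₁ w).Leaf)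
    (hx : (isoTheta hw).onV x = l.vertex) (hy : (isoTheta hw).onV y = m.vertex)
    (ax : IsActive x) (ay : IsActive y) (wx : IsWhite x) (wy : IsWhite y) :
    WhitePrecedes x y ↔ l.Precedes m := by
  have hu := isPrefixShuffle_plus hw
  obtain ⟨al, cl, -⟩ := active_and_color_iff hw x l hx
  obtain ⟨am, cm, -⟩ := active_and_color_iff hw y m hy
  obtain ⟨s, e, he, hl⟩ := exists_label_of_leaf hw l
  obtain ⟨t, f, hf, hm⟩ := exists_label_of_leaf hw m
  obtain rfl : s = .left := by
    have := cl.1 wx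
    rw [hl] at this
    exact Option.some.inj this
  obtain rfl : t = .left := by
    have := cm.1 wy
    rw [hm] at this
    exact Option.some.inj this
  obtain ⟨k, hk⟩ := (leaf_isActive_iff hw he hl).1 (al.1 ax)
  obtain ⟨j, hj⟩ := (leaf_isActive_iff hw hf hm).1 (am.1 ay)
  have hp : l.Precedes m ↔ k < j := by
    rw [Leaf.Precedes, hl, hm]
    exact idxOf_left_lt_iff hw hk hj
  have ek := (mem_stk hu hk).2.2.1
  have ej := (mem_stk hu hj).2.2.1
  obtain rfl := eq_pvert_near hw hx he hl
  obtain rfl := eq_pvert_near hw hy hf hm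
  have ox := (isActive_near_iff hw he).1 ax
  have oy := (isActive_near_iff hw hf).1 ay
  rw [hp, ← ek, ← ej, ← rank_lt_rank_iff hw (isLabel_opening hu _ _) (isLabel_opening hu _ _) ox oy,
    ← whiteRank_near hw he ox, ← whiteRank_near hw hf oy]
  exact ⟨fun h => h.2.2, fun h => ⟨⟨wx, ax⟩, ⟨wy, ay⟩, h⟩⟩

theorem blackPrecedes_iff (hw : IsPrefixShuffle w) (x y : PVertex w) (l m : (lambda₁ w).Leaf)
    (hx : (isoTheta hw).onV x = l.vertex) (hy : (isoTheta hw).onV y = m.vertex)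
    (ax : IsActive x) (ay : IsActive y) (bx : IsBlack x) (yb : IsBlack y) :
    BlackPrecedes x y ↔ m.Precedes l := by
  have hu := isPrefixShuffle_plus hw
  obtain ⟨al, -, cl⟩ := active_and_color_iff hw x l hx
  obtain ⟨am, -, cm⟩ := active_and_color_iff hw y m hy
  obtain ⟨s, e, he, hl⟩ := exists_label_of_leaf hw l
  obtain ⟨t, f, hf, hm⟩ := exists_label_of_leaf hw m
  obtain rfl : s = .right := by
    have := cl.1 bx
    rw [hl] at this
    exact Option.some.inj this
  obtain rfl : t = .right := by
    have := cm.1 yb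
    rw [hm] at this
    exact Option.some.inj this
  obtain ⟨k, hk⟩ := (leaf_isActive_iff hw he hl).1 (al.1 ax)
  obtain ⟨j, hj⟩ := (leaf_isActive_iff hw hf hm).1 (am.1 ay)
  have hp : m.Precedes l ↔ k < j := by
    rw [Leaf.Precedes, hl, hm]
    exact idxOf_right_lt_iff hw hj hk
  obtain rfl := eq_pvert_far hw hx he hl
  obtain rfl := eq_pvert_far hw hy hf hm
  rw [hp, blackPrecedes_far_iff hw he hf ((isActive_far_iff hw he).1 ax)
    ((isActive_far_iff hw hf).1 ay), (mem_stk hu hk).2.2.1, (mem_stk hu hj).2.2.1]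

end PrefixMap

open PrefixMap in
theorem mainTheorem6 (w : List Letter) (hw : IsPrefixShuffle w) :
    (partitionTree w).IsTree ∧
    Function.Bijective (BinTree.Leaf.vertex (B := lambda₁ w)) ∧
    ∃ φ : (partitionTree w).Iso (lambda₁ w).theta,
      (∀ (x : PVertex w) (l : (lambda₁ w).Leaf), φ.onV x = l.vertex →
        (IsActive x ↔ l.IsActive) ∧
        (IsWhite x ↔ BinTree.IsLeftSon l.1) ∧
        (IsBlack x ↔ BinTree.IsRightSon l.1)) ∧
      (∀ (x y : PVertex w) (l m : (lambda₁ w).Leaf), φ.onV x = l.vertex → φ.onV y = m.vertex →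
        (IsActive x → IsActive y → IsWhite x → IsWhite y → (WhitePrecedes x y ↔ l.Precedes m)) ∧
        (IsActive x → IsActive y → IsBlack x → IsBlack y →
          (BlackPrecedes x y ↔ m.Precedes l))) :=
  ⟨partitionTree_isTree hw, ⟨BinTree.Leaf.vertex_injective, BinTree.Leaf.vertex_surjective⟩,
    isoTheta hw, active_and_color_iff hw, fun x y l m hx hy =>
      ⟨whitePrecedes_iff hw x y l m hx hy, blackPrecedes_iff hw x y l m hx hy⟩⟩
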